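/- For a planar convex body $K$ (a non-empty compact convex subset of the euclidean plane) let $r(K)$, $w(K)$, $D(K)$, $R(K)$ denote its inradius, minimal width, diameter and circumradius, and put $$\ell_1(r)=2r,\qquad \ell_2(D,R)=\frac{D^2\sqrt{4R^2-D^2}}{2R^2},$$ $$\ell_3(r,D,R)=2D\sqrt{1-\Bigl(\tfrac{D}{2R}\Bigr)^2}\;\cos\Bigl[\arccos\Bigl(\tfrac{D}{2(D-r)}\Bigr)+\arccos\Bigl(\tfrac{D}{2R}\Bigr)-\arcsin\Bigl(\tfrac{r}{D-r}\Bigr)\Bigr]$$ (with $\ell_3$ read as $0$ for a single point, where $r=D=R=0$). *Bent pentagons.* Let $R>0$, $r\in[0,R]$, $\gamma\in[0,\pi/3]$, let $p^1,p^2,p^3$ lie on a circle of radius $R$ with $|p^1-p^2|=|p^1-p^3|=2R\cos(\gamma/2)=:d$ and angle $\gamma$ at $p^1$, and let $T=\mathrm{conv}\{p^1,p^2,p^3\}$. Let $B$ be a ball of radius $r$, with center $c$ on the same side of the line $p^1p^2$ as $p^3$, touching from inside the circles of radius $d$ around $p^1$ and $p^2$ (that is, $|c-p^1|=|c-p^2|=d-r$).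 Let $L_1$ be the one of the lines through $p^2$ supporting $B$ that has the smaller angle with $[p^1,p^2]$, and let $L_2$ be the parallel to $L_1$ through $p^3$. Let $P$ be the set of all points between $L_1$ and $L_2$ (inclusive) at distance at most $d$ from each of $p^1,p^2,p^3$. If $T\subset P$, $B\subset P$, $r(P)=r$, and $w(P)$ is the distance of $L_1$ and $L_2$, then $P$ is called a bent pentagon. *Diagrams.* Let $\mathcal F\subset\mathbb R^3$ be the set of all points $\bigl(\tfrac{r(K)}{R(K)},\tfrac{w(K)}{2R(K)},\tfrac{D(K)}{2R(K)}\bigr)$ and $\mathcal G\subset\mathbb R^2$ the set of all points $\bigl(\tfrac{r(K)}{R(K)},\tfrac{D(K)}{2R(K)}\bigr)$, where $K$ runs over the planar convex bodies with more than one point. The lower boundary of $\mathcal F$ is the set of those $(x,y,z)\in\mathcal F$ such that $y\le y'$ whenever $(x,y',z)\in\mathcal F$. **Theorem.** 1. Every planar convex body $K$ satisfies $w(K)\ge \ell_3\bigl(r(K),D(K),R(K)\bigr)$. 2. Every bent pentagon $P$ satisfies $w(P)=\ell_3\bigl(r(P),D(P),R(P)\bigr)$. 3. If $K$ is a planar convex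 body with $r(K)>0$ such that $\ell_3(r(K),D(K),R(K))\ge \ell_1(r(K))$ and $\ell_3(r(K),D(K),R(K))\ge \ell_2(D(K),R(K))$, then there is a bent pentagon with the same inradius, diameter and circumradius as $K$. 4. The lower boundary of $\mathcal F$ is exactly the set of all $(x,y,z)$ with $(x,z)\in\mathcal G$ and $$2y=\max\bigl\{\ell_1(x),\ \ell_2(2z,1),\ \ell_3(x,2z,1)\bigr\}.$$ -/

import Mathlib

open scoped InnerProductSpace EuclideanGeometry Real

noncomputable section

namespace BlaschkeSantalo

/-- The euclidean plane. -/
abbrev Plane : Type := EuclideanSpace ℝ (Fin 2)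

/-! ### The four radii -/

/-- The breadth of `K` in the direction of a unit vector `u`: the distance between the two
supporting lines of `K` orthogonal to `u`. -/
def breadth (K : Set Plane) (u : Plane) : ℝ :=
  sSup ((fun x => ⟪u, x⟫_ℝ) '' K) - sInf ((fun x => ⟪u, x⟫_ℝ) '' K)

/-- The (minimal) width `w(K)`: the smallest breadth. -/
def width (K : Set Plane) : ℝ :=
  sInf (breadth K '' Metric.sphere (0 : Plane) 1)

/-- The inradius `r(K)`: the radius of a biggest ball contained in `K`. -/
def inradius (K : Set Plane) : ℝ :=
  sSup {ρ : ℝ | 0 ≤ ρ ∧ ∃ c : Plane, Metric.closedBall c ρ ⊆ K}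

/-- The circumradius `R(K)`: the radius of the smallest ball containing `K`. -/
def circumradius (K : Set Plane) : ℝ :=
  sInf {ρ : ℝ | 0 ≤ ρ ∧ ∃ c : Plane, K ⊆ Metric.closedBall c ρ}

/-- The diameter `D(K)`. -/
def diameter (K : Set Plane) : ℝ := Metric.diam K

/-! ### The lower bounds for the width -/

/-- The lower bound `2r`. -/
def lowerBound₁ (r : ℝ) : ℝ := 2 * r

/-- The lower bound `D² √(4R² - D²) / (2R²)`; for `w ≥ 0`, `R > 0` and `D ≤ 2R`, the inequality
`lowerBound₂ D R ≤ w` is `(4R² - D²) D⁴ ≤ 4 w² R⁴`. -/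
def lowerBound₂ (D R : ℝ) : ℝ := D ^ 2 * √(4 * R ^ 2 - D ^ 2) / (2 * R ^ 2)

/-- The lower bound in terms of `r`, `D` and `R`. -/
def lowerBound₃ (r D R : ℝ) : ℝ :=
  2 * D * √(1 - (D / (2 * R)) ^ 2) *
    Real.cos (Real.arccos (D / (2 * (D - r))) + Real.arccos (D / (2 * R))
      - Real.arcsin (r / (D - r)))

/-! ### Bent pentagons -/

/-- The data from which a generalized bent pentagon is built.  The points `p₁, p₂, p₃` on the
circle with center `o` and radius `R` span an isosceles triangle with angle `γ ∈ [0, π/3]` at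
`p₁` and legs of length `D = 2R cos(γ/2)`.  The ball with center `c` and radius `r` touches from
inside the arcs of radius `D` around `p₁` and `p₂` (on the side of `p₁p₂` where `p₃` lies).
The vector `u` is a unit normal of the line `L₁` through `p₂`: this line supports the ball, and
among the lines through `p₂` supporting the ball it has the smaller angle with the segment
`[p₁, p₂]` (the sine of that angle being `|⟪u, p₁ - p₂⟫| / D`). -/
structure IsPentagonFrame (R r γ : ℝ) (o p₁ p₂ p₃ c u : Plane) : Prop where
  radius_pos : 0 < R
  r_mem : r ∈ Set.Icc 0 R
  angle_mem : γ ∈ Set.Icc 0 (π / 3)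
  dist_p₁ : dist p₁ o = R
  dist_p₂ : dist p₂ o = R
  dist_p₃ : dist p₃ o = R
  leg₂ : dist p₁ p₂ = 2 * R * Real.cos (γ / 2)
  leg₃ : dist p₁ p₃ = 2 * R * Real.cos (γ / 2)
  angle_eq : ∠ p₂ p₁ p₃ = γ
  tangent₁ : dist c p₁ = dist p₁ p₂ - r
  tangent₂ : dist c p₂ = dist p₁ p₂ - r
  same_side : (line[ℝ, p₁, p₂]).WSameSide c p₃
  norm_u : ‖u‖ = 1
  support : |⟪u, c - p₂⟫_ℝ| = r
  smaller_angle : ∀ v : Plane, ‖v‖ = 1 → |⟪v, c - p₂⟫_ℝ| = r →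
    |⟪u, p₁ - p₂⟫_ℝ| ≤ |⟪v, p₁ - p₂⟫_ℝ|

/-- The generalized bent pentagon: the region between the line `L₁` through `p₂` orthogonal to
`u`, the parallel line `L₂` through `p₃`, and the three arcs of radius `|p₁ - p₂|` around
`p₁, p₂, p₃`. -/
def pentagonRegion (p₁ p₂ p₃ u : Plane) : Set Plane :=
  {x | ⟪u, x⟫_ℝ ∈ Set.uIcc ⟪u, p₂⟫_ℝ ⟪u, p₃⟫_ℝ ∧
    dist x p₁ ≤ dist p₁ p₂ ∧ dist x p₂ ≤ dist p₁ p₂ ∧ dist x p₃ ≤ dist p₁ p₂}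

/-- A bent pentagon: a generalized bent pentagon that contains the isosceles triangle, has the
ball of the construction as an inball, and has the distance `|⟪u, p₃ - p₂⟫|` of the two parallel
lines as its width. -/
def IsBentPentagon (P : Set Plane) : Prop :=
  ∃ (R r γ : ℝ) (o p₁ p₂ p₃ c u : Plane),
    IsPentagonFrame R r γ o p₁ p₂ p₃ c u ∧
    P = pentagonRegion p₁ p₂ p₃ u ∧
    convexHull ℝ {p₁, p₂, p₃} ⊆ P ∧
    Metric.closedBall c r ⊆ P ∧ inradius P = r ∧
    width P = |⟪u, p₃ - p₂⟫_ℝ|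

/-! ### The Blaschke-Santaló diagrams -/

/-- The `(r, w, D, R)`-diagram: the points `(r/R, w/(2R), D/(2R))` of all convex bodies that are
not singletons. -/
def diagram : Set (ℝ × ℝ × ℝ) :=
  {q | ∃ K : ConvexBody Plane, (K : Set Plane).Nontrivial ∧
    q = (inradius K / circumradius K, width K / (2 * circumradius K),
      diameter K / (2 * circumradius K))}

/-- The `(r, D, R)`-diagram: the points `(r/R, D/(2R))` of all convex bodies that are not
singletons. -/
def diagramRDR : Set (ℝ × ℝ) :=
  {q | ∃ K : ConvexBody Plane, (K : Set Plane).Nontrivial ∧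
    q = (inradius K / circumradius K, diameter K / (2 * circumradius K))}

/-- The lower boundary of a set in space: its points whose second coordinate (the one of the
width) is least among the points of the set with the same first and third coordinates. -/
def lowerBoundary (S : Set (ℝ × ℝ × ℝ)) : Set (ℝ × ℝ × ℝ) :=
  {q | IsLeast {y : ℝ | (q.1, y, q.2.2) ∈ S} q.2.1}

end BlaschkeSantalo

end

open Metric Filter Topology

namespace BlaschkeSantalo

/-! ### Basic properties of the four radii -/

section Breadth

variable {K : Set Plane} {u : Plane}

/-! Jung's theorem allows one to write D = 2R cos(γ/2) with γ ∈ [0, π/3]. Put ρ = D − r, and let a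
and s be the angles with ρ cos a = R cos(γ/2) and ρ sin s = r. Then ℓ₃ = 2R sin γ cos(γ/2 − (s − a))
and ℓ₂ = 2R sin γ cos(γ/2). Both have the form 2R sin γ cos k, which is the breadth of an isosceles
triangle with apex angle γ, inscribed in the circumcircle and tilted by k.

The inequality. K contains a triangle inscribed in the circumcircle whose hull contains the
circumcenter. Its sides are at most D, so its central angles are at most π − γ. For a direction u
let p₁ be the vertex of middle height, at polar angle −k after reflections. The angle conditions
make the breadth at least 2R sin γ cos k' with k' = min(k, γ/2); this already gives ℓ₂. The inradius
enters through the incenter, which has distance at most ρ from every point of K. So the incenter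
lies in the disks of radius ρ around the two lower vertices, and its height is at most (E − R
sin(γ/2)) cos(γ/2 − k') with E = ρ sin a (`center_height_le`), unless the breadth is at least 2R sin
γ anyway. Comparing the lowest point of the inball with the highest vertex gives a second lower
bound for the breadth. In θ = γ/2 − k' the first bound increases and the second, in the relevant
range, decreases. They meet at θ = s − a with the common value ℓ₃ (`bound_le_of_alternatives`).

Equality. In a bent pentagon the center of the ball, seen from p₂, has inclination a + (γ/2 − k) to
the parallel lines, where k is the tilt of the triangle. Tangency to L₁ makes this angle s, so k =
γ/2 − (s − a) and the distance of the lines is ℓ₃. The pentagon has diameter D and circumradius R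
because it has diameter at most D, lies in the circumdisk and contains the triangle. Conversely,
take k = γ/2 − (s − a): ℓ₃ ≥ ℓ₂ means |k| ≤ γ/2, and ℓ₃ ≥ ℓ₁ means that the ball fits between the
lines (`exists_isBentPentagon`).

The lower boundary. It remains to find, for the radii of any K, a body whose width is at most the
greatest of the three bounds (`exists_width_eq`). The isosceles triangle T with apex angle γ has the
least inradius among bodies with given D and R (`le_inradius_of_apex_angle`). A body P ⊇ T with the
same D and R, inradius at least r and small breadth is either a pentagon region with a suitable tilt
or, if r ≥ R sin γ, the hull of T and a ball around the circumcenter. Minkowski interpolation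
between T and P then yields the inradius r exactly (`exists_inradius_eq`). -/

lemma bddAbove_inner_image (hK : IsCompact K) (u : Plane) :
    BddAbove ((fun x => ⟪u, x⟫_ℝ) '' K) :=
  hK.bddAbove_image (by fun_prop)

lemma bddBelow_inner_image (hK : IsCompact K) (u : Plane) :
    BddBelow ((fun x => ⟪u, x⟫_ℝ) '' K) :=
  hK.bddBelow_image (by fun_prop)

lemma inner_sub_inner_le_breadth (hK : IsCompact K) {x y : Plane} (hx : x ∈ K) (hy : y ∈ K) :
    ⟪u, x⟫_ℝ - ⟪u, y⟫_ℝ ≤ breadth K u :=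
  sub_le_sub (le_csSup (bddAbove_inner_image hK u) ⟨x, hx, rfl⟩)
    (csInf_le (bddBelow_inner_image hK u) ⟨y, hy, rfl⟩)

lemma breadth_le (hne : K.Nonempty) {a b : ℝ} (h : ∀ x ∈ K, ⟪u, x⟫_ℝ ∈ Set.Icc a b) :
    breadth K u ≤ b - a := by
  apply sub_le_sub
  · exact csSup_le (hne.image _) (by rintro _ ⟨x, hx, rfl⟩; exact (h x hx).2)
  · exact le_csInf (hne.image _) (by rintro _ ⟨x, hx, rfl⟩; exact (h x hx).1)

lemma breadth_nonneg (hK : IsCompact K) (hne : K.Nonempty) : 0 ≤ breadth K u := by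
  obtain ⟨x, hx⟩ := hne
  simpa using inner_sub_inner_le_breadth (u := u) hK hx hx

lemma width_le_breadth (hK : IsCompact K) (hne : K.Nonempty) (hu : ‖u‖ = 1) :
    width K ≤ breadth K u :=
  csInf_le ⟨0, by rintro _ ⟨v, -, rfl⟩; exact breadth_nonneg hK hne⟩ ⟨u, by simpa using hu, rfl⟩

lemma le_width {m : ℝ} (h : ∀ u : Plane, ‖u‖ = 1 → m ≤ breadth K u) : m ≤ width K := by
  apply le_csInf
  · exact Set.Nonempty.image _ (NormedSpace.sphere_nonempty.2 zero_le_one)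
  · rintro _ ⟨u, hu, rfl⟩
    exact h u (by simpa using hu)

lemma add_mem_of_closedBall_subset {c : Plane} {ρ : ℝ} (hρ : 0 ≤ ρ) (h : closedBall c ρ ⊆ K)
    (hu : ‖u‖ = 1) : c + ρ • u ∈ K ∧ c - ρ • u ∈ K := by
  constructor <;> apply h <;> simp [dist_eq_norm, norm_smul, hu, abs_of_nonneg hρ]

end Breadth

/-! ### Inradius and inball -/

section Inradius

variable {K : Set Plane}

lemma two_mul_le_diam {c : Plane} {ρ : ℝ} (hK : Bornology.IsBounded K) (hρ : 0 ≤ ρ)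
    (h : closedBall c ρ ⊆ K) : 2 * ρ ≤ diam K := by
  obtain ⟨u, hu⟩ := (NormedSpace.sphere_nonempty (E := Plane) (x := 0) (r := 1)).2 zero_le_one
  have hu : ‖u‖ = 1 := by simpa using hu
  obtain ⟨h1, h2⟩ := add_mem_of_closedBall_subset hρ h hu
  refine le_trans (le_of_eq ?_) (dist_le_diam_of_mem hK h1 h2)
  rw [dist_eq_norm, show c + ρ • u - (c - ρ • u) = (2 * ρ) • u by module, norm_smul, hu]
  simp [abs_of_nonneg hρ]

lemma le_inradius (hK : Bornology.IsBounded K) {c : Plane} {ρ : ℝ} (hρ : 0 ≤ ρ)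
    (h : closedBall c ρ ⊆ K) : ρ ≤ inradius K := by
  refine le_csSup ⟨diam K, ?_⟩ ⟨hρ, c, h⟩
  rintro σ ⟨hσ, d, hd⟩
  linarith [two_mul_le_diam hK hσ hd]

lemma inradius_le (hne : K.Nonempty) {m : ℝ}
    (h : ∀ (ρ : ℝ) (c : Plane), 0 ≤ ρ → closedBall c ρ ⊆ K → ρ ≤ m) : inradius K ≤ m := by
  obtain ⟨x, hx⟩ := hne
  refine csSup_le ⟨0, le_rfl, x, by simpa using hx⟩ ?_
  rintro σ ⟨hσ, d, hd⟩
  exact h σ d hσ hd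

lemma inradius_nonneg : 0 ≤ inradius K := Real.sSup_nonneg (by rintro σ ⟨hσ, -⟩; exact hσ)

/-- The inradius is attained. -/
lemma exists_inball (hK : IsCompact K) (hne : K.Nonempty) :
    ∃ c, closedBall c (inradius K) ⊆ K := by
  -- A center is a point of K farthest from the complement.
  obtain ⟨c, hc, hmax⟩ := hK.exists_isMaxOn hne (continuous_infDist_pt Kᶜ).continuousOn
  -- `infDist` to the empty set has the default value 0, so the comparison below needs a nonempty
  -- complement.
  have hKc : Kᶜ.Nonempty := by
    by_contra hcon
    rw [Set.not_nonempty_iff_eq_empty, Set.compl_empty_iff] at hcon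
    exact NormedSpace.noncompactSpace ℝ Plane |>.noncompact_univ (hcon ▸ hK)
  have hle : inradius K ≤ infDist c Kᶜ := by
    refine inradius_le hne fun ρ d hρ hd => ?_
    refine le_trans ?_ (hmax (hd (mem_closedBall_self hρ)))
    refine (le_infDist hKc).2 fun y hy => ?_
    by_contra hlt
    exact hy (hd (by rw [mem_closedBall, dist_comm]; exact (not_le.1 hlt).le))
  refine ⟨c, (closedBall_subset_closedBall hle).trans ?_⟩
  rcases eq_or_ne (infDist c Kᶜ) 0 with h0 | h0
  · rw [h0, closedBall_zero]; simpa using hc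
  · rw [← closure_ball c h0]
    exact closure_minimal ball_infDist_compl_subset hK.isClosed

/-- A ball in a closed ball. -/
lemma dist_add_le_of_closedBall_subset {c p : Plane} {ρ D : ℝ} (hρ : 0 ≤ ρ)
    (h : closedBall c ρ ⊆ closedBall p D) : dist c p + ρ ≤ D := by
  -- The point of the ball farthest from p lies in the direction w; for c = p every direction
  -- serves.
  obtain ⟨w, hw, hcw⟩ : ∃ w : Plane, ‖w‖ = 1 ∧ c - p = dist c p • w := by
    rcases eq_or_ne c p with rfl | hne
    · obtain ⟨u, hu⟩ := (NormedSpace.sphere_nonempty (E := Plane) (x := 0) (r := 1)).2 zero_le_one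
      exact ⟨u, by simpa using hu, by simp⟩
    · have : ‖c - p‖ ≠ 0 := by simpa [sub_eq_zero] using hne
      refine ⟨‖c - p‖⁻¹ • (c - p), by rw [norm_smul, norm_inv, norm_norm, inv_mul_cancel₀ this], ?_⟩
      rw [dist_eq_norm, smul_smul, mul_inv_cancel₀ this, one_smul]
  have h1 := h (show c + ρ • w ∈ closedBall c ρ by
    simp [dist_eq_norm, norm_smul, hw, abs_of_nonneg hρ])
  rw [mem_closedBall, dist_eq_norm, show c + ρ • w - p = (dist c p + ρ) • w by
    rw [add_smul, ← hcw]; abel, norm_smul, hw, mul_one] at h1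
  exact (le_abs_self _).trans h1

end Inradius

/-! ### Circumradius, circumball and contact triangle -/

section Circumradius

variable {K : Set Plane}

lemma circumradius_le {c : Plane} {ρ : ℝ} (hρ : 0 ≤ ρ) (h : K ⊆ closedBall c ρ) :
    circumradius K ≤ ρ :=
  csInf_le ⟨0, by rintro σ ⟨hσ, -⟩; exact hσ⟩ ⟨hρ, c, h⟩

lemma le_circumradius (hK : Bornology.IsBounded K) {m : ℝ}
    (h : ∀ (ρ : ℝ) (c : Plane), 0 ≤ ρ → K ⊆ closedBall c ρ → m ≤ ρ) : m ≤ circumradius K := by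
  obtain ⟨ρ, hρ⟩ := hK.subset_closedBall (0 : Plane)
  refine le_csInf ⟨max ρ 0, le_max_right _ _, 0,
    hρ.trans (closedBall_subset_closedBall (le_max_left _ _))⟩ ?_
  rintro σ ⟨hσ, d, hd⟩
  exact h σ d hσ hd

lemma circumradius_nonneg : 0 ≤ circumradius K :=
  Real.sInf_nonneg (by rintro σ ⟨hσ, -⟩; exact hσ)

/-- The circumradius is attained. -/
lemma exists_circumball (hK : IsCompact K) (hne : K.Nonempty) :
    ∃ c, K ⊆ closedBall c (circumradius K) := by
  -- The farthest distance from c to K is continuous and proper in c; its minimizer is the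
  -- circumcenter.
  set F : Plane → ℝ := fun c => sSup ((fun x => dist x c) '' K) with hF
  have hbdd : ∀ c, BddAbove ((fun x => dist x c) '' K) := fun c =>
    hK.bddAbove_image (by fun_prop)
  have hcont : Continuous F :=
    hK.continuous_sSup (f := fun c x => dist x c) (by simp only [Function.HasUncurry.uncurry]; fun_prop)
  obtain ⟨x₀, hx₀⟩ := hne
  have htend : Tendsto F (cocompact Plane) atTop := by
    refine tendsto_atTop_mono (fun c => ?_) (tendsto_dist_left_cocompact_atTop x₀)
    exact le_csSup (hbdd c) ⟨x₀, hx₀, rfl⟩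
  obtain ⟨c, hc⟩ := hcont.exists_forall_le htend
  refine ⟨c, fun x hx => ?_⟩
  have h1 : dist x c ≤ F c := le_csSup (hbdd c) ⟨x, hx, rfl⟩
  refine h1.trans (le_circumradius hK.isBounded fun ρ d _ hd => (hc d).trans ?_)
  exact csSup_le ⟨_, x₀, hx₀, rfl⟩ (by rintro _ ⟨y, hy, rfl⟩; exact hd hy)

/-- Carathéodory's theorem in the plane. -/
lemma exists_three_of_mem_convexHull {A : Set Plane} {x : Plane} (hx : x ∈ convexHull ℝ A) :
    ∃ (p : Fin 3 → Plane) (l : Fin 3 → ℝ), (∀ i, p i ∈ A) ∧ l ∈ stdSimplex ℝ (Fin 3) ∧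
      ∑ i, l i • p i = x := by
  obtain ⟨ι, _, z, w, hz, hai, hw, hw1, hwx⟩ := eq_pos_convex_span_of_mem_convexHull hx
  have hcard : Fintype.card ι ≤ Fintype.card (Fin 3) := by
    refine hai.card_le_finrank_succ.trans ?_
    have := Submodule.finrank_le (vectorSpan ℝ (Set.range z))
    rw [finrank_euclideanSpace_fin] at this
    simp only [Fintype.card_fin]
    omega
  obtain ⟨e⟩ := Function.Embedding.nonempty_of_card_le hcard
  have hι : Nonempty ι := by
    by_contra hcon
    rw [not_nonempty_iff] at hcon
    simp at hw1
  obtain ⟨i₀⟩ := hι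
  -- If fewer than three points occur, the free slots are filled with a point of A of weight 0.
  refine ⟨Function.extend e z (fun _ => z i₀), Function.extend e w 0, fun j => ?_,
    ⟨fun j => ?_, ?_⟩, ?_⟩
  · by_cases hj : ∃ i, e i = j
    · obtain ⟨i, rfl⟩ := hj
      rw [e.injective.extend_apply]; exact hz ⟨i, rfl⟩
    · rw [Function.extend_apply' _ _ _ hj]; exact hz ⟨i₀, rfl⟩
  · by_cases hj : ∃ i, e i = j
    · obtain ⟨i, rfl⟩ := hj
      rw [e.injective.extend_apply]; exact (hw i).le
    · rw [Function.extend_apply' _ _ _ hj]; simp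
  · rw [← hw1]
    symm
    refine Fintype.sum_of_injective e e.injective _ _ (fun j hj => ?_) (fun i => ?_)
    · rw [Function.extend_apply' _ _ _ (by simpa using hj)]; rfl
    · rw [e.injective.extend_apply]
  · rw [← hwx]
    symm
    refine Fintype.sum_of_injective e e.injective _ _ (fun j hj => ?_) (fun i => ?_)
    · rw [Function.extend_apply' w (0 : Fin 3 → ℝ) j (by simpa using hj)]; simp
    · rw [e.injective.extend_apply, e.injective.extend_apply]

/-- By Carathéodory's theorem the hull is the continuous image of A³ times a simplex. -/
lemma isCompact_convexHull {A : Set Plane} (hA : IsCompact A) : IsCompact (convexHull ℝ A) := by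
  have h : convexHull ℝ A = (fun q : (Fin 3 → Plane) × (Fin 3 → ℝ) => ∑ i, q.2 i • q.1 i) ''
      ((Set.univ.pi fun _ => A) ×ˢ stdSimplex ℝ (Fin 3)) := by
    ext x
    constructor
    · intro hx
      obtain ⟨p, l, hp, hl, rfl⟩ := exists_three_of_mem_convexHull hx
      exact ⟨(p, l), ⟨by simpa using hp, hl⟩, rfl⟩
    · rintro ⟨⟨p, l⟩, ⟨hp, hl⟩, rfl⟩
      exact (convex_convexHull ℝ A).sum_mem (fun i _ => hl.1 i) hl.2
        fun i _ => subset_convexHull ℝ A (hp i trivial)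
  rw [h]
  exact ((isCompact_univ_pi fun _ => hA).prod (isCompact_stdSimplex ℝ (Fin 3))).image (by fun_prop)

/-- The circumcenter is a convex combination of points of `K` on the circumcircle. -/
lemma circumcenter_mem_convexHull (hK : IsCompact K) (hne : K.Nonempty) {o : Plane}
    (ho : K ⊆ closedBall o (circumradius K)) :
    o ∈ convexHull ℝ (K ∩ sphere o (circumradius K)) := by
  set R := circumradius K with hR
  set C := convexHull ℝ (K ∩ sphere o R) with hC
  have hCc : IsCompact C := isCompact_convexHull (hK.inter_right isClosed_sphere)
  -- Otherwise some w has positive inner product with all contact directions. After moving the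
  -- center by w/(n+1), some point of K still has distance at least R; a limit of such points is a
  -- contact point y with ⟪w, y − o⟫ ≤ 0, a contradiction.
  by_contra hoC
  obtain ⟨w, hw⟩ : ∃ w : Plane, ∀ x ∈ C, 0 < ⟪w, x - o⟫_ℝ := by
    obtain ⟨f, t, hf, hft⟩ := geometric_hahn_banach_point_closed (convex_convexHull ℝ _)
      hCc.isClosed hoC
    refine ⟨(InnerProductSpace.toDual ℝ Plane).symm f, fun x hx => ?_⟩
    rw [InnerProductSpace.toDual_symm_apply, map_sub]
    linarith [hft x hx]
  have hex : ∀ n : ℕ, ∃ x ∈ K, R ≤ dist x (o + (1 / ((n : ℝ) + 1)) • w) := by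
    intro n
    obtain ⟨x, hx, hmax⟩ := hK.exists_isMaxOn hne
      (f := fun x => dist x (o + (1 / ((n : ℝ) + 1)) • w)) (by fun_prop)
    exact ⟨x, hx, circumradius_le dist_nonneg fun y hy => hmax hy⟩
  choose x hxK hx using hex
  obtain ⟨y, hyK, φ, hφ, hlim⟩ := hK.tendsto_subseq hxK
  have hε : Tendsto (fun n => (1 / ((φ n : ℝ) + 1))) atTop (𝓝 0) :=
    tendsto_one_div_add_atTop_nhds_zero_nat.comp hφ.tendsto_atTop
  have h1 : R ≤ dist y o := by
    have h2 : Tendsto (fun n => dist (x (φ n)) (o + (1 / ((φ n : ℝ) + 1)) • w)) atTop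
        (𝓝 (dist y (o + (0 : ℝ) • w))) :=
      hlim.dist (tendsto_const_nhds.add (hε.smul_const w))
    have := ge_of_tendsto' h2 fun n => hx (φ n)
    simpa using this
  have hyo : dist y o = R := le_antisymm (ho hyK) h1
  have hpos := hw y (subset_convexHull ℝ _ ⟨hyK, hyo⟩)
  -- From dist x o ≤ R ≤ dist x (o + εw): the squares give 2⟪w, x − o⟫ ≤ ε‖w‖².
  have hle : ∀ n, ⟪w, x (φ n) - o⟫_ℝ ≤ (1 / ((φ n : ℝ) + 1)) * ‖w‖ ^ 2 := by
    intro n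
    set ε := 1 / ((φ n : ℝ) + 1) with hεd
    have hε0 : 0 < ε := by positivity
    have h3 : dist (x (φ n)) o ≤ R := ho (hxK _)
    have h4 := hx (φ n)
    have h5 : dist (x (φ n)) o ^ 2 ≤ dist (x (φ n)) (o + ε • w) ^ 2 :=
      pow_le_pow_left₀ dist_nonneg (h3.trans h4) 2
    rw [dist_eq_norm, dist_eq_norm, show x (φ n) - (o + ε • w) = (x (φ n) - o) - ε • w by abel,
      norm_sub_sq_real (x (φ n) - o) (ε • w), norm_smul, inner_smul_right, mul_pow,
      real_inner_comm w (x (φ n) - o)] at h5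
    have h6 : ‖ε‖ ^ 2 = ε ^ 2 := by simp
    rw [h6] at h5
    have h7 : 0 ≤ ‖w‖ ^ 2 := sq_nonneg _
    have h8 : ε * (2 * ⟪w, x (φ n) - o⟫_ℝ) ≤ ε * (ε * ‖w‖ ^ 2) := by nlinarith
    have h9 := le_of_mul_le_mul_left h8 hε0
    nlinarith [mul_nonneg hε0.le h7]
  have h10 : Tendsto (fun n => ⟪w, x (φ n) - o⟫_ℝ) atTop (𝓝 ⟪w, y - o⟫_ℝ) :=
    tendsto_const_nhds.inner (hlim.sub_const o)
  have h11 : Tendsto (fun n => (1 / ((φ n : ℝ) + 1)) * ‖w‖ ^ 2) atTop (𝓝 (0 * ‖w‖ ^ 2)) :=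
    hε.mul_const _
  have := le_of_tendsto_of_tendsto' h10 h11 hle
  linarith

/-- A convex body contains a triangle, possibly degenerate, which is inscribed in the circumcircle
and contains the circumcenter. -/
lemma exists_contact_triangle (hK : IsCompact K) (hne : K.Nonempty) {o : Plane}
    (ho : K ⊆ closedBall o (circumradius K)) :
    ∃ (p₁ p₂ p₃ : Plane) (l₁ l₂ l₃ : ℝ), p₁ ∈ K ∧ p₂ ∈ K ∧ p₃ ∈ K ∧
      ‖p₁ - o‖ = circumradius K ∧ ‖p₂ - o‖ = circumradius K ∧ ‖p₃ - o‖ = circumradius K ∧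
      0 ≤ l₁ ∧ 0 ≤ l₂ ∧ 0 ≤ l₃ ∧ l₁ + l₂ + l₃ = 1 ∧
      l₁ • (p₁ - o) + l₂ • (p₂ - o) + l₃ • (p₃ - o) = 0 := by
  obtain ⟨p, l, hp, hl, hsum⟩ :=
    exists_three_of_mem_convexHull (circumcenter_mem_convexHull hK hne ho)
  have hl1 := hl.2
  rw [Fin.sum_univ_three] at hsum hl1
  refine ⟨p 0, p 1, p 2, l 0, l 1, l 2, (hp 0).1, (hp 1).1, (hp 2).1, ?_, ?_, ?_, hl.1 0, hl.1 1,
    hl.1 2, hl1, ?_⟩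
  · simpa [dist_eq_norm] using (hp 0).2
  · simpa [dist_eq_norm] using (hp 1).2
  · simpa [dist_eq_norm] using (hp 2).2
  · have : l 0 • (p 0 - o) + l 1 • (p 1 - o) + l 2 • (p 2 - o)
        = (l 0 • p 0 + l 1 • p 1 + l 2 • p 2) - (l 0 + l 1 + l 2) • o := by module
    rw [this, hsum, hl1, one_smul, sub_self]

/-- A set containing points on a sphere around `o` which have `o` in their convex hull does not
fit into a smaller ball. -/
lemma le_circumradius_of_triangle (hK : Bornology.IsBounded K) {o p₁ p₂ p₃ : Plane}
    {R l₁ l₂ l₃ : ℝ} (h₁ : p₁ ∈ K) (h₂ : p₂ ∈ K) (h₃ : p₃ ∈ K)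
    (hn₁ : ‖p₁ - o‖ = R) (hn₂ : ‖p₂ - o‖ = R) (hn₃ : ‖p₃ - o‖ = R)
    (hl₁ : 0 ≤ l₁) (hl₂ : 0 ≤ l₂) (hl₃ : 0 ≤ l₃) (hl : l₁ + l₂ + l₃ = 1)
    (hz : l₁ • (p₁ - o) + l₂ • (p₂ - o) + l₃ • (p₃ - o) = 0) : R ≤ circumradius K := by
  refine le_circumradius hK fun ρ c hρ hc => ?_
  -- Averaged with the weights lᵢ, the linear term cancels and R² + ‖c − o‖² ≤ ρ² remains.
  have key : ∀ p ∈ K, ‖p - o‖ = R → R ^ 2 - 2 * ⟪p - o, c - o⟫_ℝ + ‖c - o‖ ^ 2 ≤ ρ ^ 2 := by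
    intro p hp hn
    have h := pow_le_pow_left₀ dist_nonneg (hc hp) 2
    rw [dist_eq_norm, show p - c = (p - o) - (c - o) by abel, norm_sub_sq_real, hn] at h
    exact h
  have e₁ := mul_le_mul_of_nonneg_left (key _ h₁ hn₁) hl₁
  have e₂ := mul_le_mul_of_nonneg_left (key _ h₂ hn₂) hl₂
  have e₃ := mul_le_mul_of_nonneg_left (key _ h₃ hn₃) hl₃
  have hin : l₁ * ⟪p₁ - o, c - o⟫_ℝ + l₂ * ⟪p₂ - o, c - o⟫_ℝ + l₃ * ⟪p₃ - o, c - o⟫_ℝ = 0 := by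
    rw [← inner_zero_left (𝕜 := ℝ) (c - o), ← hz, inner_add_left, inner_add_left,
      real_inner_smul_left, real_inner_smul_left, real_inner_smul_left]
  have hl' : l₃ = 1 - l₁ - l₂ := by linarith
  subst hl'
  have : R ^ 2 ≤ ρ ^ 2 := by nlinarith [sq_nonneg ‖c - o‖]
  exact (pow_le_pow_iff_left₀ (hn₁ ▸ norm_nonneg _) hρ two_ne_zero).1 this

end Circumradius

/-! ### The width inequality in coordinates -/

section Coordinates

/-- The height, over the chord of length `2ℓ`, of the intersection of two disks of radius
`√(ℓ² + E²)` around the end points of the chord, measured in the direction `(S, C)`. -/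
lemma lens_height {S C E ℓ α β : ℝ} (hS : 0 ≤ S) (hC : 0 ≤ C) (hE : 0 ≤ E) (hℓ : 0 < ℓ)
    (h : E * S ≤ ℓ * C) (h₁ : (α - ℓ) ^ 2 + β ^ 2 ≤ ℓ ^ 2 + E ^ 2)
    (h₂ : (α + ℓ) ^ 2 + β ^ 2 ≤ ℓ ^ 2 + E ^ 2) : α * S + β * C ≤ E * C := by
  -- The hypothesis `h`, with the nonnegativity of S and C, places (S, C) in the normal cone of the
  -- lens at its apex (0, E), so the functional is greatest there. For α > 0 only the disk around
  -- (−ℓ, 0) matters.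
  rcases le_or_gt α 0 with hα | hα
  · have hβ : β ≤ E := abs_le_of_sq_le_sq' (by nlinarith) hE |>.2
    nlinarith
  · have hβ : β ≤ E := abs_le_of_sq_le_sq' (by nlinarith) hE |>.2
    have hE' : 0 < E := by
      rcases hE.eq_or_lt with h0 | h0
      · subst h0; nlinarith
      · exact h0
    have h3 : α * ℓ ≤ (E - β) * E := by nlinarith
    have h4 : α * (E * S) ≤ α * (ℓ * C) := mul_le_mul_of_nonneg_left h hα.le
    have h5 : α * ℓ * C ≤ (E - β) * E * C := mul_le_mul_of_nonneg_right h3 hC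
    have h6 : E * (α * S) ≤ E * ((E - β) * C) := by linarith
    have := le_of_mul_le_mul_left h6 hE'
    linarith

lemma sin_le_sin_of_le_of_le_pi_sub {α ψ : ℝ} (hα : -(π / 2) ≤ α) (h₁ : α ≤ ψ) (h₂ : ψ ≤ π - α) :
    Real.sin α ≤ Real.sin ψ := by
  rcases le_or_gt ψ (π / 2) with h | h
  · exact Real.sin_le_sin_of_le_of_le_pi_div_two hα h h₁
  · rw [← Real.sin_pi_sub ψ]
    exact Real.sin_le_sin_of_le_of_le_pi_div_two hα (by linarith) (by linarith)

lemma exists_angle {R x y : ℝ} (hR : 0 < R) (h : x ^ 2 + y ^ 2 = R ^ 2) (hy : 0 ≤ y) :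
    ∃ ψ ∈ Set.Icc 0 π, x = R * Real.cos ψ ∧ y = R * Real.sin ψ := by
  have hx := abs_le_of_sq_le_sq' (by nlinarith : x ^ 2 ≤ R ^ 2) hR.le
  have h1 : Real.cos (Real.arccos (x / R)) = x / R :=
    Real.cos_arccos (by rw [le_div_iff₀ hR]; linarith) (by rw [div_le_iff₀ hR]; linarith)
  refine ⟨Real.arccos (x / R), ⟨Real.arccos_nonneg _, Real.arccos_le_pi _⟩, ?_, ?_⟩
  · rw [h1]; field_simp
  · rw [Real.sin_arccos, ← Real.sqrt_sq hR.le, ← Real.sqrt_mul (sq_nonneg R),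
      Real.sqrt_sq hR.le, show R ^ 2 * (1 - (x / R) ^ 2) = y ^ 2 by field_simp; linarith,
      Real.sqrt_sq hy]

/-- A vanishing weight in a convex combination of points on a circle that gives the center
produces two antipodal points. -/
lemma weight_pos_of_not_antipodal {R x₁ y₁ x₂ y₂ x₃ y₃ l₁ l₂ l₃ : ℝ} (hR : 0 < R)
    (hl₃ : 0 ≤ l₃) (hl₁ : 0 ≤ l₁) (hl₂ : 0 ≤ l₂) (hl : l₁ + l₂ + l₃ = 1)
    (h₁ : x₁ ^ 2 + y₁ ^ 2 = R ^ 2) (h₂ : x₂ ^ 2 + y₂ ^ 2 = R ^ 2)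
    (hx : l₁ * x₁ + l₂ * x₂ + l₃ * x₃ = 0) (hy : l₁ * y₁ + l₂ * y₂ + l₃ * y₃ = 0)
    (hd : (x₁ - x₂) ^ 2 + (y₁ - y₂) ^ 2 < (2 * R) ^ 2) : 0 < l₃ := by
  rcases hl₃.eq_or_lt with h0 | h0
  · exfalso
    subst h0
    have hx' : l₁ * x₁ = -(l₂ * x₂) := by linarith
    have hy' : l₁ * y₁ = -(l₂ * y₂) := by linarith
    have h3 : l₁ ^ 2 * R ^ 2 = l₂ ^ 2 * R ^ 2 := by
      rw [← h₁, mul_add, ← mul_pow, ← mul_pow, hx', hy', h₁, ← h₂]; ring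
    have h4 : l₁ ^ 2 = l₂ ^ 2 := mul_right_cancel₀ (pow_pos hR 2).ne' h3
    have h5 : l₁ = l₂ := (pow_left_inj₀ hl₁ hl₂ two_ne_zero).1 h4
    have h6 : l₁ = 1 / 2 := by linarith
    rw [← h5, h6] at hx' hy'
    have h7 : x₂ = -x₁ := by linarith
    have h8 : y₂ = -y₁ := by linarith
    rw [h7, h8] at hd
    nlinarith
  · exact h0

set_option maxHeartbeats 800000 in
/-- Angular coordinates of a triangle inscribed in a circle which contains the center of the
circle and has no side longer than `2R cos (γ/2)`. -/
lemma exists_triangle_angles {R γ x₁ y₁ x₂ y₂ x₃ y₃ l₁ l₂ l₃ : ℝ} (hR : 0 < R)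
    (hγ : γ ∈ Set.Ioc 0 (π / 3)) (hl₁ : 0 ≤ l₁) (hl₂ : 0 ≤ l₂) (hl₃ : 0 ≤ l₃)
    (hl : l₁ + l₂ + l₃ = 1)
    (h₁ : x₁ ^ 2 + y₁ ^ 2 = R ^ 2) (h₂ : x₂ ^ 2 + y₂ ^ 2 = R ^ 2) (h₃ : x₃ ^ 2 + y₃ ^ 2 = R ^ 2)
    (hx : l₁ * x₁ + l₂ * x₂ + l₃ * x₃ = 0) (hy : l₁ * y₁ + l₂ * y₂ + l₃ * y₃ = 0)
    (d₁₂ : (x₁ - x₂) ^ 2 + (y₁ - y₂) ^ 2 ≤ (2 * R * Real.cos (γ / 2)) ^ 2)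
    (d₁₃ : (x₁ - x₃) ^ 2 + (y₁ - y₃) ^ 2 ≤ (2 * R * Real.cos (γ / 2)) ^ 2)
    (d₂₃ : (x₂ - x₃) ^ 2 + (y₂ - y₃) ^ 2 ≤ (2 * R * Real.cos (γ / 2)) ^ 2)
    (hx₁ : 0 ≤ x₁) (hy₁ : y₁ ≤ 0) (hy₂₁ : y₂ ≤ y₁) (hy₁₃ : y₁ ≤ y₃) :
    ∃ k ψ₂ ψ₃ : ℝ, 0 ≤ k ∧ k ≤ π / 2 ∧ k ≤ ψ₂ ∧ ψ₂ + k ≤ π ∧ γ ≤ ψ₂ + k ∧ γ + k ≤ ψ₃ ∧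
      ψ₂ + ψ₃ ≤ π - γ ∧
      x₁ = R * Real.cos k ∧ y₁ = -(R * Real.sin k) ∧
      x₂ = -(R * Real.cos ψ₂) ∧ y₂ = -(R * Real.sin ψ₂) ∧
      x₃ = -(R * Real.cos ψ₃) ∧ y₃ = R * Real.sin ψ₃ := by
  have hπ := Real.pi_pos
  obtain ⟨hγ0, hγ3⟩ := hγ
  have hD : (2 * R * Real.cos (γ / 2)) ^ 2 = 2 * R ^ 2 + 2 * R ^ 2 * Real.cos γ := by
    have := Real.cos_sq (γ / 2)
    rw [mul_pow, this, show 2 * (γ / 2) = γ by ring]; ring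
  have hcos1 : Real.cos γ < 1 := by
    rw [← Real.cos_zero]
    exact Real.cos_lt_cos_of_nonneg_of_le_pi le_rfl (by linarith) hγ0
  have hR2 : 0 < R ^ 2 := pow_pos hR 2
  have hD4 : (2 * R * Real.cos (γ / 2)) ^ 2 < (2 * R) ^ 2 := by rw [hD]; nlinarith
  -- The weighted mean of the heights is 0, so the highest vertex is not below the center.
  have hy₃ : 0 ≤ y₃ := by
    by_contra hneg
    push Not at hneg
    have e1 : l₁ * y₁ ≤ l₁ * y₃ := mul_le_mul_of_nonneg_left hy₁₃ hl₁
    have e2 : l₂ * y₂ ≤ l₂ * y₃ := mul_le_mul_of_nonneg_left (hy₂₁.trans hy₁₃) hl₂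
    have e3 : (l₁ + l₂ + l₃) * y₃ = y₃ := by rw [hl, one_mul]
    linarith
  obtain ⟨k, ⟨hk0, hkπ⟩, hk1, hk2⟩ := exists_angle (x := x₁) (y := -y₁) hR (by rw [neg_sq, h₁])
    (by linarith)
  obtain ⟨ψ₂, ⟨hψ20, hψ2π⟩, hψ21, hψ22⟩ := exists_angle (x := -x₂) (y := -y₂) hR (by rw [neg_sq, neg_sq, h₂])
    (by linarith)
  obtain ⟨ψ₃, ⟨hψ30, hψ3π⟩, hψ31, hψ32⟩ := exists_angle (x := -x₃) (y := y₃) hR (by rw [neg_sq, h₃])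
    hy₃
  have hy₁' : y₁ = -(R * Real.sin k) := by linarith
  have hx₂' : x₂ = -(R * Real.cos ψ₂) := by linarith
  have hy₂' : y₂ = -(R * Real.sin ψ₂) := by linarith
  have hx₃' : x₃ = -(R * Real.cos ψ₃) := by linarith
  have hl1p : 0 < l₁ := weight_pos_of_not_antipodal (l₁ := l₂) (l₂ := l₃) (x₃ := x₁) (y₃ := y₁)
    hR hl₁ hl₂ hl₃ (by linarith) h₂ h₃ (by linarith) (by linarith) (by linarith)
  have hl2p : 0 < l₂ := weight_pos_of_not_antipodal (l₁ := l₁) (l₂ := l₃) (x₃ := x₂) (y₃ := y₂)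
    hR hl₂ hl₁ hl₃ (by linarith) h₁ h₃ (by linarith) (by linarith) (by linarith)
  have hl3p : 0 < l₃ := weight_pos_of_not_antipodal hR hl₃ hl₁ hl₂ hl h₁ h₂ hx hy (by linarith)
  have hk2' : k ≤ π / 2 := by
    by_contra hcon
    push Not at hcon
    have := mul_neg_of_pos_of_neg hR (Real.cos_neg_of_pi_div_two_lt_of_lt hcon (by linarith))
    linarith
  have hsin : Real.sin k ≤ Real.sin ψ₂ := by
    have : R * Real.sin k ≤ R * Real.sin ψ₂ := by linarith
    exact le_of_mul_le_mul_left this hR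
  have hkψ : k ≤ ψ₂ := by
    by_contra hcon
    push Not at hcon
    exact absurd hsin (not_le.2 (Real.sin_lt_sin_of_lt_of_le_pi_div_two (by linarith) hk2' hcon))
  have hkψ' : ψ₂ + k ≤ π := by
    by_contra hcon
    push Not at hcon
    rw [← Real.sin_pi_sub ψ₂] at hsin
    exact absurd hsin
      (not_le.2 (Real.sin_lt_sin_of_lt_of_le_pi_div_two (by linarith) hk2' (by linarith)))
  have ht1 := Real.sin_sq_add_cos_sq k
  have ht2 := Real.sin_sq_add_cos_sq ψ₂
  have ht3 := Real.sin_sq_add_cos_sq ψ₃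
  -- The three side lengths become bounds for the cosines of the central angles.
  have hc12 : Real.cos (ψ₂ + k) ≤ Real.cos γ := by
    rw [hD] at d₁₂
    have : R ^ 2 * Real.cos (ψ₂ + k) ≤ R ^ 2 * Real.cos γ := by
      rw [Real.cos_add]
      rw [hk1, hy₁', hx₂', hy₂'] at d₁₂
      linear_combination d₁₂ / 2 - R ^ 2 / 2 * ht1 - R ^ 2 / 2 * ht2
    exact le_of_mul_le_mul_left this hR2
  have hc13 : Real.cos (ψ₃ - k) ≤ Real.cos γ := by
    rw [hD] at d₁₃
    have : R ^ 2 * Real.cos (ψ₃ - k) ≤ R ^ 2 * Real.cos γ := by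
      rw [Real.cos_sub]
      rw [hk1, hy₁', hx₃', hψ32] at d₁₃
      linear_combination d₁₃ / 2 - R ^ 2 / 2 * ht1 - R ^ 2 / 2 * ht3
    exact le_of_mul_le_mul_left this hR2
  have hc23 : Real.cos (π - γ) ≤ Real.cos (ψ₂ + ψ₃) := by
    rw [hD] at d₂₃
    have : R ^ 2 * Real.cos (π - γ) ≤ R ^ 2 * Real.cos (ψ₂ + ψ₃) := by
      rw [Real.cos_add, Real.cos_pi_sub]
      rw [hx₂', hy₂', hx₃', hψ32] at d₂₃
      linear_combination d₂₃ / 2 - R ^ 2 / 2 * ht2 - R ^ 2 / 2 * ht3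
    exact le_of_mul_le_mul_left this hR2
  have hs1 : 0 ≤ Real.sin (ψ₂ + k) := Real.sin_nonneg_of_nonneg_of_le_pi (by linarith) hkψ'
  -- The cross product of the relation Σ lᵢ(pᵢ − o) = 0 with one vertex eliminates its weight. The
  -- resulting signs of the sines express that the center lies in the triangle, and they select the
  -- right branch for inverting the cosines.
  have hbal1 : l₃ * Real.sin (ψ₃ - k) = l₂ * Real.sin (ψ₂ + k) := by
    rw [hk1, hx₂', hx₃'] at hx
    rw [hy₁', hy₂', hψ32] at hy
    rw [Real.sin_sub, Real.sin_add]
    apply mul_left_cancel₀ hR.ne'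
    linear_combination Real.sin k * hx + Real.cos k * hy
  have hbal2 : l₃ * Real.sin (ψ₂ + ψ₃) = l₁ * Real.sin (ψ₂ + k) := by
    rw [hk1, hx₂', hx₃'] at hx
    rw [hy₁', hy₂', hψ32] at hy
    rw [Real.sin_add, Real.sin_add]
    apply mul_left_cancel₀ hR.ne'
    linear_combination -Real.sin ψ₂ * hx + Real.cos ψ₂ * hy
  have hs2 : 0 ≤ Real.sin (ψ₃ - k) := by
    have : 0 ≤ l₃ * Real.sin (ψ₃ - k) := by rw [hbal1]; positivity
    exact nonneg_of_mul_nonneg_right this hl3p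
  have hs3 : 0 ≤ Real.sin (ψ₂ + ψ₃) := by
    have : 0 ≤ l₃ * Real.sin (ψ₂ + ψ₃) := by rw [hbal2]; positivity
    exact nonneg_of_mul_nonneg_right this hl3p
  have hψ3k : 0 ≤ ψ₃ - k := by
    by_contra hcon
    push Not at hcon
    exact absurd hs2 (not_le.2 (Real.sin_neg_of_neg_of_neg_pi_lt hcon (by linarith)))
  have hψ23 : ψ₂ + ψ₃ ≤ π := by
    by_contra hcon
    push Not at hcon
    -- In the boundary case all three vertices coincide, so the center is not in their hull.
    rcases eq_or_lt_of_le (by linarith : ψ₂ + ψ₃ ≤ 2 * π) with h0 | h0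
    · have e2 : ψ₂ = π := by linarith
      have e3 : ψ₃ = π := by linarith
      have ek : k = 0 := by linarith
      rw [e2, Real.cos_pi] at hx₂'
      rw [e3, Real.cos_pi] at hx₃'
      rw [ek, Real.cos_zero] at hk1
      rw [hk1, hx₂', hx₃'] at hx
      have : (l₁ + l₂ + l₃) * R = 0 := by linarith
      rw [hl, one_mul] at this
      linarith
    · have : Real.sin (ψ₂ + ψ₃ - 2 * π) < 0 :=
        Real.sin_neg_of_neg_of_neg_pi_lt (by linarith) (by linarith)
      rw [Real.sin_sub_two_pi] at this
      linarith
  refine ⟨k, ψ₂, ψ₃, hk0, hk2', hkψ, hkψ', ?_, ?_, ?_, hk1, hy₁', hx₂', hy₂', hx₃', hψ32⟩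
  · by_contra hcon
    push Not at hcon
    exact absurd hc12 (not_le.2 (Real.cos_lt_cos_of_nonneg_of_le_pi (by linarith) (by linarith) hcon))
  · by_contra hcon
    push Not at hcon
    exact absurd hc13
      (not_le.2 (Real.cos_lt_cos_of_nonneg_of_le_pi hψ3k (by linarith) (by linarith)))
  · by_contra hcon
    push Not at hcon
    exact absurd hc23
      (not_le.2 (Real.cos_lt_cos_of_nonneg_of_le_pi (by linarith) hψ23 hcon))

/-- The heights of the lowest and the highest vertex of the triangle. -/
lemma sin_le_sin_of_triangle_angles {γ k k' ψ₂ ψ₃ : ℝ} (hγ : γ ∈ Set.Ioc 0 (π / 3)) (hk : 0 ≤ k)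
    (hk' : k' = min k (γ / 2)) (hkψ : k ≤ ψ₂) (hψ₂ : γ ≤ ψ₂ + k) (hψ₃ : γ + k ≤ ψ₃)
    (hψ : ψ₂ + ψ₃ ≤ π - γ) : γ - k' ≤ ψ₂ ∧ Real.sin (γ - k') ≤ Real.sin ψ₂ ∧
      Real.sin (γ + k') ≤ Real.sin ψ₃ := by
  obtain ⟨hγ0, hγ3⟩ := hγ
  have hπ := Real.pi_pos
  have h1 : k' ≤ k := hk' ▸ min_le_left _ _
  have h2 : k' ≤ γ / 2 := hk' ▸ min_le_right _ _
  have h0 : 0 ≤ k' := hk' ▸ le_min hk (by linarith)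
  have h3 : γ - k' ≤ ψ₂ := by
    rcases min_choice k (γ / 2) with h | h
    · rw [hk', h]; linarith
    · have : γ / 2 ≤ k := h ▸ min_le_left _ _
      rw [hk', h]; linarith
  exact ⟨h3, sin_le_sin_of_le_of_le_pi_sub (by linarith) h3 (by linarith),
    sin_le_sin_of_le_of_le_pi_sub (by linarith) (by linarith) (by linarith)⟩

set_option maxHeartbeats 800000 in
/-- The center of a ball in a body of diameter `2R cos (γ/2)` has bounded height. -/
lemma center_height_le {R γ ρ E k k' ψ₂ cx cy : ℝ} (hR : 0 < R)
    (hγ : γ ∈ Set.Ioc 0 (π / 3)) (hk : 0 ≤ k) (hkπ : k ≤ π / 2) (hk' : k' = min k (γ / 2))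
    (hk'ψ : γ - k' ≤ ψ₂) (hψγ : ψ₂ ≤ γ)
    (hE : 0 ≤ E) (hEρ : (R * Real.cos (γ / 2)) ^ 2 + E ^ 2 = ρ ^ 2) (hRρ : R ≤ ρ)
    (hρD : ρ ≤ 2 * R * Real.cos (γ / 2))
    (c₁ : (cx - R * Real.cos k) ^ 2 + (cy + R * Real.sin k) ^ 2 ≤ ρ ^ 2)
    (c₂ : (cx + R * Real.cos ψ₂) ^ 2 + (cy + R * Real.sin ψ₂) ^ 2 ≤ ρ ^ 2) :
    cy ≤ (E - R * Real.sin (γ / 2)) * Real.cos (γ / 2 - k') := by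
  have hπ := Real.pi_pos
  obtain ⟨hγ0, hγ3⟩ := hγ
  have hk'1 : k' ≤ k := hk' ▸ min_le_left _ _
  have hk'2 : k' ≤ γ / 2 := hk' ▸ min_le_right _ _
  have hk'0 : 0 ≤ k' := hk' ▸ le_min hk (by linarith)
  set θ := γ / 2 - k' with hθ
  set σ := Real.sin (γ / 2) with hσ
  set κ := Real.cos (γ / 2) with hκ
  have hσκ : σ ^ 2 + κ ^ 2 = 1 := Real.sin_sq_add_cos_sq _
  have hσ0 : 0 ≤ σ := Real.sin_nonneg_of_nonneg_of_le_pi (by linarith) (by linarith)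
  have hκ0 : 0 < κ := Real.cos_pos_of_mem_Ioo ⟨by linarith, by linarith⟩
  have hκ1 : κ ≤ 1 := Real.cos_le_one _
  have hsθ0 : 0 ≤ Real.sin θ := Real.sin_nonneg_of_nonneg_of_le_pi (by linarith) (by linarith)
  have hsθ : Real.sin θ ≤ 1 / 2 := by
    rw [← Real.sin_pi_div_six]
    exact Real.sin_le_sin_of_le_of_le_pi_div_two (by linarith) (by linarith) (by linarith)
  have hcθ : 0 < Real.cos θ := Real.cos_pos_of_mem_Ioo ⟨by linarith, by linarith⟩
  have htθ := Real.sin_sq_add_cos_sq θ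
  have hτ0 : 0 ≤ E - R * σ := by
    have hR2 : R ^ 2 ≤ ρ ^ 2 := pow_le_pow_left₀ hR.le hRρ 2
    have : (R * σ) ^ 2 ≤ E ^ 2 := by linear_combination hR2 + R ^ 2 * hσκ - hEρ
    have := abs_le_of_sq_le_sq' this hE
    linarith [this.2]
  -- The half chord Rκ and the lens height E enclose an angle a with tan a = E/(Rκ) ≤ √3. Together
  -- with θ ≤ π/6 this gives the normal cone condition of `lens_height`.
  have hEℓ : E ^ 2 ≤ 3 * (R * κ) ^ 2 := by
    have : ρ ^ 2 ≤ (2 * R * κ) ^ 2 := pow_le_pow_left₀ (hR.le.trans hRρ) hρD 2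
    linear_combination this + hEρ
  have hτ2 : E - R * σ ≤ 2 * R := by
    have hE2 : E ≤ 2 * R :=
      (abs_le_of_sq_le_sq' (by nlinarith [sq_nonneg (R * σ)] : E ^ 2 ≤ (2 * R) ^ 2)
        (by linarith)).2
    linarith [mul_nonneg hR.le hσ0]
  set τ := E - R * σ with hτ
  have hρτ : ρ ^ 2 = R ^ 2 + τ ^ 2 + 2 * R * τ * σ := by
    rw [← hEρ, hτ]; linear_combination R ^ 2 * hσκ
  by_contra hcon
  push Not at hcon
  have hh0 : 0 ≤ τ * Real.cos θ := by positivity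
  have hcy : 0 < cy := lt_of_le_of_lt hh0 hcon
  have hcψ : 0 ≤ Real.cos ψ₂ := Real.cos_nonneg_of_mem_Icc ⟨by linarith, by linarith⟩
  have hψ2 := Real.sin_sq_add_cos_sq ψ₂
  have hsψ : Real.sin (γ / 2 + θ) ≤ Real.sin ψ₂ :=
    Real.sin_le_sin_of_le_of_le_pi_div_two (by linarith) (by linarith) (by linarith)
  have hcγθ : 1 / 2 ≤ Real.cos (γ / 2 + θ) := by
    rw [← Real.cos_pi_div_three]
    exact Real.cos_le_cos_of_nonneg_of_le_pi (by linarith) (by linarith) (by linarith)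
  -- For cx ≥ 0 the disk around the lowest vertex suffices; for cx < 0 and k ≥ γ/2 the disk around
  -- the middle vertex does. In the remaining case ψ₂ may be lowered to γ − k, since this only
  -- enlarges the admissible positions with cx < 0 < cy; the two disks then form a lens over a chord
  -- of half length Rκ tilted by θ.
  rcases le_or_gt 0 cx with hcx | hcx
  · set h := τ * Real.cos θ with hh
    have e1 : R ^ 2 + cy ^ 2 + 2 * R * cy * Real.sin ψ₂ ≤ ρ ^ 2 := by
      have : 0 ≤ cx * (R * Real.cos ψ₂) := by positivity
      linear_combination c₂ + 2 * this + sq_nonneg cx - R ^ 2 * hψ2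
    have hS0 : 0 ≤ Real.sin (γ / 2 + θ) :=
      Real.sin_nonneg_of_nonneg_of_le_pi (by linarith) (by linarith)
    have e2 : h * Real.sin (γ / 2 + θ) ≤ cy * Real.sin ψ₂ :=
      mul_le_mul hcon.le hsψ hS0 hcy.le
    have e3 : h ^ 2 < cy ^ 2 := pow_lt_pow_left₀ hcon hh0 two_ne_zero
    have e4 : h ^ 2 + 2 * R * (h * Real.sin (γ / 2 + θ)) < τ ^ 2 + 2 * R * τ * σ := by
      have := mul_le_mul_of_nonneg_left e2 hR.le
      linarith
    have e5 : Real.cos θ * Real.sin (γ / 2 + θ) - σ = Real.sin θ * Real.cos (γ / 2 + θ) := by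
      rw [Real.sin_add, Real.cos_add]; linear_combination σ * htθ
    have e6 : τ * (Real.sin θ * (2 * R * Real.cos (γ / 2 + θ) - τ * Real.sin θ)) < 0 := by
      rw [hh] at e4
      linear_combination e4 - 2 * R * τ * e5 - τ ^ 2 * htθ
    have e7 : τ * Real.sin θ ≤ 2 * R * (1 / 2) := mul_le_mul hτ2 hsθ hsθ0 (by linarith)
    have e8 : 0 ≤ 2 * R * Real.cos (γ / 2 + θ) - τ * Real.sin θ := by
      linarith [mul_le_mul_of_nonneg_left hcγθ hR.le]
    have : 0 ≤ τ * (Real.sin θ * (2 * R * Real.cos (γ / 2 + θ) - τ * Real.sin θ)) := by positivity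
    linarith
  · rcases le_or_gt (γ / 2) k with hkγ | hkγ
    · have hk'' : k' = γ / 2 := by rw [hk', min_eq_right hkγ]
      have hθ0 : θ = 0 := by rw [hθ, hk'']; ring
      rw [hθ0, Real.cos_zero, mul_one] at hcon
      have hck : 0 ≤ Real.cos k := Real.cos_nonneg_of_mem_Icc ⟨by linarith, by linarith⟩
      have hsk : σ ≤ Real.sin k :=
        Real.sin_le_sin_of_le_of_le_pi_div_two (by linarith) (by linarith) hkγ
      have htk := Real.sin_sq_add_cos_sq k
      have e1 : R ^ 2 + cy ^ 2 + 2 * R * cy * Real.sin k ≤ ρ ^ 2 := by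
        have : 0 ≤ -cx * (R * Real.cos k) := mul_nonneg (by linarith) (by positivity)
        linear_combination c₁ + 2 * this + sq_nonneg cx - R ^ 2 * htk
      have e2 : τ * σ ≤ cy * Real.sin k := mul_le_mul hcon.le hsk hσ0 hcy.le
      have e3 : τ ^ 2 < cy ^ 2 := pow_lt_pow_left₀ hcon hτ0 two_ne_zero
      linarith [mul_le_mul_of_nonneg_left e2 hR.le]
    · have hk'' : k' = k := by rw [hk', min_eq_left hkγ.le]
      rw [hk''] at hk'ψ hθ
      have hC : Real.cos ψ₂ ≤ Real.cos (γ - k) :=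
        Real.cos_le_cos_of_nonneg_of_le_pi (by linarith) (by linarith) hk'ψ
      have hS : Real.sin (γ - k) ≤ Real.sin ψ₂ :=
        Real.sin_le_sin_of_le_of_le_pi_div_two (by linarith) (by linarith) hk'ψ
      have ht := Real.sin_sq_add_cos_sq (γ - k)
      have c₂' : (cx + R * Real.cos (γ - k)) ^ 2 + (cy + R * Real.sin (γ - k)) ^ 2 ≤ ρ ^ 2 := by
        have e1 : 0 ≤ R * (-cx * (Real.cos (γ - k) - Real.cos ψ₂)) :=
          mul_nonneg hR.le (mul_nonneg (by linarith) (by linarith))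
        have e2 : 0 ≤ R * (cy * (Real.sin ψ₂ - Real.sin (γ - k))) :=
          mul_nonneg hR.le (mul_nonneg hcy.le (by linarith))
        linear_combination c₂ + 2 * e1 + 2 * e2 - R ^ 2 * hψ2 + R ^ 2 * ht
      have hk1 : Real.cos k = κ * Real.cos θ + σ * Real.sin θ := by
        rw [show k = γ / 2 - θ by rw [hθ]; ring, Real.cos_sub]
      have hk2 : Real.sin k = σ * Real.cos θ - κ * Real.sin θ := by
        rw [show k = γ / 2 - θ by rw [hθ]; ring, Real.sin_sub]
      have hk3 : Real.cos (γ - k) = κ * Real.cos θ - σ * Real.sin θ := by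
        rw [show γ - k = γ / 2 + θ by rw [hθ]; ring, Real.cos_add]
      have hk4 : Real.sin (γ - k) = σ * Real.cos θ + κ * Real.sin θ := by
        rw [show γ - k = γ / 2 + θ by rw [hθ]; ring, Real.sin_add]
      rw [hk1, hk2] at c₁
      rw [hk3, hk4] at c₂'
      have hlens := lens_height (S := Real.sin θ) (C := Real.cos θ) (E := E) (ℓ := R * κ)
        (α := cx * Real.cos θ + cy * Real.sin θ)
        (β := -cx * Real.sin θ + cy * Real.cos θ + R * σ) hsθ0 hcθ.le hE (by positivity) ?_ ?_ ?_
      · have : cy * (Real.sin θ ^ 2 + Real.cos θ ^ 2) = cy := by rw [htθ, mul_one]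
        rw [hτ] at hcon
        linarith
      · have h1 : (E * Real.sin θ) ^ 2 ≤ (R * κ * Real.cos θ) ^ 2 := by
          have a1 : Real.sin θ ^ 2 ≤ 1 / 4 := by nlinarith
          have a2 : 3 * Real.sin θ ^ 2 ≤ Real.cos θ ^ 2 := by linarith
          rw [mul_pow, mul_pow]
          calc E ^ 2 * Real.sin θ ^ 2 ≤ 3 * (R * κ) ^ 2 * Real.sin θ ^ 2 :=
                mul_le_mul_of_nonneg_right hEℓ (sq_nonneg _)
            _ = (R * κ) ^ 2 * (3 * Real.sin θ ^ 2) := by ring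
            _ ≤ _ := mul_le_mul_of_nonneg_left a2 (sq_nonneg _)
        exact (abs_le_of_sq_le_sq' h1 (by positivity)).2
      · rw [hEρ]
        refine le_trans (le_of_eq ?_) c₁
        linear_combination (cx ^ 2 + cy ^ 2 - R ^ 2 * κ ^ 2 - R ^ 2 * σ ^ 2) * htθ
      · rw [hEρ]
        refine le_trans (le_of_eq ?_) c₂'
        linear_combination (cx ^ 2 + cy ^ 2 - R ^ 2 * κ ^ 2 - R ^ 2 * σ ^ 2) * htθ

/-- The trigonometric core of the width inequality. -/
lemma bound_le_of_alternatives {R γ r ρ E a s w : ℝ} (hR : 0 < R)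
    (hγ : γ ∈ Set.Ioc 0 (π / 3)) (hρ : 0 < ρ)
    (ha : a ∈ Set.Icc 0 (π / 2)) (hs : s ∈ Set.Icc 0 (π / 2))
    (hac : ρ * Real.cos a = R * Real.cos (γ / 2)) (has : ρ * Real.sin a = E)
    (hsr : ρ * Real.sin s = r) (hw : 2 * r ≤ w)
    (h : 2 * R * Real.sin γ ≤ w ∨ ∃ k ∈ Set.Icc 0 (γ / 2), 2 * R * Real.sin γ * Real.cos k ≤ w ∧
      R * Real.sin (γ + k) + r - (E - R * Real.sin (γ / 2)) * Real.cos (γ / 2 - k) ≤ w) :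
    2 * R * Real.sin γ * Real.cos (γ / 2 - (s - a)) ≤ w := by
  have hπ := Real.pi_pos
  obtain ⟨hγ0, hγ3⟩ := hγ
  have hsγ : 0 < Real.sin γ := Real.sin_pos_of_pos_of_lt_pi hγ0 (by linarith)
  by_contra hcon
  push Not at hcon
  have hL : 2 * R * Real.sin γ * Real.cos (γ / 2 - (s - a)) ≤ 2 * R * Real.sin γ :=
    mul_le_of_le_one_right (by positivity) (Real.cos_le_one _)
  rcases h with h | ⟨k, ⟨hk0, hkγ⟩, h1, h2⟩
  · linarith
  have hcos : Real.cos k < Real.cos (γ / 2 - (s - a)) :=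
    lt_of_mul_lt_mul_left (h1.trans_lt hcon) (by positivity)
  set b := s - a with hb
  have hθb : γ / 2 - k < b := by
    by_contra hle
    push Not at hle
    have : Real.cos (γ / 2 - b) ≤ Real.cos k := by
      apply Real.cos_le_cos_of_nonneg_of_le_pi hk0 _ (by linarith)
      linarith [ha.2, hs.1]
    linarith
  set θ := γ / 2 - k with hθ
  have hEr : E ≤ r := by
    rw [← has, ← hsr]
    exact mul_le_mul_of_nonneg_left
      (Real.sin_le_sin_of_le_of_le_pi_div_two (by linarith [ha.1]) hs.2 (by linarith)) hρ.le
  have hκ : 1 / 2 ≤ Real.cos (γ / 2) := by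
    rw [← Real.cos_pi_div_three]
    exact Real.cos_le_cos_of_nonneg_of_le_pi (by linarith) (by linarith) (by linarith)
  -- With A = 2R cos(γ/2) sin γ − E and B = R cos(3γ/2) the second alternative reads A cos θ − B sin
  -- θ + r ≤ w. For A, B ≥ 0 its left side decreases in θ, and at θ = b it equals the claimed bound,
  -- by `e3` and `e4`. Since θ < b, this contradicts `hcon`. That A ≥ 0 follows from E ≤ r and 2r ≤
  -- w < 2R sin γ.
  have hA : 0 ≤ 2 * R * Real.cos (γ / 2) * Real.sin γ - E := by
    have : R * Real.sin γ ≤ 2 * R * Real.cos (γ / 2) * Real.sin γ := by nlinarith [mul_pos hR hsγ]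
    linarith
  have hB : 0 ≤ R * Real.cos (3 * γ / 2) :=
    mul_nonneg hR.le (Real.cos_nonneg_of_mem_Icc ⟨by linarith, by linarith⟩)
  have hsin : Real.sin θ ≤ Real.sin b :=
    Real.sin_le_sin_of_le_of_le_pi_div_two (by linarith) (by linarith [ha.1, hs.2]) hθb.le
  have hcosb : Real.cos b ≤ Real.cos θ :=
    Real.cos_le_cos_of_nonneg_of_le_pi (by linarith) (by linarith [ha.1, hs.2]) hθb.le
  have e1 : Real.sin (γ + k) = Real.sin (3 * γ / 2) * Real.cos θ
      - Real.cos (3 * γ / 2) * Real.sin θ := by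
    rw [← Real.sin_sub]; congr 1; rw [hθ]; ring
  have e2 : Real.sin (3 * γ / 2) + Real.sin (γ / 2) = 2 * Real.cos (γ / 2) * Real.sin γ := by
    rw [show 3 * γ / 2 = γ + γ / 2 by ring, show Real.sin (γ / 2) = Real.sin (γ - γ / 2) by
      congr 1; ring, Real.sin_add, Real.sin_sub]; ring
  have e3 : r = E * Real.cos b + R * Real.cos (γ / 2) * Real.sin b := by
    rw [← hsr, show s = a + b by rw [hb]; ring, Real.sin_add, ← has, ← hac]; ring
  have e4 : 2 * Real.sin γ * Real.cos (γ / 2 - b) =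
      Real.sin (3 * γ / 2) * Real.cos b - Real.cos (3 * γ / 2) * Real.sin b
      + (Real.sin (γ / 2) * Real.cos b + Real.cos (γ / 2) * Real.sin b) := by
    rw [← Real.sin_sub, ← Real.sin_add, show 3 * γ / 2 - b = γ + (γ / 2 - b) by ring,
      show γ / 2 + b = γ - (γ / 2 - b) by ring, Real.sin_add γ, Real.sin_sub γ]; ring
  have e5 : 2 * R * Real.sin γ * Real.cos (γ / 2 - b) = R * (2 * Real.sin γ * Real.cos (γ / 2 - b)) := by
    ring
  rw [e5, e4] at hcon
  rw [e1] at h2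
  have e6 := mul_le_mul_of_nonneg_left hcosb hA
  have e7 := mul_le_mul_of_nonneg_left hsin hB
  have e8 : R * (Real.sin (3 * γ / 2) + Real.sin (γ / 2)) * Real.cos θ
      = R * (2 * Real.cos (γ / 2) * Real.sin γ) * Real.cos θ := by rw [e2]
  have e9 : R * (Real.sin (3 * γ / 2) + Real.sin (γ / 2)) * Real.cos b
      = R * (2 * Real.cos (γ / 2) * Real.sin γ) * Real.cos b := by rw [e2]
  linarith

end Coordinates

/-! ### Orthonormal frames of the plane -/

/-- `v, u` is an orthonormal basis of the plane. -/
structure IsFrame (v u : Plane) : Prop where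
  norm_left : ‖v‖ = 1
  norm_right : ‖u‖ = 1
  inner_eq_zero : ⟪v, u⟫_ℝ = 0
  inner_eq : ∀ x y : Plane, ⟪x, y⟫_ℝ = ⟪v, x⟫_ℝ * ⟪v, y⟫_ℝ + ⟪u, x⟫_ℝ * ⟪u, y⟫_ℝ

lemma exists_isFrame {u : Plane} (hu : ‖u‖ = 1) : ∃ v, IsFrame v u := by
  have h : u 0 ^ 2 + u 1 ^ 2 = 1 := by
    have := EuclideanSpace.real_norm_sq_eq u
    rw [hu, Fin.sum_univ_two] at this
    linarith
  refine ⟨!₂[-u 1, u 0], ?_, hu, ?_, fun x y => ?_⟩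
  · rw [← pow_left_inj₀ (norm_nonneg _) zero_le_one two_ne_zero, EuclideanSpace.real_norm_sq_eq,
      Fin.sum_univ_two]
    simp; linarith
  · simp [PiLp.inner_apply, Fin.sum_univ_two]; ring
  · simp only [PiLp.inner_apply, Fin.sum_univ_two, RCLike.inner_apply, conj_trivial]
    simp
    linear_combination (-(x 0 * y 0) - x 1 * y 1) * h

namespace IsFrame

variable {v u : Plane}

lemma neg_left (h : IsFrame v u) : IsFrame (-v) u :=
  ⟨by rw [norm_neg, h.norm_left], h.norm_right, by rw [inner_neg_left, h.inner_eq_zero, neg_zero],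
    fun x y => by rw [h.inner_eq x y, inner_neg_left, inner_neg_left, neg_mul_neg]⟩

lemma neg_right (h : IsFrame v u) : IsFrame v (-u) :=
  ⟨h.norm_left, by rw [norm_neg, h.norm_right], by rw [inner_neg_right, h.inner_eq_zero, neg_zero],
    fun x y => by rw [h.inner_eq x y, inner_neg_left, inner_neg_left, neg_mul_neg]⟩

lemma inner_self_left (h : IsFrame v u) : ⟪v, v⟫_ℝ = 1 := by
  rw [real_inner_self_eq_norm_sq, h.norm_left, one_pow]

lemma inner_self_right (h : IsFrame v u) : ⟪u, u⟫_ℝ = 1 := by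
  rw [real_inner_self_eq_norm_sq, h.norm_right, one_pow]

lemma inner_eq_zero' (h : IsFrame v u) : ⟪u, v⟫_ℝ = 0 := by
  rw [real_inner_comm, h.inner_eq_zero]

lemma norm_sq (h : IsFrame v u) (x : Plane) : ‖x‖ ^ 2 = ⟪v, x⟫_ℝ ^ 2 + ⟪u, x⟫_ℝ ^ 2 := by
  rw [← real_inner_self_eq_norm_sq, h.inner_eq]; ring

lemma dist_sq (h : IsFrame v u) (x y o : Plane) :
    dist x y ^ 2 = (⟪v, x - o⟫_ℝ - ⟪v, y - o⟫_ℝ) ^ 2 + (⟪u, x - o⟫_ℝ - ⟪u, y - o⟫_ℝ) ^ 2 := by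
  rw [dist_eq_norm, h.norm_sq, ← inner_sub_right, ← inner_sub_right, sub_sub_sub_cancel_right]

lemma ext (h : IsFrame v u) {x y : Plane} (hv : ⟪v, x⟫_ℝ = ⟪v, y⟫_ℝ) (hu : ⟪u, x⟫_ℝ = ⟪u, y⟫_ℝ) :
    x = y := by
  rw [← sub_eq_zero, ← norm_eq_zero, ← sq_eq_zero_iff, h.norm_sq, inner_sub_right,
    inner_sub_right, hv, hu]
  ring

lemma inner_left_comb (h : IsFrame v u) (a b : ℝ) : ⟪v, a • v + b • u⟫_ℝ = a := by
  rw [inner_add_right, inner_smul_right, inner_smul_right, h.inner_self_left, h.inner_eq_zero]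
  ring

lemma inner_right_comb (h : IsFrame v u) (a b : ℝ) : ⟪u, a • v + b • u⟫_ℝ = b := by
  rw [inner_add_right, inner_smul_right, inner_smul_right, h.inner_self_right, h.inner_eq_zero']
  ring

end IsFrame

/-! ### Relations between the radii -/

section Radii

variable {K : Set Plane}

lemma circumradius_pos (hK : IsCompact K) (hnt : K.Nontrivial) : 0 < circumradius K := by
  obtain ⟨c, hc⟩ := exists_circumball hK hnt.nonempty
  refine lt_of_le_of_ne circumradius_nonneg fun h => ?_
  rw [← h, closedBall_zero] at hc
  exact (Set.not_subsingleton_iff.2 hnt) (Set.subsingleton_singleton.anti hc)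

/-- The inball lies in the ball of radius D around any point p of K. This is the only way in which r
and D are combined in the width estimate. -/
lemma dist_inball_add_le (hK : IsCompact K) {c p : Plane} (hc : closedBall c (inradius K) ⊆ K)
    (hp : p ∈ K) : dist c p + inradius K ≤ diameter K :=
  dist_add_le_of_closedBall_subset inradius_nonneg
    (hc.trans fun _ hx => dist_le_diam_of_mem hK.isBounded hx hp)

/-- The ball of radius D − r around the incenter contains K. -/
lemma circumradius_le_diameter_sub (hK : IsCompact K) (hne : K.Nonempty) :
    circumradius K ≤ diameter K - inradius K := by
  obtain ⟨c, hc⟩ := exists_inball hK hne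
  have h : ∀ x ∈ K, dist x c ≤ diameter K - inradius K := fun x hx => by
    rw [dist_comm]; linarith [dist_inball_add_le hK hc hx]
  obtain ⟨x, hx⟩ := hne
  exact circumradius_le (dist_nonneg.trans (h x hx)) h

lemma inradius_le_circumradius (hK : IsCompact K) (hne : K.Nonempty) :
    inradius K ≤ circumradius K := by
  obtain ⟨c, hc⟩ := exists_inball hK hne
  obtain ⟨o, ho⟩ := exists_circumball hK hne
  linarith [dist_add_le_of_closedBall_subset inradius_nonneg (hc.trans ho),
    dist_nonneg (x := c) (y := o)]

lemma diameter_le_two_mul_circumradius (hK : IsCompact K) (hne : K.Nonempty) :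
    diameter K ≤ 2 * circumradius K := by
  obtain ⟨o, ho⟩ := exists_circumball hK hne
  refine diam_le_of_forall_dist_le (by linarith [circumradius_nonneg (K := K)]) fun x hx y hy => ?_
  have h1 : dist x o ≤ _ := ho hx
  have h2 : dist y o ≤ _ := ho hy
  linarith [dist_triangle_right x y o]

lemma two_mul_inradius_le_width (hK : IsCompact K) (hne : K.Nonempty) :
    2 * inradius K ≤ width K := by
  obtain ⟨c, hc⟩ := exists_inball hK hne
  refine le_width fun u hu => ?_
  obtain ⟨h1, h2⟩ := add_mem_of_closedBall_subset inradius_nonneg hc hu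
  refine le_trans (le_of_eq ?_) (inner_sub_inner_le_breadth hK h1 h2)
  rw [inner_add_right, inner_sub_right, inner_smul_right, real_inner_self_eq_norm_sq, hu]
  ring

/-- Jung's theorem in the plane. -/
lemma three_mul_circumradius_sq_le (hK : IsCompact K) (hne : K.Nonempty) :
    3 * circumradius K ^ 2 ≤ diameter K ^ 2 := by
  obtain ⟨o, ho⟩ := exists_circumball hK hne
  obtain ⟨p₁, p₂, p₃, l₁, l₂, l₃, h₁, h₂, h₃, n₁, n₂, n₃, hl₁, hl₂, hl₃, hl, hz⟩ :=
    exists_contact_triangle hK hne ho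
  set R := circumradius K
  set D := diameter K with hD
  have key : ∀ p ∈ K, ∀ q ∈ K, ‖p - o‖ = R → ‖q - o‖ = R →
      2 * R ^ 2 - 2 * ⟪p - o, q - o⟫_ℝ ≤ D ^ 2 := by
    intro p hp q hq hpn hqn
    have h := pow_le_pow_left₀ dist_nonneg (dist_le_diam_of_mem hK.isBounded hp hq) 2
    rw [dist_eq_norm, show p - q = (p - o) - (q - o) by abel, norm_sub_sq_real, hpn, hqn] at h
    exact le_trans (le_of_eq (by ring)) h
  have e₁ := mul_le_mul_of_nonneg_left (key _ h₁ _ h₂ n₁ n₂) (mul_nonneg hl₁ hl₂)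
  have e₂ := mul_le_mul_of_nonneg_left (key _ h₁ _ h₃ n₁ n₃) (mul_nonneg hl₁ hl₃)
  have e₃ := mul_le_mul_of_nonneg_left (key _ h₂ _ h₃ n₂ n₃) (mul_nonneg hl₂ hl₃)
  have hin : ⟪l₁ • (p₁ - o) + l₂ • (p₂ - o) + l₃ • (p₃ - o),
      l₁ • (p₁ - o) + l₂ • (p₂ - o) + l₃ • (p₃ - o)⟫_ℝ = 0 := by rw [hz, inner_zero_left]
  simp only [inner_add_left, inner_add_right, real_inner_smul_left, real_inner_smul_right,
    real_inner_self_eq_norm_sq, norm_smul, mul_pow, Real.norm_eq_abs, sq_abs, n₁, n₂, n₃, real_inner_comm (p₁ - o) (p₂ - o),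
    real_inner_comm (p₁ - o) (p₃ - o), real_inner_comm (p₂ - o) (p₃ - o)] at hin
  have hl' : (l₁ + l₂ + l₃) ^ 2 = 1 := by rw [hl, one_pow]
  -- Expanding ‖Σ lᵢ(pᵢ − o)‖² = 0 shows that R² is the sum of lᵢlⱼ‖pᵢ − pⱼ‖² over the pairs i < j.
  have h4 : R ^ 2 ≤ (l₁ * l₂ + l₁ * l₃ + l₂ * l₃) * D ^ 2 := by
    linear_combination e₁ + e₂ + e₃ + hin - R ^ 2 * hl'
  have h5 : l₁ * l₂ + l₁ * l₃ + l₂ * l₃ ≤ 1 / 3 := by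
    nlinarith [sq_nonneg (l₁ - l₂), sq_nonneg (l₁ - l₃), sq_nonneg (l₂ - l₃)]
  nlinarith [mul_le_mul_of_nonneg_right h5 (sq_nonneg D)]

/-- The angle `γ` with `D(K) = 2 R(K) cos (γ/2)`. -/
lemma exists_apex_angle (hK : IsCompact K) (hnt : K.Nontrivial) :
    ∃ γ ∈ Set.Icc 0 (π / 3), diameter K = 2 * circumradius K * Real.cos (γ / 2) := by
  have hR := circumradius_pos hK hnt
  have hJ := three_mul_circumradius_sq_le hK hnt.nonempty
  have hD0 : 0 ≤ diameter K := diam_nonneg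
  have hD2 := diameter_le_two_mul_circumradius hK hnt.nonempty
  set R := circumradius K
  set D := diameter K
  refine ⟨2 * Real.arccos (D / (2 * R)), ⟨by linarith [Real.arccos_nonneg (D / (2 * R))], ?_⟩, ?_⟩
  · have h1 : √3 / 2 ≤ D / (2 * R) := by
      rw [div_le_div_iff₀ two_pos (by positivity)]
      have : √3 * R ≤ D := by
        rw [← Real.sqrt_sq hR.le, ← Real.sqrt_mul (by norm_num)]
        exact Real.sqrt_le_iff.2 ⟨hD0, hJ⟩
      linarith
    have h2 := Real.arccos_le_arccos h1
    rw [← Real.cos_pi_div_six, Real.arccos_cos (by positivity) (by linarith [Real.pi_pos])] at h2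
    linarith
  · rw [mul_div_cancel_left₀ _ two_ne_zero, Real.cos_arccos]
    · field_simp
    · linarith [show 0 ≤ D / (2 * R) by positivity]
    · rw [div_le_one (by positivity)]; exact hD2

end Radii

/-! ### The lower bounds in terms of the angle -/

section Formulas

variable {R D γ r : ℝ}

lemma arccos_div_eq (hR : 0 < R) (hγ : γ ∈ Set.Icc 0 (π / 3)) (hD : D = 2 * R * Real.cos (γ / 2)) :
    Real.arccos (D / (2 * R)) = γ / 2 := by
  rw [hD, mul_div_cancel_left₀ _ (by positivity), Real.arccos_cos (by linarith [hγ.1])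
    (by linarith [hγ.2, Real.pi_pos])]

lemma sqrt_one_sub_div_sq_eq (hR : 0 < R) (hγ : γ ∈ Set.Icc 0 (π / 3))
    (hD : D = 2 * R * Real.cos (γ / 2)) : √(1 - (D / (2 * R)) ^ 2) = Real.sin (γ / 2) := by
  rw [hD, mul_div_cancel_left₀ _ (by positivity), ← Real.abs_sin_eq_sqrt_one_sub_cos_sq,
    abs_of_nonneg (Real.sin_nonneg_of_nonneg_of_le_pi (by linarith [hγ.1])
    (by linarith [hγ.2, Real.pi_pos]))]

lemma sin_eq_two_mul_half (γ : ℝ) : Real.sin γ = 2 * Real.sin (γ / 2) * Real.cos (γ / 2) := by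
  rw [← Real.sin_two_mul, mul_div_cancel₀ _ two_ne_zero]

/-- This displays ℓ₃ as the breadth of an isosceles triangle with tilt k = γ/2 − (s − a), the form
used throughout. -/
lemma lowerBound₃_eq (hR : 0 < R) (hγ : γ ∈ Set.Icc 0 (π / 3))
    (hD : D = 2 * R * Real.cos (γ / 2)) :
    lowerBound₃ r D R = 2 * R * Real.sin γ *
      Real.cos (γ / 2 - (Real.arcsin (r / (D - r)) - Real.arccos (D / (2 * (D - r))))) := by
  rw [lowerBound₃, sqrt_one_sub_div_sq_eq hR hγ hD, arccos_div_eq hR hγ hD, sin_eq_two_mul_half γ,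
    show Real.arccos (D / (2 * (D - r))) + γ / 2 - Real.arcsin (r / (D - r)) =
      γ / 2 - (Real.arcsin (r / (D - r)) - Real.arccos (D / (2 * (D - r)))) by ring]
  nth_rewrite 1 [hD]
  ring

/-- The same expression at the extreme tilt k = γ/2. -/
lemma lowerBound₂_eq (hR : 0 < R) (hγ : γ ∈ Set.Icc 0 (π / 3))
    (hD : D = 2 * R * Real.cos (γ / 2)) :
    lowerBound₂ D R = 2 * R * Real.sin γ * Real.cos (γ / 2) := by
  have hs : 0 ≤ Real.sin (γ / 2) := Real.sin_nonneg_of_nonneg_of_le_pi (by linarith [hγ.1])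
    (by linarith [hγ.2, Real.pi_pos])
  have h : √(4 * R ^ 2 - D ^ 2) = 2 * R * Real.sin (γ / 2) := by
    rw [← Real.sqrt_sq (by positivity : 0 ≤ 2 * R * Real.sin (γ / 2)), hD]
    congr 1
    linear_combination (-4 * R ^ 2) * Real.sin_sq_add_cos_sq (γ / 2)
  rw [lowerBound₂, h, hD, sin_eq_two_mul_half γ]
  field_simp

/-- The angles `a` and `s` at the vertex `p₂` which occur in the third lower bound. -/
lemma vertex_angles (hR : 0 < R) (hγ : γ ∈ Set.Icc 0 (π / 3)) (hD : D = 2 * R * Real.cos (γ / 2))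
    (hr : 0 ≤ r) (hrR : r ≤ R) (hRD : R ≤ D - r) :
    Real.arccos (D / (2 * (D - r))) ∈ Set.Icc 0 (π / 3) ∧
    γ / 2 ≤ Real.arccos (D / (2 * (D - r))) ∧
    Real.arcsin (r / (D - r)) ∈ Set.Icc 0 (π / 2) ∧
    (D - r) * Real.cos (Real.arccos (D / (2 * (D - r)))) = R * Real.cos (γ / 2) ∧
    (D - r) * Real.sin (Real.arcsin (r / (D - r))) = r := by
  have hρ : 0 < D - r := hR.trans_le hRD
  have hκ : 0 < Real.cos (γ / 2) := Real.cos_pos_of_mem_Ioo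
    ⟨by linarith [hγ.1, Real.pi_pos], by linarith [hγ.2, Real.pi_pos]⟩
  have hD0 : 0 < D := by rw [hD]; positivity
  have h1 : 1 / 2 ≤ D / (2 * (D - r)) := by
    rw [div_le_div_iff₀ two_pos (by positivity)]; linarith
  have h2 : D / (2 * (D - r)) ≤ Real.cos (γ / 2) := by
    rw [div_le_iff₀ (by positivity)]
    calc D = 2 * R * Real.cos (γ / 2) := hD
      _ ≤ _ := by nlinarith
  refine ⟨⟨Real.arccos_nonneg _, ?_⟩, ?_, ⟨Real.arcsin_nonneg.2 (by positivity),
    Real.arcsin_le_pi_div_two _⟩, ?_, ?_⟩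
  · have := Real.arccos_le_arccos h1
    rwa [← Real.cos_pi_div_three, Real.arccos_cos (by positivity) (by linarith [Real.pi_pos])]
      at this
  · have := Real.arccos_le_arccos h2
    rwa [Real.arccos_cos (by linarith [hγ.1]) (by linarith [hγ.2, Real.pi_pos])] at this
  · rw [Real.cos_arccos (by linarith) (h2.trans (Real.cos_le_one _)), ← mul_div_assoc,
      mul_comm, mul_div_mul_right _ _ hρ.ne', hD]
    ring
  · rw [Real.sin_arcsin (by linarith [show 0 ≤ r / (D - r) by positivity])
      (by rw [div_le_one hρ]; linarith)]
    field_simp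

end Formulas

/-! ### The inequalities for general bodies -/

section Inequalities

variable {K : Set Plane} {γ : ℝ}

/-- The contact triangle in coordinates adapted to a direction `u`. -/
lemma exists_triangle_in_body (hK : IsCompact K) (hnt : K.Nontrivial)
    (hγ : γ ∈ Set.Ioc 0 (π / 3)) (hD : diameter K = 2 * circumradius K * Real.cos (γ / 2))
    {u : Plane} (hu : ‖u‖ = 1) :
    ∃ (o v u' p₁ p₂ p₃ : Plane) (k ψ₂ ψ₃ : ℝ), IsFrame v u' ∧ (u' = u ∨ u' = -u) ∧
      p₁ ∈ K ∧ p₂ ∈ K ∧ p₃ ∈ K ∧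
      0 ≤ k ∧ k ≤ π / 2 ∧ k ≤ ψ₂ ∧ ψ₂ + k ≤ π ∧ γ ≤ ψ₂ + k ∧ γ + k ≤ ψ₃ ∧ ψ₂ + ψ₃ ≤ π - γ ∧
      ⟪v, p₁ - o⟫_ℝ = circumradius K * Real.cos k ∧
      ⟪u', p₁ - o⟫_ℝ = -(circumradius K * Real.sin k) ∧
      ⟪v, p₂ - o⟫_ℝ = -(circumradius K * Real.cos ψ₂) ∧
      ⟪u', p₂ - o⟫_ℝ = -(circumradius K * Real.sin ψ₂) ∧
      ⟪v, p₃ - o⟫_ℝ = -(circumradius K * Real.cos ψ₃) ∧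
      ⟪u', p₃ - o⟫_ℝ = circumradius K * Real.sin ψ₃ := by
  have hR := circumradius_pos hK hnt
  obtain ⟨o, ho⟩ := exists_circumball hK hnt.nonempty
  -- the vertices ordered by height
  obtain ⟨p₁, p₂, p₃, l₁, l₂, l₃, ⟨h₁, h₂, h₃, n₁, n₂, n₃, hl₁, hl₂, hl₃, hl, hz⟩, h21, h13⟩ :
      ∃ (p₁ p₂ p₃ : Plane) (l₁ l₂ l₃ : ℝ), (p₁ ∈ K ∧ p₂ ∈ K ∧ p₃ ∈ K ∧
        ‖p₁ - o‖ = circumradius K ∧ ‖p₂ - o‖ = circumradius K ∧ ‖p₃ - o‖ = circumradius K ∧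
        0 ≤ l₁ ∧ 0 ≤ l₂ ∧ 0 ≤ l₃ ∧ l₁ + l₂ + l₃ = 1 ∧
        l₁ • (p₁ - o) + l₂ • (p₂ - o) + l₃ • (p₃ - o) = 0) ∧
        ⟪u, p₂ - o⟫_ℝ ≤ ⟪u, p₁ - o⟫_ℝ ∧ ⟪u, p₁ - o⟫_ℝ ≤ ⟪u, p₃ - o⟫_ℝ := by
    obtain ⟨p₁, p₂, p₃, l₁, l₂, l₃, h₁, h₂, h₃, n₁, n₂, n₃, hl₁, hl₂, hl₃, hl, hz⟩ :=
      exists_contact_triangle hK hnt.nonempty ho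
    rcases le_total ⟪u, p₁ - o⟫_ℝ ⟪u, p₂ - o⟫_ℝ with a | a <;>
    rcases le_total ⟪u, p₂ - o⟫_ℝ ⟪u, p₃ - o⟫_ℝ with b | b <;>
    rcases le_total ⟪u, p₁ - o⟫_ℝ ⟪u, p₃ - o⟫_ℝ with c | c
    · exact ⟨p₂, p₁, p₃, l₂, l₁, l₃, ⟨h₂, h₁, h₃, n₂, n₁, n₃, hl₂, hl₁, hl₃, by linarith,
        by rw [← hz]; abel⟩, a, b⟩
    · exact ⟨p₂, p₁, p₃, l₂, l₁, l₃, ⟨h₂, h₁, h₃, n₂, n₁, n₃, hl₂, hl₁, hl₃, by linarith,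
        by rw [← hz]; abel⟩, a, b⟩
    · exact ⟨p₃, p₁, p₂, l₃, l₁, l₂, ⟨h₃, h₁, h₂, n₃, n₁, n₂, hl₃, hl₁, hl₂, by linarith,
        by rw [← hz]; abel⟩, c, b⟩
    · exact ⟨p₁, p₃, p₂, l₁, l₃, l₂, ⟨h₁, h₃, h₂, n₁, n₃, n₂, hl₁, hl₃, hl₂, by linarith,
        by rw [← hz]; abel⟩, c, a⟩
    · exact ⟨p₁, p₂, p₃, l₁, l₂, l₃, ⟨h₁, h₂, h₃, n₁, n₂, n₃, hl₁, hl₂, hl₃, hl, hz⟩, a, c⟩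
    · exact ⟨p₃, p₂, p₁, l₃, l₂, l₁, ⟨h₃, h₂, h₁, n₃, n₂, n₁, hl₃, hl₂, hl₁, by linarith,
        by rw [← hz]; abel⟩, b, c⟩
    · exact ⟨p₂, p₃, p₁, l₂, l₃, l₁, ⟨h₂, h₃, h₁, n₂, n₃, n₁, hl₂, hl₃, hl₁, by linarith,
        by rw [← hz]; abel⟩, b, a⟩
    · exact ⟨p₂, p₃, p₁, l₂, l₃, l₁, ⟨h₂, h₃, h₁, n₂, n₃, n₁, hl₂, hl₃, hl₁, by linarith,
        by rw [← hz]; abel⟩, b, a⟩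
  -- the orientation of the axes
  obtain ⟨v₀, hv₀⟩ := exists_isFrame hu
  obtain ⟨v, hv, hx₁⟩ : ∃ v, IsFrame v u ∧ 0 ≤ ⟪v, p₁ - o⟫_ℝ := by
    rcases le_total 0 ⟪v₀, p₁ - o⟫_ℝ with h | h
    · exact ⟨v₀, hv₀, h⟩
    · exact ⟨-v₀, hv₀.neg_left, by rw [inner_neg_left]; linarith⟩
  -- If the middle vertex lies above the center, u is reversed and the highest and lowest vertices
  -- change roles.
  obtain ⟨u', q₂, q₃, m₂, m₃, hf, hu', hq₂, hq₃, hn₂, hn₃, hm₂, hm₃, hm, hmz, hy₁, hy₂₁, hy₁₃⟩ :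
      ∃ (u' q₂ q₃ : Plane) (m₂ m₃ : ℝ), IsFrame v u' ∧ (u' = u ∨ u' = -u) ∧
        q₂ ∈ K ∧ q₃ ∈ K ∧ ‖q₂ - o‖ = circumradius K ∧ ‖q₃ - o‖ = circumradius K ∧
        0 ≤ m₂ ∧ 0 ≤ m₃ ∧ l₁ + m₂ + m₃ = 1 ∧
        l₁ • (p₁ - o) + m₂ • (q₂ - o) + m₃ • (q₃ - o) = 0 ∧ ⟪u', p₁ - o⟫_ℝ ≤ 0 ∧
        ⟪u', q₂ - o⟫_ℝ ≤ ⟪u', p₁ - o⟫_ℝ ∧ ⟪u', p₁ - o⟫_ℝ ≤ ⟪u', q₃ - o⟫_ℝ := by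
    rcases le_total ⟪u, p₁ - o⟫_ℝ 0 with h | h
    · exact ⟨u, p₂, p₃, l₂, l₃, hv, Or.inl rfl, h₂, h₃, n₂, n₃, hl₂, hl₃, hl, hz, h, h21, h13⟩
    · refine ⟨-u, p₃, p₂, l₃, l₂, hv.neg_right, Or.inr rfl, h₃, h₂, n₃, n₂, hl₃, hl₂,
        by linarith, by rw [← hz]; abel, ?_, ?_, ?_⟩ <;> simp only [inner_neg_left] <;> linarith
  have hcirc : ∀ q : Plane, ‖q - o‖ = circumradius K →
      ⟪v, q - o⟫_ℝ ^ 2 + ⟪u', q - o⟫_ℝ ^ 2 = circumradius K ^ 2 := fun q hq => by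
    rw [← hf.norm_sq, hq]
  have hdist : ∀ q ∈ K, ∀ q' ∈ K, (⟪v, q - o⟫_ℝ - ⟪v, q' - o⟫_ℝ) ^ 2 +
      (⟪u', q - o⟫_ℝ - ⟪u', q' - o⟫_ℝ) ^ 2 ≤ (2 * circumradius K * Real.cos (γ / 2)) ^ 2 := by
    intro q hq q' hq'
    rw [← hf.dist_sq, ← hD]
    exact pow_le_pow_left₀ dist_nonneg (dist_le_diam_of_mem hK.isBounded hq hq') 2
  have hsum : ∀ w : Plane, l₁ * ⟪w, p₁ - o⟫_ℝ + m₂ * ⟪w, q₂ - o⟫_ℝ + m₃ * ⟪w, q₃ - o⟫_ℝ = 0 := by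
    intro w
    rw [← inner_zero_right (𝕜 := ℝ) w, ← hmz, inner_add_right, inner_add_right,
      inner_smul_right, inner_smul_right, inner_smul_right]
  obtain ⟨k, ψ₂, ψ₃, h⟩ := exists_triangle_angles hR hγ hl₁ hm₂ hm₃ hm (hcirc _ n₁)
    (hcirc _ hn₂) (hcirc _ hn₃) (hsum v) (hsum u') (hdist _ h₁ _ hq₂) (hdist _ h₁ _ hq₃)
    (hdist _ hq₂ _ hq₃) hx₁ hy₁ hy₂₁ hy₁₃
  exact ⟨o, v, u', p₁, q₂, q₃, k, ψ₂, ψ₃, hf, hu', h₁, hq₂, hq₃, h⟩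

/-- The triangle alone has breadth at least R(sin(γ + k') + sin(γ − k')) = 2R sin γ cos k'. The last
estimate measures from the bottom of the inball to the highest vertex. It uses ψ₂ < γ; otherwise
both extreme vertices have height at least R sin γ in absolute value. -/
lemma breadth_alternatives (hK : IsCompact K) (hnt : K.Nontrivial)
    (hγ : γ ∈ Set.Ioc 0 (π / 3)) (hD : diameter K = 2 * circumradius K * Real.cos (γ / 2))
    {E : ℝ} (hE : 0 ≤ E)
    (hEρ : (circumradius K * Real.cos (γ / 2)) ^ 2 + E ^ 2 = (diameter K - inradius K) ^ 2)
    {u : Plane} (hu : ‖u‖ = 1) :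
    2 * circumradius K * Real.sin γ * Real.cos (γ / 2) ≤ breadth K u ∧
    (2 * circumradius K * Real.sin γ ≤ breadth K u ∨
      ∃ k ∈ Set.Icc 0 (γ / 2), 2 * circumradius K * Real.sin γ * Real.cos k ≤ breadth K u ∧
        circumradius K * Real.sin (γ + k) + inradius K -
          (E - circumradius K * Real.sin (γ / 2)) * Real.cos (γ / 2 - k) ≤ breadth K u) := by
  have hπ := Real.pi_pos
  have hR := circumradius_pos hK hnt
  obtain ⟨o, v, u', p₁, p₂, p₃, k, ψ₂, ψ₃, hf, hu', h₁, h₂, h₃, hk0, hkπ, hkψ, hkψ', hψ₂, hψ₃, hψ,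
    hx₁, hy₁, hx₂, hy₂, hx₃, hy₃⟩ := exists_triangle_in_body hK hnt hγ hD hu
  obtain ⟨c, hc⟩ := exists_inball hK hnt.nonempty
  have hw : ∀ x ∈ K, ∀ y ∈ K, ⟪u', x - o⟫_ℝ - ⟪u', y - o⟫_ℝ ≤ breadth K u := by
    intro x hx y hy
    rw [← inner_sub_right, sub_sub_sub_cancel_right, inner_sub_right]
    rcases hu' with rfl | rfl
    · exact inner_sub_inner_le_breadth hK hx hy
    · have := inner_sub_inner_le_breadth (u := u) hK hy hx
      rw [inner_neg_left, inner_neg_left]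
      linarith
  set R := circumradius K
  set w := breadth K u
  set r := inradius K
  obtain ⟨k', hk'⟩ : ∃ k', k' = min k (γ / 2) := ⟨_, rfl⟩
  obtain ⟨hs₀, hs₂, hs₃⟩ := sin_le_sin_of_triangle_angles hγ hk0 hk' hkψ hψ₂ hψ₃ hψ
  have hk'0 : 0 ≤ k' := hk' ▸ le_min hk0 (by linarith [hγ.1])
  have hk'1 : k' ≤ γ / 2 := hk' ▸ min_le_right _ _
  have hsγ : 0 < Real.sin γ := Real.sin_pos_of_pos_of_lt_pi hγ.1 (by linarith [hγ.2])
  have hT : R * Real.sin ψ₃ + R * Real.sin ψ₂ ≤ w := by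
    have := hw _ h₃ _ h₂
    rw [hy₃, hy₂] at this
    linarith
  have hTk : 2 * R * Real.sin γ * Real.cos k' ≤ w := by
    have e := Real.sin_add γ k'
    have e' := Real.sin_sub γ k'
    have e2 := mul_le_mul_of_nonneg_left hs₂ hR.le
    have e3 := mul_le_mul_of_nonneg_left hs₃ hR.le
    rw [e'] at e2
    rw [e] at e3
    linarith
  refine ⟨le_trans ?_ hTk, ?_⟩
  · exact mul_le_mul_of_nonneg_left (Real.cos_le_cos_of_nonneg_of_le_pi hk'0
      (by linarith [hγ.2]) hk'1) (by positivity)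
  rcases le_or_gt γ ψ₂ with hψγ | hψγ
  · left
    have e2 := mul_le_mul_of_nonneg_left (sin_le_sin_of_le_of_le_pi_sub (by linarith [hγ.1])
      hψγ (by linarith [hγ.1])) hR.le
    have e3 := mul_le_mul_of_nonneg_left (sin_le_sin_of_le_of_le_pi_sub (α := γ) (ψ := ψ₃)
      (by linarith [hγ.1]) (by linarith) (by linarith)) hR.le
    linarith
  · right
    refine ⟨k', ⟨hk'0, hk'1⟩, hTk, ?_⟩
    have hcd : ∀ p ∈ K, (⟪v, c - o⟫_ℝ - ⟪v, p - o⟫_ℝ) ^ 2 +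
        (⟪u', c - o⟫_ℝ - ⟪u', p - o⟫_ℝ) ^ 2 ≤ (diameter K - r) ^ 2 := by
      intro p hp
      rw [← hf.dist_sq]
      exact pow_le_pow_left₀ dist_nonneg (by linarith [dist_inball_add_le hK hc hp]) 2
    have hcy := center_height_le (cx := ⟪v, c - o⟫_ℝ) (cy := ⟪u', c - o⟫_ℝ) hR hγ hk0 hkπ hk'
      hs₀ hψγ.le hE hEρ (circumradius_le_diameter_sub hK hnt.nonempty)
      (by rw [← hD]; linarith [inradius_nonneg (K := K)])
      (by have := hcd _ h₁; rw [hx₁, hy₁] at this; linarith)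
      (by have := hcd _ h₂; rw [hx₂, hy₂] at this; linarith)
    have hcu := hw _ h₃ _ (add_mem_of_closedBall_subset inradius_nonneg hc hf.norm_right).2
    have e3 := mul_le_mul_of_nonneg_left hs₃ hR.le
    rw [hy₃, show c - r • u' - o = (c - o) - r • u' by abel, inner_sub_right, inner_smul_right,
      hf.inner_self_right] at hcu
    linarith

/-- The three lower bounds for the width. -/
lemma lowerBounds_le_width (hK : IsCompact K) (hnt : K.Nontrivial) :
    lowerBound₁ (inradius K) ≤ width K ∧
    lowerBound₂ (diameter K) (circumradius K) ≤ width K ∧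
    lowerBound₃ (inradius K) (diameter K) (circumradius K) ≤ width K := by
  have hπ := Real.pi_pos
  have hR := circumradius_pos hK hnt
  have hw := two_mul_inradius_le_width hK hnt.nonempty
  obtain ⟨γ, hγ, hD⟩ := exists_apex_angle hK hnt
  obtain ⟨ha, haγ, hs, hac, hsr⟩ := vertex_angles hR hγ hD inradius_nonneg
    (inradius_le_circumradius hK hnt.nonempty) (circumradius_le_diameter_sub hK hnt.nonempty)
  rw [lowerBound₁, lowerBound₂_eq hR hγ hD, lowerBound₃_eq hR hγ hD]
  refine ⟨hw, ?_⟩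
  have hρ := hR.trans_le (circumradius_le_diameter_sub hK hnt.nonempty)
  set a := Real.arccos (diameter K / (2 * (diameter K - inradius K)))
  set s := Real.arcsin (inradius K / (diameter K - inradius K))
  have ha0 : 0 ≤ Real.sin a := Real.sin_nonneg_of_nonneg_of_le_pi ha.1 (by linarith [ha.2])
  -- For γ = 0 both trigonometric bounds vanish; the triangle coordinates need γ > 0.
  rcases hγ.1.eq_or_lt with h0 | h0
  · have : 0 ≤ width K := by linarith [inradius_nonneg (K := K)]
    rw [← h0]
    simpa using this
  · have hE : (circumradius K * Real.cos (γ / 2)) ^ 2 +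
        ((diameter K - inradius K) * Real.sin a) ^ 2 = (diameter K - inradius K) ^ 2 := by
      rw [← hac]
      linear_combination (diameter K - inradius K) ^ 2 * Real.sin_sq_add_cos_sq a
    have halt := fun (u : Plane) (hu : ‖u‖ = 1) => breadth_alternatives hK hnt ⟨h0, hγ.2⟩ hD
      (mul_nonneg hρ.le ha0) hE hu
    refine ⟨le_width fun u hu => (halt u hu).1, le_width fun u hu => ?_⟩
    exact bound_le_of_alternatives hR ⟨h0, hγ.2⟩ hρ ⟨ha.1, by linarith [ha.2]⟩ hs hac rfl hsr
      (hw.trans (width_le_breadth hK hnt.nonempty hu)) (halt u hu).2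

/-! ### A lower bound for the inradius -/

/-- By Carnot's formula cos A + cos B + cos C − 1 is the quotient of inradius and circumradius of a
triangle. For a fixed sum, two cosines decrease when their angles are spread apart. Spreading twice,
up to the cap π/2 − γ/2, leads to the isosceles triangle with apex angle γ. -/
lemma cos_add_cos_add_cos_ge {A B C γ : ℝ} (hγ : γ ∈ Set.Icc 0 (π / 3)) (hA : A ≤ π / 2 - γ / 2)
    (hB : B ≤ π / 2 - γ / 2) (hC : C ≤ π / 2 - γ / 2) (h : A + B + C = π) :
    2 * Real.sin (γ / 2) * (1 - Real.sin (γ / 2)) ≤ Real.cos A + Real.cos B + Real.cos C - 1 := by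
  have hπ := Real.pi_pos
  obtain ⟨h0, h3⟩ := hγ
  have key : ∀ x y z w : ℝ, |x - y| ≤ |z - w| → |z - w| ≤ 2 * π → x + y = z + w → 0 ≤ x + y →
      x + y ≤ π → Real.cos z + Real.cos w ≤ Real.cos x + Real.cos y := by
    intro x y z w h1 h2 h3 h4 h5
    rw [Real.cos_add_cos, Real.cos_add_cos, h3]
    have h6 : 0 ≤ Real.cos ((z + w) / 2) :=
      Real.cos_nonneg_of_mem_Icc ⟨by linarith, by linarith⟩
    have h7 : Real.cos ((z - w) / 2) ≤ Real.cos ((x - y) / 2) := by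
      rw [← Real.cos_abs ((z - w) / 2), ← Real.cos_abs ((x - y) / 2), abs_div, abs_div, abs_two]
      exact Real.cos_le_cos_of_nonneg_of_le_pi (by positivity) (by linarith) (by linarith)
    exact mul_le_mul_of_nonneg_left h7 (by positivity)
  set c := π / 2 - γ / 2 with hc
  have e1 : Real.cos c + Real.cos (π - A - c) ≤ Real.cos B + Real.cos C := by
    refine key _ _ _ _ (abs_le_abs ?_ ?_) ?_ (by ring_nf; linarith) (by linarith) (by linarith)
    · linarith
    · linarith
    · rw [abs_le]; constructor <;> linarith
  have e2 : Real.cos c + Real.cos (π - c - c) ≤ Real.cos A + Real.cos (π - A - c) := by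
    refine key _ _ _ _ (abs_le_abs ?_ ?_) ?_ (by ring_nf) (by linarith) (by linarith)
    · linarith
    · linarith
    · rw [abs_le]; constructor <;> linarith
  have e3 : Real.cos c = Real.sin (γ / 2) := by rw [hc, Real.cos_pi_div_two_sub]
  have e4 : Real.cos (π - c - c) = 1 - 2 * Real.sin (γ / 2) ^ 2 := by
    rw [show π - c - c = 2 * (γ / 2) by rw [hc]; ring, Real.cos_two_mul']
    linear_combination Real.sin_sq_add_cos_sq (γ / 2)
  linarith

/-- Twice the area is inradius times perimeter: for circumradius 1 the left side is twice the area,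
and on the right Carnot's expression for the inradius is multiplied by the perimeter. -/
lemma sin_two_mul_add_sin_two_mul {A B C : ℝ} (h : A + B + C = π) :
    Real.sin (2 * A) + Real.sin (2 * B) + Real.sin (2 * C) =
      2 * (Real.cos A + Real.cos B + Real.cos C - 1) *
        (Real.sin A + Real.sin B + Real.sin C) := by
  have hC : C = π - (A + B) := by linarith
  have h1 : Real.sin C = Real.sin A * Real.cos B + Real.cos A * Real.sin B := by
    rw [hC, Real.sin_pi_sub, Real.sin_add]
  have h2 : Real.cos C = -(Real.cos A * Real.cos B - Real.sin A * Real.sin B) := by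
    rw [hC, Real.cos_pi_sub, Real.cos_add]
  rw [Real.sin_two_mul, Real.sin_two_mul, Real.sin_two_mul, h1, h2]
  have ha := Real.sin_sq_add_cos_sq A
  have hb := Real.sin_sq_add_cos_sq B
  linear_combination (-2 * Real.sin B) * ha - 2 * Real.sin A * hb

/-- A triangle contains the ball around its incenter whose radius is the quotient of twice the
area and the perimeter. -/
lemma closedBall_subset_of_triangle (hK : Convex ℝ K) {v u o p₁ p₂ p₃ : Plane} (hf : IsFrame v u)
    (h₁ : p₁ ∈ K) (h₂ : p₂ ∈ K) (h₃ : p₃ ∈ K) {x₁ y₁ x₂ y₂ x₃ y₃ a₁ a₂ a₃ T ρ : ℝ}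
    (hx₁ : ⟪v, p₁ - o⟫_ℝ = x₁) (hy₁ : ⟪u, p₁ - o⟫_ℝ = y₁) (hx₂ : ⟪v, p₂ - o⟫_ℝ = x₂)
    (hy₂ : ⟪u, p₂ - o⟫_ℝ = y₂) (hx₃ : ⟪v, p₃ - o⟫_ℝ = x₃) (hy₃ : ⟪u, p₃ - o⟫_ℝ = y₃)
    (ha₁ : 0 < a₁) (ha₂ : 0 < a₂) (ha₃ : 0 < a₃)
    (hs₁ : (x₂ - x₃) ^ 2 + (y₂ - y₃) ^ 2 = a₁ ^ 2)
    (hs₂ : (x₁ - x₃) ^ 2 + (y₁ - y₃) ^ 2 = a₂ ^ 2)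
    (hs₃ : (x₁ - x₂) ^ 2 + (y₁ - y₂) ^ 2 = a₃ ^ 2)
    (hT : T = x₁ * y₃ - x₃ * y₁ + (x₃ * y₂ - x₂ * y₃) + (x₂ * y₁ - x₁ * y₂)) (hT0 : 0 < T)
    (hρ : ρ * (a₁ + a₂ + a₃) = T) :
    ∃ c, closedBall c ρ ⊆ K := by
  have hS : 0 < a₁ + a₂ + a₃ := by positivity
  have hρ0 : 0 < ρ := pos_of_mul_pos_left (hρ ▸ hT0) hS.le
  set S := a₁ + a₂ + a₃ with hSd
  refine ⟨o + ((a₁ * x₁ + a₂ * x₂ + a₃ * x₃) / S) • v + ((a₁ * y₁ + a₂ * y₂ + a₃ * y₃) / S) • u,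
    fun q hq => ?_⟩
  have hq' := pow_le_pow_left₀ dist_nonneg (mem_closedBall.1 hq) 2
  rw [hf.dist_sq _ _ o, add_assoc, add_sub_cancel_left, hf.inner_left_comb,
    hf.inner_right_comb] at hq'
  set x := ⟪v, q - o⟫_ℝ with hx
  set y := ⟪u, q - o⟫_ℝ with hy
  set zx := x - (a₁ * x₁ + a₂ * x₂ + a₃ * x₃) / S with hzx
  set zy := y - (a₁ * y₁ + a₂ * y₂ + a₃ * y₃) / S with hzy
  have hxS : S * x = a₁ * x₁ + a₂ * x₂ + a₃ * x₃ + S * zx := by rw [hzx]; field_simp; ring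
  have hyS : S * y = a₁ * y₁ + a₂ * y₂ + a₃ * y₃ + S * zy := by rw [hzy]; field_simp; ring
  -- Cauchy–Schwarz: a displacement of length at most ρ changes the signed distance to a side by at
  -- most ρ. The incenter has distance ρ to every side, so the barycentric coordinates below stay
  -- nonnegative.
  have key : ∀ (X Y a : ℝ), 0 < a → X ^ 2 + Y ^ 2 = a ^ 2 → zx * Y - zy * X ≤ ρ * a := by
    intro X Y a ha hXY
    refine (abs_le_of_sq_le_sq' ?_ (by positivity)).2
    have : (zx ^ 2 + zy ^ 2) * (X ^ 2 + Y ^ 2) ≤ ρ ^ 2 * a ^ 2 := by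
      rw [hXY]; exact mul_le_mul_of_nonneg_right hq' (sq_nonneg _)
    linear_combination this + sq_nonneg (zx * X + zy * Y)
  -- the barycentric coordinates of `q`
  set b₁ := (x₃ - x) * (y₂ - y) - (x₂ - x) * (y₃ - y) with hb₁
  set b₂ := (x₁ - x) * (y₃ - y) - (x₃ - x) * (y₁ - y) with hb₂
  set b₃ := (x₂ - x) * (y₁ - y) - (x₁ - x) * (y₂ - y) with hb₃
  have hb₁0 : 0 ≤ b₁ := by
    have : S * b₁ = S * (ρ * a₁ - (zx * (y₂ - y₃) - zy * (x₂ - x₃))) := by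
      rw [hb₁]
      linear_combination (y₃ - y₂) * hxS + (x₂ - x₃) * hyS +
        (x₃ * y₂ - x₂ * y₃) * hSd - a₁ * hρ - a₁ * hT
    rw [mul_left_cancel₀ hS.ne' this]
    linarith [key (x₂ - x₃) (y₂ - y₃) a₁ ha₁ hs₁]
  have hb₂0 : 0 ≤ b₂ := by
    have : S * b₂ = S * (ρ * a₂ - (zx * (y₃ - y₁) - zy * (x₃ - x₁))) := by
      rw [hb₂]
      linear_combination (y₁ - y₃) * hxS + (x₃ - x₁) * hyS +
        (x₁ * y₃ - x₃ * y₁) * hSd - a₂ * hρ - a₂ * hT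
    rw [mul_left_cancel₀ hS.ne' this]
    linarith [key (x₃ - x₁) (y₃ - y₁) a₂ ha₂ (by rw [← hs₂]; ring)]
  have hb₃0 : 0 ≤ b₃ := by
    have : S * b₃ = S * (ρ * a₃ - (zx * (y₁ - y₂) - zy * (x₁ - x₂))) := by
      rw [hb₃]
      linear_combination (y₂ - y₁) * hxS + (x₁ - x₂) * hyS +
        (x₂ * y₁ - x₁ * y₂) * hSd - a₃ * hρ - a₃ * hT
    rw [mul_left_cancel₀ hS.ne' this]
    linarith [key (x₁ - x₂) (y₁ - y₂) a₃ ha₃ hs₃]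
  have hbT : b₁ + b₂ + b₃ = T := by rw [hb₁, hb₂, hb₃, hT]; ring
  have hqeq : q = (b₁ / T) • p₁ + (b₂ / T) • p₂ + (b₃ / T) • p₃ := by
    have h1 : b₁ / T + b₂ / T + b₃ / T = 1 := by rw [← add_div, ← add_div, hbT, div_self hT0.ne']
    have h2 : q - o = (b₁ / T) • (p₁ - o) + (b₂ / T) • (p₂ - o) + (b₃ / T) • (p₃ - o) := by
      apply hf.ext <;> simp only [inner_add_right, inner_smul_right, hx₁, hx₂, hx₃, hy₁, hy₂, hy₃]
      · rw [← hx]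
        field_simp
        rw [hT, hb₁, hb₂, hb₃]; ring
      · rw [← hy]
        field_simp
        rw [hT, hb₁, hb₂, hb₃]; ring
    have h3 : (b₁ / T) • (p₁ - o) + (b₂ / T) • (p₂ - o) + (b₃ / T) • (p₃ - o) =
        (b₁ / T) • p₁ + (b₂ / T) • p₂ + (b₃ / T) • p₃ - (b₁ / T + b₂ / T + b₃ / T) • o := by module
    rw [h3, h1, one_smul] at h2
    exact sub_left_injective h2
  rw [hqeq]
  have hw : b₁ / T + b₂ / T + b₃ / T = 1 := by rw [← add_div, ← add_div, hbT, div_self hT0.ne']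
  have := hK.sum_mem (t := Finset.univ) (w := ![b₁ / T, b₂ / T, b₃ / T]) (z := ![p₁, p₂, p₃])
    (by intro i _; fin_cases i <;> simp <;> positivity)
    (by simpa [Fin.sum_univ_three] using hw) (by intro i _; fin_cases i <;> simpa)
  simpa [Fin.sum_univ_three] using this

/-- The sides of the contact triangle are at most D, so its angles are at most π/2 − γ/2 and its
inradius R(cos A + cos B + cos C − 1) is least for the isosceles triangle. -/
lemma le_inradius_of_apex_angle (hK : IsCompact K) (hKc : Convex ℝ K) (hnt : K.Nontrivial)
    (hγ : γ ∈ Set.Icc 0 (π / 3)) (hD : diameter K = 2 * circumradius K * Real.cos (γ / 2)) :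
    2 * circumradius K * Real.sin (γ / 2) * (1 - Real.sin (γ / 2)) ≤ inradius K := by
  have hπ := Real.pi_pos
  have hR := circumradius_pos hK hnt
  rcases hγ.1.eq_or_lt with h0 | h0
  · rw [← h0]; simpa using inradius_nonneg
  obtain ⟨u, hu⟩ := (NormedSpace.sphere_nonempty (E := Plane) (x := 0) (r := 1)).2 zero_le_one
  obtain ⟨o, v, u', p₁, p₂, p₃, k, ψ₂, ψ₃, hf, hu', h₁, h₂, h₃, hk0, hkπ, hkψ, hkψ', hψ₂, hψ₃, hψ,
    hx₁, hy₁, hx₂, hy₂, hx₃, hy₃⟩ :=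
    exists_triangle_in_body hK hnt ⟨h0, hγ.2⟩ hD (u := u) (by simpa using hu)
  set R := circumradius K
  -- A, B, C are the angles at p₁, p₂, p₃, half the central angles of the opposite sides.
  obtain ⟨A, hA⟩ : ∃ A, A = (ψ₂ + ψ₃) / 2 := ⟨_, rfl⟩
  obtain ⟨B, hB⟩ : ∃ B, B = (π - ψ₃ + k) / 2 := ⟨_, rfl⟩
  obtain ⟨C, hC⟩ : ∃ C, C = (π - ψ₂ - k) / 2 := ⟨_, rfl⟩
  have hABC : A + B + C = π := by rw [hA, hB, hC]; ring
  have hA2 : A ≤ π / 2 - γ / 2 := by linarith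
  have hB2 : B ≤ π / 2 - γ / 2 := by linarith
  have hC2 : C ≤ π / 2 - γ / 2 := by linarith
  have hpos : ∀ x y z : ℝ, x ≤ π / 2 - γ / 2 → y ≤ π / 2 - γ / 2 → z ≤ π / 2 - γ / 2 →
      x + y + z = π → 0 < Real.sin x := fun x y z h1 h2 h3 h4 =>
    Real.sin_pos_of_pos_of_lt_pi (by linarith) (by linarith)
  have hsA := hpos A B C hA2 hB2 hC2 hABC
  have hsB := hpos B A C hB2 hA2 hC2 (by linarith)
  have hsC := hpos C A B hC2 hA2 hB2 (by linarith)
  have hcos := cos_add_cos_add_cos_ge hγ hA2 hB2 hC2 hABC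
  have hσ : 0 < Real.sin (γ / 2) := Real.sin_pos_of_pos_of_lt_pi (by linarith) (by linarith [hγ.2])
  have hσ1 : Real.sin (γ / 2) < 1 := by
    rw [← Real.sin_pi_div_two]
    exact Real.sin_lt_sin_of_lt_of_le_pi_div_two (by linarith) le_rfl (by linarith [hγ.2])
  have hX : 0 < Real.cos A + Real.cos B + Real.cos C - 1 :=
    lt_of_lt_of_le (mul_pos (by linarith) (by linarith)) hcos
  have s1 : Real.sin (ψ₂ + ψ₃) = Real.sin (2 * A) := by congr 1; rw [hA]; ring
  have s2 : Real.sin (ψ₃ - k) = Real.sin (2 * B) := by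
    rw [← Real.sin_pi_sub]; congr 1; rw [hB]; ring
  have s3 : Real.sin (ψ₂ + k) = Real.sin (2 * C) := by
    rw [← Real.sin_pi_sub]; congr 1; rw [hC]; ring
  have c1 : Real.cos (ψ₂ + ψ₃) = 1 - 2 * Real.sin A ^ 2 := by
    rw [show ψ₂ + ψ₃ = 2 * A by rw [hA]; ring, Real.cos_two_mul']
    linear_combination Real.sin_sq_add_cos_sq A
  have c2 : Real.cos (ψ₃ - k) = -(1 - 2 * Real.sin B ^ 2) := by
    rw [show ψ₃ - k = π - 2 * B by rw [hB]; ring, Real.cos_pi_sub, Real.cos_two_mul']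
    linear_combination -Real.sin_sq_add_cos_sq B
  have c3 : Real.cos (ψ₂ + k) = -(1 - 2 * Real.sin C ^ 2) := by
    rw [show ψ₂ + k = π - 2 * C by rw [hC]; ring, Real.cos_pi_sub, Real.cos_two_mul']
    linear_combination -Real.sin_sq_add_cos_sq C
  rw [Real.sin_add] at s1 s3
  rw [Real.sin_sub] at s2
  rw [Real.cos_add] at c1 c3
  rw [Real.cos_sub] at c2
  have hk := Real.sin_sq_add_cos_sq k
  have h2 := Real.sin_sq_add_cos_sq ψ₂
  have h3 := Real.sin_sq_add_cos_sq ψ₃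
  have hsum := sin_two_mul_add_sin_two_mul hABC
  set X := Real.cos A + Real.cos B + Real.cos C - 1 with hXd
  obtain ⟨c, hc⟩ := closedBall_subset_of_triangle hKc hf h₁ h₂ h₃ hx₁ hy₁ hx₂ hy₂ hx₃ hy₃
    (a₁ := 2 * R * Real.sin A) (a₂ := 2 * R * Real.sin B) (a₃ := 2 * R * Real.sin C)
    (T := R ^ 2 * (Real.sin (2 * A) + Real.sin (2 * B) + Real.sin (2 * C))) (ρ := R * X)
    (by positivity) (by positivity) (by positivity)
    (by linear_combination R ^ 2 * (h2 + h3 - 2 * c1))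
    (by linear_combination R ^ 2 * (hk + h3 + 2 * c2))
    (by linear_combination R ^ 2 * (hk + h2 + 2 * c3))
    (by rw [← s1, ← s2, ← s3]; ring)
    (by rw [hsum]; positivity)
    (by rw [hsum]; ring)
  refine le_trans ?_ (le_inradius hK.isBounded (by positivity) hc)
  have := mul_le_mul_of_nonneg_left hcos hR.le
  linarith

end Inequalities

/-! ### The pentagon region -/

/-- The isosceles triangle with apex `p₁` and apex angle `γ`, inscribed in the circle with center
`o` and radius `R`, in coordinates for which the line from the apex to `o` has inclination `k`
and `p₂`, `p₁`, `p₃` are ordered by height. -/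
structure IsTiltedTriangle (R γ k : ℝ) (o v u p₁ p₂ p₃ : Plane) : Prop where
  frame : IsFrame v u
  radius_pos : 0 < R
  angle_mem : γ ∈ Set.Icc 0 (π / 3)
  tilt_mem : k ∈ Set.Icc (-(γ / 2)) (γ / 2)
  x₁ : ⟪v, p₁ - o⟫_ℝ = R * Real.cos k
  y₁ : ⟪u, p₁ - o⟫_ℝ = -(R * Real.sin k)
  x₂ : ⟪v, p₂ - o⟫_ℝ = -(R * Real.cos (γ - k))
  y₂ : ⟪u, p₂ - o⟫_ℝ = -(R * Real.sin (γ - k))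
  x₃ : ⟪v, p₃ - o⟫_ℝ = -(R * Real.cos (γ + k))
  y₃ : ⟪u, p₃ - o⟫_ℝ = R * Real.sin (γ + k)

lemma pentagonRegion_neg (p₁ p₂ p₃ u : Plane) :
    pentagonRegion p₁ p₂ p₃ (-u) = pentagonRegion p₁ p₂ p₃ u := by
  ext x
  simp only [pentagonRegion, Set.mem_ofPred_eq, inner_neg_left, Set.uIcc, Set.mem_Icc,
    inf_le_iff, le_sup_iff, neg_le_neg_iff]
  tauto

lemma pentagonRegion_eq (p₁ p₂ p₃ u : Plane) :
    pentagonRegion p₁ p₂ p₃ u = (innerSL ℝ u) ⁻¹' Set.uIcc ⟪u, p₂⟫_ℝ ⟪u, p₃⟫_ℝ ∩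
      (closedBall p₁ (dist p₁ p₂) ∩ (closedBall p₂ (dist p₁ p₂) ∩ closedBall p₃ (dist p₁ p₂))) :=
  rfl

lemma isCompact_pentagonRegion (p₁ p₂ p₃ u : Plane) : IsCompact (pentagonRegion p₁ p₂ p₃ u) := by
  rw [pentagonRegion_eq]
  exact ((isCompact_closedBall _ _).inter_right
    (isClosed_closedBall.inter isClosed_closedBall)).inter_left
    (isClosed_Icc.preimage (innerSL ℝ u).continuous)

lemma convex_pentagonRegion (p₁ p₂ p₃ u : Plane) : Convex ℝ (pentagonRegion p₁ p₂ p₃ u) := by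
  rw [pentagonRegion_eq]
  exact ((convex_uIcc _ _).linear_preimage (innerSL ℝ u).toLinearMap).inter
    ((convex_closedBall _ _).inter ((convex_closedBall _ _).inter (convex_closedBall _ _)))

/-! ### Metric properties of the tilted triangle and its region -/

namespace IsTiltedTriangle

variable {R γ k : ℝ} {o v u p₁ p₂ p₃ : Plane}

section Trig

lemma sin_nonneg (h : IsTiltedTriangle R γ k o v u p₁ p₂ p₃) : 0 ≤ Real.sin γ :=
  Real.sin_nonneg_of_nonneg_of_le_pi h.angle_mem.1 (by linarith [h.angle_mem.2, Real.pi_pos])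

lemma cos_half_pos (h : IsTiltedTriangle R γ k o v u p₁ p₂ p₃) : 0 < Real.cos (γ / 2) :=
  Real.cos_pos_of_mem_Ioo ⟨by linarith [h.angle_mem.1, Real.pi_pos],
    by linarith [h.angle_mem.2, Real.pi_pos]⟩

lemma cos_angle_pos (h : IsTiltedTriangle R γ k o v u p₁ p₂ p₃) : 0 < Real.cos γ :=
  Real.cos_pos_of_mem_Ioo ⟨by linarith [h.angle_mem.1, Real.pi_pos],
    by linarith [h.angle_mem.2, Real.pi_pos]⟩

lemma cos_tilt_pos (h : IsTiltedTriangle R γ k o v u p₁ p₂ p₃) : 0 < Real.cos k :=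
  Real.cos_pos_of_mem_Ioo ⟨by linarith [h.angle_mem.2, h.tilt_mem.1, Real.pi_pos],
    by linarith [h.angle_mem.2, h.tilt_mem.2, Real.pi_pos]⟩

/-- The coordinates of the legs of the triangle. -/
lemma leg_coords (h : IsTiltedTriangle R γ k o v u p₁ p₂ p₃) :
    ⟪v, p₂ - o⟫_ℝ = ⟪v, p₁ - o⟫_ℝ - 2 * R * Real.cos (γ / 2) * Real.cos (γ / 2 - k) ∧
    ⟪u, p₂ - o⟫_ℝ = ⟪u, p₁ - o⟫_ℝ - 2 * R * Real.cos (γ / 2) * Real.sin (γ / 2 - k) ∧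
    ⟪v, p₃ - o⟫_ℝ = ⟪v, p₁ - o⟫_ℝ - 2 * R * Real.cos (γ / 2) * Real.cos (γ / 2 + k) ∧
    ⟪u, p₃ - o⟫_ℝ = ⟪u, p₁ - o⟫_ℝ + 2 * R * Real.cos (γ / 2) * Real.sin (γ / 2 + k) := by
  obtain ⟨θ, hθ⟩ : ∃ θ, θ = γ / 2 - k := ⟨_, rfl⟩
  obtain ⟨η, hη⟩ : ∃ η, η = γ / 2 + k := ⟨_, rfl⟩
  have e1 : k = γ / 2 - θ := by rw [hθ]; ring
  have e2 : k = η - γ / 2 := by rw [hη]; ring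
  have e3 : γ - k = γ / 2 + θ := by rw [hθ]; ring
  have e4 : γ + k = η + γ / 2 := by rw [hη]; ring
  rw [← hθ, ← hη]
  refine ⟨?_, ?_, ?_, ?_⟩
  · rw [h.x₂, h.x₁, e3, e1, Real.cos_add, Real.cos_sub]; ring
  · rw [h.y₂, h.y₁, e3, e1, Real.sin_add, Real.sin_sub]; ring
  · rw [h.x₃, h.x₁, e4, e2, Real.cos_add, Real.cos_sub]; ring
  · rw [h.y₃, h.y₁, e4, e2, Real.sin_add, Real.sin_sub]; ring

end Trig

lemma norm_sub (h : IsTiltedTriangle R γ k o v u p₁ p₂ p₃) :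
    ‖p₁ - o‖ = R ∧ ‖p₂ - o‖ = R ∧ ‖p₃ - o‖ = R := by
  refine ⟨?_, ?_, ?_⟩ <;>
    rw [← pow_left_inj₀ (norm_nonneg _) h.radius_pos.le two_ne_zero, h.frame.norm_sq]
  · rw [h.x₁, h.y₁]; linear_combination R ^ 2 * Real.sin_sq_add_cos_sq k
  · rw [h.x₂, h.y₂]; linear_combination R ^ 2 * Real.sin_sq_add_cos_sq (γ - k)
  · rw [h.x₃, h.y₃]; linear_combination R ^ 2 * Real.sin_sq_add_cos_sq (γ + k)

lemma leg_pos (h : IsTiltedTriangle R γ k o v u p₁ p₂ p₃) : 0 < 2 * R * Real.cos (γ / 2) :=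
  mul_pos (by linarith [h.radius_pos]) h.cos_half_pos

lemma dist_legs (h : IsTiltedTriangle R γ k o v u p₁ p₂ p₃) :
    dist p₁ p₂ = 2 * R * Real.cos (γ / 2) ∧ dist p₁ p₃ = 2 * R * Real.cos (γ / 2) := by
  obtain ⟨h1, h2, h3, h4⟩ := h.leg_coords
  constructor <;>
    rw [← pow_left_inj₀ dist_nonneg h.leg_pos.le two_ne_zero, h.frame.dist_sq _ _ o]
  · rw [h1, h2]
    linear_combination (2 * R * Real.cos (γ / 2)) ^ 2 * Real.sin_sq_add_cos_sq (γ / 2 - k)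
  · rw [h3, h4]
    linear_combination (2 * R * Real.cos (γ / 2)) ^ 2 * Real.sin_sq_add_cos_sq (γ / 2 + k)

lemma height_base (h : IsTiltedTriangle R γ k o v u p₁ p₂ p₃) :
    ⟪u, p₃ - o⟫_ℝ - ⟪u, p₂ - o⟫_ℝ = 2 * R * Real.sin γ * Real.cos k := by
  rw [h.y₂, h.y₃, Real.sin_add, Real.sin_sub]; ring

lemma height_base_nonneg (h : IsTiltedTriangle R γ k o v u p₁ p₂ p₃) :
    0 ≤ 2 * R * Real.sin γ * Real.cos k :=
  mul_nonneg (mul_nonneg (by linarith [h.radius_pos]) h.sin_nonneg) h.cos_tilt_pos.le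

lemma inner_sub_base (h : IsTiltedTriangle R γ k o v u p₁ p₂ p₃) :
    ⟪u, p₃ - p₂⟫_ℝ = 2 * R * Real.sin γ * Real.cos k := by
  rw [← h.height_base, ← inner_sub_right, sub_sub_sub_cancel_right]

/-- The base is 2 sin(γ/2) times a leg, and γ ≤ π/3. -/
lemma dist_base_le (h : IsTiltedTriangle R γ k o v u p₁ p₂ p₃) :
    dist p₂ p₃ ≤ 2 * R * Real.cos (γ / 2) := by
  refine abs_le_of_sq_le_sq' ?_ h.leg_pos.le |>.2
  rw [h.frame.dist_sq _ _ o, h.x₂, h.x₃, h.y₂, h.y₃, Real.sin_add, Real.sin_sub, Real.cos_add,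
    Real.cos_sub]
  have h1 := Real.sin_sq_add_cos_sq k
  have h2 : Real.sin (γ / 2) ≤ 1 / 2 := by
    rw [← Real.sin_pi_div_six]
    exact Real.sin_le_sin_of_le_of_le_pi_div_two (by linarith [h.angle_mem.1, Real.pi_pos])
      (by linarith [Real.pi_pos]) (by linarith [h.angle_mem.2])
  have h3 : 0 ≤ Real.sin (γ / 2) := Real.sin_nonneg_of_nonneg_of_le_pi
    (by linarith [h.angle_mem.1]) (by linarith [h.angle_mem.2, Real.pi_pos])
  have h4 : Real.sin (γ / 2) ^ 2 ≤ 1 / 4 := by nlinarith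
  have h5 : (2 * R * Real.cos (γ / 2)) ^ 2 * (4 * Real.sin (γ / 2) ^ 2) ≤
      (2 * R * Real.cos (γ / 2)) ^ 2 * 1 :=
    mul_le_mul_of_nonneg_left (by linarith) (sq_nonneg _)
  have h6 := sin_eq_two_mul_half γ
  have h7 : Real.sin γ ^ 2 = (2 * Real.sin (γ / 2) * Real.cos (γ / 2)) ^ 2 := by rw [h6]
  linear_combination h5 + 4 * R ^ 2 * Real.sin γ ^ 2 * h1 + 4 * R ^ 2 * h7

/-- The circumcenter as a convex combination of the vertices. -/
lemma weights (h : IsTiltedTriangle R γ k o v u p₁ p₂ p₃) :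
    0 ≤ 2 * Real.cos γ / (2 * Real.cos γ + 2) ∧ 0 ≤ 1 / (2 * Real.cos γ + 2) ∧
    2 * Real.cos γ / (2 * Real.cos γ + 2) + 1 / (2 * Real.cos γ + 2) + 1 / (2 * Real.cos γ + 2) = 1 ∧
    (2 * Real.cos γ / (2 * Real.cos γ + 2)) • (p₁ - o) + (1 / (2 * Real.cos γ + 2)) • (p₂ - o) +
      (1 / (2 * Real.cos γ + 2)) • (p₃ - o) = 0 := by
  have hc := h.cos_angle_pos
  refine ⟨by positivity, by positivity, by field_simp; ring, ?_⟩
  apply h.frame.ext <;> simp only [inner_add_right, inner_smul_right, inner_zero_right]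
  · rw [h.x₁, h.x₂, h.x₃, Real.cos_add, Real.cos_sub]; field_simp; ring
  · rw [h.y₁, h.y₂, h.y₃, Real.sin_add, Real.sin_sub]; field_simp; ring

lemma mem_region_iff (h : IsTiltedTriangle R γ k o v u p₁ p₂ p₃) {x : Plane} :
    x ∈ pentagonRegion p₁ p₂ p₃ u ↔
      ⟪u, x - o⟫_ℝ ∈ Set.Icc (-(R * Real.sin (γ - k))) (R * Real.sin (γ + k)) ∧
      dist x p₁ ≤ 2 * R * Real.cos (γ / 2) ∧ dist x p₂ ≤ 2 * R * Real.cos (γ / 2) ∧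
      dist x p₃ ≤ 2 * R * Real.cos (γ / 2) := by
  have h1 := h.height_base
  have h2 := h.height_base_nonneg
  rw [inner_sub_right, inner_sub_right] at h1
  rw [pentagonRegion, Set.mem_ofPred_eq, h.dist_legs.1, Set.uIcc_of_le (by linarith), ← h.y₂,
    ← h.y₃, inner_sub_right, inner_sub_right, inner_sub_right, Set.mem_Icc, Set.mem_Icc,
    sub_le_sub_iff_right, sub_le_sub_iff_right]

lemma vertices_mem (h : IsTiltedTriangle R γ k o v u p₁ p₂ p₃) :
    p₁ ∈ pentagonRegion p₁ p₂ p₃ u ∧ p₂ ∈ pentagonRegion p₁ p₂ p₃ u ∧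
      p₃ ∈ pentagonRegion p₁ p₂ p₃ u := by
  obtain ⟨-, h2, -, h4⟩ := h.leg_coords
  have hπ := Real.pi_pos
  have hD := h.leg_pos
  have s2 : 0 ≤ Real.sin (γ / 2 - k) := Real.sin_nonneg_of_nonneg_of_le_pi
    (by linarith [h.tilt_mem.2]) (by linarith [h.tilt_mem.1, h.angle_mem.2])
  have s4 : 0 ≤ Real.sin (γ / 2 + k) := Real.sin_nonneg_of_nonneg_of_le_pi
    (by linarith [h.tilt_mem.1]) (by linarith [h.tilt_mem.2, h.angle_mem.2])
  have m2 := mul_nonneg hD.le s2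
  have m4 := mul_nonneg hD.le s4
  have hb := h.height_base
  have hb' := h.height_base_nonneg
  simp only [h.mem_region_iff, ← h.y₂, ← h.y₃, Set.mem_Icc, dist_self]
  refine ⟨⟨⟨by linarith, by linarith⟩, hD.le, h.dist_legs.1.le, h.dist_legs.2.le⟩,
    ⟨⟨by linarith, by linarith⟩, by rw [dist_comm]; exact h.dist_legs.1.le, hD.le, h.dist_base_le⟩,
    ⟨⟨by linarith, by linarith⟩, by rw [dist_comm]; exact h.dist_legs.2.le,
      by rw [dist_comm]; exact h.dist_base_le, hD.le⟩⟩

lemma convexHull_subset (h : IsTiltedTriangle R γ k o v u p₁ p₂ p₃) :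
    convexHull ℝ {p₁, p₂, p₃} ⊆ pentagonRegion p₁ p₂ p₃ u := by
  refine convexHull_min ?_ (convex_pentagonRegion _ _ _ _)
  obtain ⟨h1, h2, h3⟩ := h.vertices_mem
  rintro x (rfl | rfl | rfl) <;> assumption

/-- The region lies in the circumdisk of the triangle. -/
lemma region_subset_closedBall (h : IsTiltedTriangle R γ k o v u p₁ p₂ p₃) :
    pentagonRegion p₁ p₂ p₃ u ⊆ closedBall o R := by
  intro x hx
  obtain ⟨⟨hy₂, hy₃⟩, d₁, d₂, d₃⟩ := h.mem_region_iff.1 hx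
  have hπ := Real.pi_pos
  have hR := h.radius_pos
  obtain ⟨hγ0, hγ3⟩ := h.angle_mem
  obtain ⟨hk0, hk1⟩ := h.tilt_mem
  have hcγ := h.cos_angle_pos
  rw [mem_closedBall, dist_eq_norm]
  by_contra hcon
  push Not at hcon
  have hξ0 := hR.trans hcon
  have hn := h.frame.norm_sq (x - o)
  set ξ := ‖x - o‖ with hξ
  set X := ⟪v, x - o⟫_ℝ with hX
  set Y := ⟪u, x - o⟫_ℝ with hY
  have hYξ := abs_le_of_sq_le_sq' (by nlinarith [sq_nonneg X] : Y ^ 2 ≤ ξ ^ 2) hξ0.le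
  obtain ⟨φ, hφ⟩ : ∃ φ, φ = Real.arcsin (Y / ξ) := ⟨_, rfl⟩
  have hsφ : Y = ξ * Real.sin φ := by
    rw [hφ, Real.sin_arcsin (by rw [le_div_iff₀ hξ0]; linarith)
      (by rw [div_le_iff₀ hξ0]; linarith)]
    field_simp
  have hφ1 : -(π / 2) ≤ φ := hφ ▸ Real.neg_pi_div_two_le_arcsin _
  have hφ2 : φ ≤ π / 2 := hφ ▸ Real.arcsin_le_pi_div_two _
  have hcφ : 0 ≤ Real.cos φ := Real.cos_nonneg_of_mem_Icc ⟨hφ1, hφ2⟩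
  have hXφ : X ^ 2 = (ξ * Real.cos φ) ^ 2 := by
    rw [hsφ] at hn
    linear_combination -hn - ξ ^ 2 * Real.sin_sq_add_cos_sq φ
  have hφ3 : φ ≤ γ + k := by
    by_contra hlt
    push Not at hlt
    have h1 : Real.sin (γ + k) < Real.sin φ :=
      Real.sin_lt_sin_of_lt_of_le_pi_div_two (by linarith) hφ2 hlt
    have h2 : 0 ≤ Real.sin (γ + k) :=
      Real.sin_nonneg_of_nonneg_of_le_pi (by linarith) (by linarith)
    nlinarith
  have hφ4 : -(γ - k) ≤ φ := by
    by_contra hlt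
    push Not at hlt
    have h1 : Real.sin φ < Real.sin (-(γ - k)) :=
      Real.sin_lt_sin_of_lt_of_le_pi_div_two hφ1 (by linarith) hlt
    have h2 : 0 ≤ Real.sin (γ - k) :=
      Real.sin_nonneg_of_nonneg_of_le_pi (by linarith) (by linarith)
    rw [Real.sin_neg] at h1
    nlinarith
  -- A point outside the circumdisk whose direction differs by at most γ from the antipode of a
  -- vertex has distance greater than D from that vertex. The strip confines φ so that one vertex
  -- always qualifies: p₂ or p₃ on the right, p₁ on the left.
  have key : ∀ (p : Plane) (x' y' ω : ℝ), dist x p ≤ 2 * R * Real.cos (γ / 2) →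
      ⟪v, p - o⟫_ℝ = x' → ⟪u, p - o⟫_ℝ = y' → x' ^ 2 + y' ^ 2 = R ^ 2 → |ω| ≤ γ →
      X * x' + Y * y' = -(R * ξ * Real.cos ω) → False := by
    intro p x' y' ω hd hx' hy' hxy hω he
    have h1 := pow_le_pow_left₀ dist_nonneg hd 2
    rw [h.frame.dist_sq _ _ o, hx', hy', mul_pow, Real.cos_sq,
      show 2 * (γ / 2) = γ by ring] at h1
    have h2 : Real.cos γ ≤ Real.cos ω := by
      rw [← Real.cos_abs ω]
      exact Real.cos_le_cos_of_nonneg_of_le_pi (abs_nonneg _) (by linarith) hω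
    have h3 : R * ξ * Real.cos γ ≤ R * ξ * Real.cos ω :=
      mul_le_mul_of_nonneg_left h2 (by positivity)
    have h4 : R * R * Real.cos γ ≤ R * ξ * Real.cos γ :=
      mul_le_mul_of_nonneg_right (mul_le_mul_of_nonneg_left hcon.le hR.le) hcγ.le
    have h5 : R ^ 2 < ξ ^ 2 := pow_lt_pow_left₀ hcon hR.le two_ne_zero
    linarith
  rcases sq_eq_sq_iff_eq_or_eq_neg.1 hXφ with hX' | hX'
  · rcases le_total (-k) φ with hkφ | hkφ
    · refine key p₂ _ _ (φ - (γ - k)) d₂ h.x₂ h.y₂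
        (by linear_combination R ^ 2 * Real.sin_sq_add_cos_sq (γ - k)) ?_ ?_
      · rw [abs_le]; constructor <;> linarith
      · rw [hX', hsφ, Real.cos_sub φ]; ring
    · refine key p₃ _ _ (φ + (γ + k)) d₃ h.x₃ h.y₃
        (by linear_combination R ^ 2 * Real.sin_sq_add_cos_sq (γ + k)) ?_ ?_
      · rw [abs_le]; constructor <;> linarith
      · rw [hX', hsφ, Real.cos_add φ]; ring
  · refine key p₁ _ _ (φ - k) d₁ h.x₁ h.y₁
      (by linear_combination R ^ 2 * Real.sin_sq_add_cos_sq k) ?_ ?_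
    · rw [abs_le]; constructor <;> linarith
    · rw [hX', hsφ, Real.cos_sub φ]; ring

set_option maxHeartbeats 1000000 in
/-- The region has diameter at most the length of the legs. -/
lemma dist_le_of_mem_region (h : IsTiltedTriangle R γ k o v u p₁ p₂ p₃) {x y : Plane}
    (hx : x ∈ pentagonRegion p₁ p₂ p₃ u) (hy : y ∈ pentagonRegion p₁ p₂ p₃ u) :
    dist x y ≤ 2 * R * Real.cos (γ / 2) := by
  wlog hxy : ⟪v, x - o⟫_ℝ ≤ ⟪v, y - o⟫_ℝ generalizing x y
  · rw [dist_comm]; exact this hy hx (le_of_not_ge hxy)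
  obtain ⟨⟨hx₂, hx₃⟩, d₁, -, -⟩ := h.mem_region_iff.1 hx
  obtain ⟨-, e₁, e₂, e₃⟩ := h.mem_region_iff.1 hy
  obtain ⟨l₁, l₂, l₃, l₄⟩ := h.leg_coords
  have hπ := Real.pi_pos
  have hsγ := h.sin_nonneg
  obtain ⟨hγ0, hγ3⟩ := h.angle_mem
  obtain ⟨hk0, hk1⟩ := h.tilt_mem
  have hD := h.leg_pos
  rw [← h.y₂] at hx₂
  rw [← h.y₃] at hx₃
  have d₁' := pow_le_pow_left₀ dist_nonneg d₁ 2
  have e₂' := pow_le_pow_left₀ dist_nonneg e₂ 2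
  have e₃' := pow_le_pow_left₀ dist_nonneg e₃ 2
  refine (abs_le_of_sq_le_sq' ?_ hD.le).2
  rw [h.frame.dist_sq _ _ o] at d₁' e₂' e₃' ⊢
  set D := 2 * R * Real.cos (γ / 2) with hDd
  rw [l₁, l₂] at e₂'
  rw [l₃, l₄] at e₃'
  rw [l₂] at hx₂
  rw [l₄] at hx₃
  obtain ⟨θ₂, hθ₂⟩ : ∃ θ₂, θ₂ = γ / 2 - k := ⟨_, rfl⟩
  obtain ⟨θ₃, hθ₃⟩ : ∃ θ₃, θ₃ = γ / 2 + k := ⟨_, rfl⟩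
  rw [← hθ₂] at e₂' hx₂
  rw [← hθ₃] at e₃' hx₃
  -- coordinates relative to the apex
  obtain ⟨X, hX⟩ : ∃ X, X = ⟪v, x - o⟫_ℝ - ⟪v, p₁ - o⟫_ℝ := ⟨_, rfl⟩
  obtain ⟨Y, hY⟩ : ∃ Y, Y = ⟪u, x - o⟫_ℝ - ⟪u, p₁ - o⟫_ℝ := ⟨_, rfl⟩
  obtain ⟨X', hX'⟩ : ∃ X', X' = ⟪v, y - o⟫_ℝ - ⟪v, p₁ - o⟫_ℝ := ⟨_, rfl⟩
  obtain ⟨Y', hY'⟩ : ∃ Y', Y' = ⟪u, y - o⟫_ℝ - ⟪u, p₁ - o⟫_ℝ := ⟨_, rfl⟩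
  rw [← hX, ← hY] at d₁'
  have f₂ : (X' + D * Real.cos θ₂) ^ 2 + (Y' + D * Real.sin θ₂) ^ 2 ≤ D ^ 2 := by
    rw [hX', hY']; refine le_trans (le_of_eq ?_) e₂'; ring
  have f₃ : (X' + D * Real.cos θ₃) ^ 2 + (Y' - D * Real.sin θ₃) ^ 2 ≤ D ^ 2 := by
    rw [hX', hY']; refine le_trans (le_of_eq ?_) e₃'; ring
  have hgoal : (⟪v, x - o⟫_ℝ - ⟪v, y - o⟫_ℝ) ^ 2 + (⟪u, x - o⟫_ℝ - ⟪u, y - o⟫_ℝ) ^ 2 =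
      (X' - X) ^ 2 + (Y' - Y) ^ 2 := by rw [hX, hX', hY, hY']; ring
  rw [hgoal]
  have hXX : X ≤ X' := by rw [hX, hX']; linarith
  have hY2 : -(D * Real.sin θ₂) ≤ Y := by rw [hY]; linarith
  have hY3 : Y ≤ D * Real.sin θ₃ := by rw [hY]; linarith
  have t₂ := Real.sin_sq_add_cos_sq θ₂
  have t₃ := Real.sin_sq_add_cos_sq θ₃
  -- the point of the left arc at the height of `x`
  have hYD := abs_le_of_sq_le_sq' (by linear_combination d₁' + sq_nonneg X : Y ^ 2 ≤ D ^ 2) hD.le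
  obtain ⟨ω, hω⟩ : ∃ ω, ω = Real.arcsin (Y / D) := ⟨_, rfl⟩
  have hsω : Y = D * Real.sin ω := by
    rw [hω, Real.sin_arcsin (by rw [le_div_iff₀ hD]; linarith)
      (by rw [div_le_iff₀ hD]; linarith)]
    field_simp
  have hω1 : -(π / 2) ≤ ω := hω ▸ Real.neg_pi_div_two_le_arcsin _
  have hω2 : ω ≤ π / 2 := hω ▸ Real.arcsin_le_pi_div_two _
  have hcω : 0 ≤ Real.cos ω := Real.cos_nonneg_of_mem_Icc ⟨hω1, hω2⟩
  have tω := Real.sin_sq_add_cos_sq ω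
  have hωθ₃ : ω ≤ θ₃ := by
    by_contra hlt
    push Not at hlt
    have := mul_lt_mul_of_pos_left
      (Real.sin_lt_sin_of_lt_of_le_pi_div_two (by linarith) hω2 hlt) hD
    linarith
  have hωθ₂ : -θ₂ ≤ ω := by
    by_contra hlt
    push Not at hlt
    have := mul_lt_mul_of_pos_left
      (Real.sin_lt_sin_of_lt_of_le_pi_div_two hω1 (by linarith) hlt) hD
    rw [Real.sin_neg] at this
    linarith
  have hXω : -(D * Real.cos ω) ≤ X := by
    refine (abs_le_of_sq_le_sq' ?_ (by positivity)).1
    rw [hsω] at d₁'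
    linear_combination d₁' - D ^ 2 * tω
  -- Sliding x to the left onto the arc around p₁ only increases its distance to y. The new point
  -- lies on the arc from p₂ to p₃, and its direction from p₁ is a nonnegative combination of the
  -- directions to p₂ and p₃ with coefficients sin(θ₃ − ω)/sin γ and sin(θ₂ + ω)/sin γ, whose sum is
  -- at least 1. Hence the disk conditions for y at p₂ and p₃ imply the one at this point.
  have hfin : (X' + D * Real.cos ω) ^ 2 + (Y' - D * Real.sin ω) ^ 2 ≤ D ^ 2 := by
    obtain ⟨N, hN⟩ : ∃ N, N = X' ^ 2 + Y' ^ 2 := ⟨_, rfl⟩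
    have hN0 : 0 ≤ N := by rw [hN]; positivity
    have g₂ : N + 2 * D * (X' * Real.cos θ₂ + Y' * Real.sin θ₂) ≤ 0 := by
      rw [hN]; linear_combination f₂ - D ^ 2 * t₂
    have g₃ : N + 2 * D * (X' * Real.cos θ₃ - Y' * Real.sin θ₃) ≤ 0 := by
      rw [hN]; linear_combination f₃ - D ^ 2 * t₃
    suffices hs : N + 2 * D * (X' * Real.cos ω - Y' * Real.sin ω) ≤ 0 by
      rw [hN] at hs; linear_combination hs + D ^ 2 * tω
    rcases hγ0.eq_or_lt with hγ | hγ
    · have e2 : θ₂ = 0 := by linarith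
      have e3 : θ₃ = 0 := by linarith
      have e1 : ω = 0 := by linarith
      rw [e1]
      rw [e2] at g₂
      rw [Real.sin_zero] at g₂ ⊢
      linarith
    · have hsγ' : 0 < Real.sin γ := Real.sin_pos_of_pos_of_lt_pi hγ (by linarith)
      have hm : 0 ≤ Real.sin (θ₃ - ω) :=
        Real.sin_nonneg_of_nonneg_of_le_pi (by linarith) (by linarith)
      have hl : 0 ≤ Real.sin (θ₂ + ω) :=
        Real.sin_nonneg_of_nonneg_of_le_pi (by linarith) (by linarith)
      have hγs : Real.sin γ = Real.sin (θ₃ - ω) * Real.cos (θ₂ + ω) +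
          Real.cos (θ₃ - ω) * Real.sin (θ₂ + ω) := by
        rw [← Real.sin_add]; congr 1; rw [hθ₂, hθ₃]; ring
      have hle : Real.sin γ ≤ Real.sin (θ₃ - ω) + Real.sin (θ₂ + ω) := by
        rw [hγs]
        have a1 := mul_le_of_le_one_right hm (Real.cos_le_one (θ₂ + ω))
        have a2 := mul_le_of_le_one_left hl (Real.cos_le_one (θ₃ - ω))
        linarith
      have hc : Real.sin (θ₃ - ω) * Real.cos θ₂ + Real.sin (θ₂ + ω) * Real.cos θ₃ =
          Real.sin γ * Real.cos ω := by
        rw [show γ = θ₂ + θ₃ by rw [hθ₂, hθ₃]; ring, Real.sin_sub, Real.sin_add, Real.sin_add]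
        ring
      have hs : Real.sin (θ₂ + ω) * Real.sin θ₃ - Real.sin (θ₃ - ω) * Real.sin θ₂ =
          Real.sin γ * Real.sin ω := by
        rw [show γ = θ₂ + θ₃ by rw [hθ₂, hθ₃]; ring, Real.sin_sub, Real.sin_add, Real.sin_add]
        ring
      have i₂ := mul_nonpos_of_nonneg_of_nonpos hm g₂
      have i₃ := mul_nonpos_of_nonneg_of_nonpos hl g₃
      have i₁ := mul_le_mul_of_nonneg_right hle hN0
      have : Real.sin γ * (N + 2 * D * (X' * Real.cos ω - Y' * Real.sin ω)) ≤ 0 := by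
        linear_combination i₁ + i₂ + i₃ - 2 * D * X' * hc + 2 * D * Y' * hs
      exact nonpos_of_mul_nonpos_right this hsγ'
  have hlast : (X' - X) ^ 2 ≤ (X' + D * Real.cos ω) ^ 2 :=
    pow_le_pow_left₀ (by linarith) (by linarith) 2
  rw [hsω]
  linarith

/-! ### Diameter, circumradius and breadth of sets squeezed by the triangle and its bounds -/

section Sandwich

variable {K : Set Plane}

lemma diameter_eq (h : IsTiltedTriangle R γ k o v u p₁ p₂ p₃) (h₁ : p₁ ∈ K) (h₂ : p₂ ∈ K)
    (hK : ∀ x ∈ K, ∀ y ∈ K, dist x y ≤ 2 * R * Real.cos (γ / 2)) :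
    diameter K = 2 * R * Real.cos (γ / 2) := by
  refine le_antisymm (diam_le_of_forall_dist_le h.leg_pos.le hK) ?_
  rw [← h.dist_legs.1]
  exact dist_le_diam_of_mem (isBounded_iff.2 ⟨_, hK⟩) h₁ h₂

lemma circumradius_eq (h : IsTiltedTriangle R γ k o v u p₁ p₂ p₃) (h₁ : p₁ ∈ K) (h₂ : p₂ ∈ K)
    (h₃ : p₃ ∈ K) (hK : K ⊆ closedBall o R) : circumradius K = R := by
  obtain ⟨w₁, w₂, hw, hz⟩ := h.weights
  obtain ⟨n₁, n₂, n₃⟩ := h.norm_sub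
  exact le_antisymm (circumradius_le h.radius_pos.le hK)
    (le_circumradius_of_triangle (isBounded_closedBall.subset hK) h₁ h₂ h₃ n₁ n₂ n₃ w₁ w₂ w₂ hw hz)

lemma breadth_le (h : IsTiltedTriangle R γ k o v u p₁ p₂ p₃) (hne : K.Nonempty)
    (hK : K ⊆ pentagonRegion p₁ p₂ p₃ u) : breadth K u ≤ 2 * R * Real.sin γ * Real.cos k := by
  rw [← h.inner_sub_base, inner_sub_right]
  have h1 := h.inner_sub_base
  have h2 := h.height_base_nonneg
  rw [inner_sub_right] at h1
  refine BlaschkeSantalo.breadth_le hne fun x hx => ?_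
  have := (hK hx).1
  rwa [Set.uIcc_of_le (by linarith)] at this

end Sandwich

end IsTiltedTriangle

/-! ### The width of bent pentagons -/

/-- Coordinates for an isosceles triangle inscribed in a circle, in which the heights of its
vertices are `y₂ ≤ y₁ ≤ y₃`. -/
lemma exists_tilt_of_coordinates {R γ x₁ y₁ x₂ y₂ x₃ y₃ : ℝ} (hR : 0 < R)
    (hγ : γ ∈ Set.Icc 0 (π / 3)) (hn₁ : x₁ ^ 2 + y₁ ^ 2 = R ^ 2) (hn₂ : x₂ ^ 2 + y₂ ^ 2 = R ^ 2)
    (h₁₂ : x₁ * x₂ + y₁ * y₂ = -(R ^ 2 * Real.cos γ))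
    (hx : 2 * Real.cos γ * x₁ + x₂ + x₃ = 0) (hy : 2 * Real.cos γ * y₁ + y₂ + y₃ = 0)
    (hx₁ : 0 ≤ x₁) (h21 : y₂ ≤ y₁) (h13 : y₁ ≤ y₃) :
    ∃ k ∈ Set.Icc (-(γ / 2)) (γ / 2), x₁ = R * Real.cos k ∧ y₁ = -(R * Real.sin k) ∧
      x₂ = -(R * Real.cos (γ - k)) ∧ y₂ = -(R * Real.sin (γ - k)) ∧
      x₃ = -(R * Real.cos (γ + k)) ∧ y₃ = R * Real.sin (γ + k) := by
  have hπ := Real.pi_pos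
  obtain ⟨hγ0, hγ3⟩ := hγ
  have hc : 0 < Real.cos γ := Real.cos_pos_of_mem_Ioo ⟨by linarith, by linarith⟩
  have hs : 0 ≤ Real.sin γ := Real.sin_nonneg_of_nonneg_of_le_pi hγ0 (by linarith)
  have hR2 : 0 < R ^ 2 := pow_pos hR 2
  -- With x₁ = 0 the base would be horizontal and the apex not between its end points in height.
  have hx₁' : 0 < x₁ := by
    rcases hx₁.eq_or_lt with h0 | h0
    · exfalso
      have hy₁ : y₁ ≠ 0 := by
        rintro rfl
        rw [← h0] at hn₁
        linarith
      have hy₂ : y₂ = -(Real.cos γ * y₁) := by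
        apply mul_left_cancel₀ hy₁
        rw [← h0] at hn₁ h₁₂
        linear_combination h₁₂ + Real.cos γ * hn₁
      have : (1 + Real.cos γ) * y₁ = 0 := by linarith
      rcases mul_eq_zero.1 this with h | h
      · linarith
      · exact hy₁ h
    · exact h0
  -- the orientation of the triangle
  have hcross : x₁ * y₂ - y₁ * x₂ = -(R ^ 2 * Real.sin γ) := by
    have hsq : (x₁ * y₂ - y₁ * x₂) ^ 2 = (R ^ 2 * Real.sin γ) ^ 2 := by
      have : (x₁ * y₂ - y₁ * x₂) ^ 2 + (x₁ * x₂ + y₁ * y₂) ^ 2 = R ^ 2 * R ^ 2 := by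
        rw [← hn₁]
        nth_rewrite 2 [hn₁]
        rw [← hn₂]; ring
      rw [h₁₂] at this
      linear_combination this - R ^ 4 * Real.sin_sq_add_cos_sq γ
    -- The other orientation would exchange the heights of p₂ and p₃; it is possible only for sin γ
    -- = 0, where the two orientations agree.
    rcases sq_eq_sq_iff_eq_or_eq_neg.1 hsq with h | h
    · have h1 : R ^ 2 * y₂ = -(R ^ 2 * Real.cos γ) * y₁ + R ^ 2 * Real.sin γ * x₁ := by
        rw [← h, ← h₁₂]; linear_combination -y₂ * hn₁
      have h2 : R ^ 2 * (Real.sin γ * x₁) ≤ R ^ 2 * 0 := by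
        have := mul_le_mul_of_nonneg_left (h21.trans h13) hR2.le
        linear_combination this / 2 + R ^ 2 / 2 * hy - h1
      have h3 : Real.sin γ * x₁ ≤ 0 := le_of_mul_le_mul_left h2 hR2
      have h4 : Real.sin γ = 0 := le_antisymm (nonpos_of_mul_nonpos_left h3 hx₁') hs
      rw [h, h4]; ring
    · exact h
  obtain ⟨k, hk⟩ : ∃ k, k = Real.arcsin (-y₁ / R) := ⟨_, rfl⟩
  have hy₁R := abs_le_of_sq_le_sq' (by nlinarith : y₁ ^ 2 ≤ R ^ 2) hR.le
  have hsk : R * Real.sin k = -y₁ := by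
    rw [hk, Real.sin_arcsin (by rw [le_div_iff₀ hR]; linarith) (by rw [div_le_iff₀ hR]; linarith)]
    field_simp
  have hk1 : -(π / 2) ≤ k := hk ▸ Real.neg_pi_div_two_le_arcsin _
  have hk2 : k ≤ π / 2 := hk ▸ Real.arcsin_le_pi_div_two _
  have hck : 0 ≤ Real.cos k := Real.cos_nonneg_of_mem_Icc ⟨hk1, hk2⟩
  have ex₁ : x₁ = R * Real.cos k := by
    rw [← pow_left_inj₀ hx₁ (by positivity) two_ne_zero]
    linear_combination hn₁ - R ^ 2 * Real.sin_sq_add_cos_sq k + (R * Real.sin k - y₁) * hsk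
  have ey₁ : y₁ = -(R * Real.sin k) := by linarith
  have ex₂ : x₂ = -(R * Real.cos (γ - k)) := by
    apply mul_left_cancel₀ hR2.ne'
    rw [Real.cos_sub]
    linear_combination x₁ * h₁₂ - y₁ * hcross - x₂ * hn₁ - R ^ 2 * Real.cos γ * ex₁ +
      R ^ 2 * Real.sin γ * ey₁
  have ey₂ : y₂ = -(R * Real.sin (γ - k)) := by
    apply mul_left_cancel₀ hR2.ne'
    rw [Real.sin_sub]
    linear_combination y₁ * h₁₂ + x₁ * hcross - y₂ * hn₁ - R ^ 2 * Real.cos γ * ey₁ -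
      R ^ 2 * Real.sin γ * ex₁
  have ex₃ : x₃ = -(R * Real.cos (γ + k)) := by
    rw [Real.cos_sub] at ex₂
    rw [Real.cos_add]
    linear_combination hx - ex₂ - 2 * Real.cos γ * ex₁
  have ey₃ : y₃ = R * Real.sin (γ + k) := by
    rw [Real.sin_sub] at ey₂
    rw [Real.sin_add]
    linear_combination hy - ey₂ - 2 * Real.cos γ * ey₁
  refine ⟨k, ⟨?_, ?_⟩, ex₁, ey₁, ex₂, ey₂, ex₃, ey₃⟩
  · by_contra hlt
    push Not at hlt
    have h1 : Real.sin (γ + k) < Real.sin (-k) :=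
      Real.sin_lt_sin_of_lt_of_le_pi_div_two (by linarith) (by linarith) (by linarith)
    rw [Real.sin_neg] at h1
    have := mul_lt_mul_of_pos_left h1 hR
    linarith
  · by_contra hlt
    push Not at hlt
    have h1 : Real.sin (γ - k) < Real.sin k :=
      Real.sin_lt_sin_of_lt_of_le_pi_div_two (by linarith) (by linarith) (by linarith)
    have := mul_lt_mul_of_pos_left h1 hR
    linarith

/-- The triangle of a pentagon frame is a tilted triangle, if its apex lies between the two
parallel lines. -/
lemma IsPentagonFrame.exists_isTiltedTriangle {R r γ : ℝ} {o p₁ p₂ p₃ c u : Plane}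
    (h : IsPentagonFrame R r γ o p₁ p₂ p₃ c u)
    (hp : ⟪u, p₁⟫_ℝ ∈ Set.uIcc ⟪u, p₂⟫_ℝ ⟪u, p₃⟫_ℝ) :
    ∃ (v u' : Plane) (k : ℝ), (u' = u ∨ u' = -u) ∧ IsTiltedTriangle R γ k o v u' p₁ p₂ p₃ := by
  obtain ⟨u', hu', hn, h21, h13⟩ : ∃ u', (u' = u ∨ u' = -u) ∧ ‖u'‖ = 1 ∧
      ⟪u', p₂⟫_ℝ ≤ ⟪u', p₁⟫_ℝ ∧ ⟪u', p₁⟫_ℝ ≤ ⟪u', p₃⟫_ℝ := by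
    rcases le_total ⟪u, p₂⟫_ℝ ⟪u, p₃⟫_ℝ with hle | hle
    · rw [Set.uIcc_of_le hle] at hp
      exact ⟨u, Or.inl rfl, h.norm_u, hp.1, hp.2⟩
    · rw [Set.uIcc_of_ge hle] at hp
      refine ⟨-u, Or.inr rfl, by rw [norm_neg, h.norm_u], ?_, ?_⟩ <;>
        rw [inner_neg_left, inner_neg_left, neg_le_neg_iff]
      exacts [hp.2, hp.1]
  obtain ⟨v₀, hv₀⟩ := exists_isFrame hn
  obtain ⟨v, hv, hx₁⟩ : ∃ v, IsFrame v u' ∧ 0 ≤ ⟪v, p₁ - o⟫_ℝ := by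
    rcases le_total 0 ⟪v₀, p₁ - o⟫_ℝ with h | h
    · exact ⟨v₀, hv₀, h⟩
    · exact ⟨-v₀, hv₀.neg_left, by rw [inner_neg_left]; linarith⟩
  have n₁ : ‖p₁ - o‖ = R := by rw [← dist_eq_norm, h.dist_p₁]
  have n₂ : ‖p₂ - o‖ = R := by rw [← dist_eq_norm, h.dist_p₂]
  have n₃ : ‖p₃ - o‖ = R := by rw [← dist_eq_norm, h.dist_p₃]
  have hD : (2 * R * Real.cos (γ / 2)) ^ 2 = 2 * R ^ 2 + 2 * R ^ 2 * Real.cos γ := by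
    rw [mul_pow, Real.cos_sq, show 2 * (γ / 2) = γ by ring]; ring
  have i₁₂ : ⟪p₁ - o, p₂ - o⟫_ℝ = -(R ^ 2 * Real.cos γ) := by
    have := norm_sub_sq_real (p₁ - o) (p₂ - o)
    rw [sub_sub_sub_cancel_right, ← dist_eq_norm, h.leg₂, hD, n₁, n₂] at this
    linarith
  have i₁₃ : ⟪p₁ - o, p₃ - o⟫_ℝ = -(R ^ 2 * Real.cos γ) := by
    have := norm_sub_sq_real (p₁ - o) (p₃ - o)
    rw [sub_sub_sub_cancel_right, ← dist_eq_norm, h.leg₃, hD, n₁, n₃] at this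
    linarith
  -- The lengths of the legs alone would allow p₂ = p₃; the apex angle decides.
  have i₂₃ : ⟪p₂ - o, p₃ - o⟫_ℝ = R ^ 2 * (2 * Real.cos γ ^ 2 - 1) := by
    have h1 := InnerProductGeometry.cos_angle_mul_norm_mul_norm (p₂ - p₁) (p₃ - p₁)
    have h2 : InnerProductGeometry.angle (p₂ - p₁) (p₃ - p₁) = γ := h.angle_eq
    rw [h2, ← dist_eq_norm, ← dist_eq_norm, dist_comm p₂, dist_comm p₃, h.leg₂, h.leg₃,
      ← pow_two, hD, ← sub_sub_sub_cancel_right p₂ p₁ o, ← sub_sub_sub_cancel_right p₃ p₁ o,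
      inner_sub_left, inner_sub_right (p₂ - o) (p₃ - o) (p₁ - o),
      inner_sub_right (p₁ - o) (p₃ - o) (p₁ - o), real_inner_self_eq_norm_sq, n₁,
      real_inner_comm (p₁ - o) (p₂ - o), i₁₂, i₁₃] at h1
    linarith
  have hz : (2 * Real.cos γ) • (p₁ - o) + (p₂ - o) + (p₃ - o) = 0 := by
    rw [← inner_self_eq_zero (𝕜 := ℝ)]
    simp only [inner_add_left, inner_add_right, real_inner_smul_left, real_inner_smul_right,
      real_inner_self_eq_norm_sq, norm_smul, mul_pow, Real.norm_eq_abs, sq_abs, n₁, n₂, n₃,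
      real_inner_comm (p₁ - o) (p₂ - o), real_inner_comm (p₁ - o) (p₃ - o),
      real_inner_comm (p₂ - o) (p₃ - o), i₁₂, i₁₃, i₂₃]
    ring
  have hcirc : ∀ q : Plane, ‖q - o‖ = R → ⟪v, q - o⟫_ℝ ^ 2 + ⟪u', q - o⟫_ℝ ^ 2 = R ^ 2 :=
    fun q hq => by rw [← hv.norm_sq, hq]
  have hsum : ∀ w : Plane, 2 * Real.cos γ * ⟪w, p₁ - o⟫_ℝ + ⟪w, p₂ - o⟫_ℝ + ⟪w, p₃ - o⟫_ℝ = 0 := by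
    intro w
    rw [← inner_zero_right (𝕜 := ℝ) w, ← hz, inner_add_right, inner_add_right, inner_smul_right]
  rw [hv.inner_eq] at i₁₂
  obtain ⟨k, hk, e⟩ := exists_tilt_of_coordinates h.radius_pos h.angle_mem (hcirc _ n₁)
    (hcirc _ n₂) i₁₂ (hsum v) (hsum u') hx₁ (by rw [inner_sub_right, inner_sub_right]; linarith)
    (by rw [inner_sub_right, inner_sub_right]; linarith)
  exact ⟨v, u', k, hu', hv, h.radius_pos, h.angle_mem, hk, e.1, e.2.1, e.2.2.1, e.2.2.2.1,
    e.2.2.2.2.1, e.2.2.2.2.2⟩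

/-! ### The ball of the construction in coordinates -/

namespace IsTiltedTriangle

variable {R γ k : ℝ} {o v u p₁ p₂ p₃ : Plane}

/-- The coordinates relative to `p₂` of a point with equal distances `ρ` to `p₁` and `p₂` which
lies on the same side of `p₁p₂` as `p₃`. -/
lemma center_coords (h : IsTiltedTriangle R γ k o v u p₁ p₂ p₃) (hγ : 0 < γ) {c : Plane} {ρ a : ℝ}
    (hρ : 0 < ρ) (ha : a ∈ Set.Icc 0 π) (hac : ρ * Real.cos a = R * Real.cos (γ / 2))
    (h₁ : dist c p₁ = ρ) (h₂ : dist c p₂ = ρ) (hside : (line[ℝ, p₁, p₂]).WSameSide c p₃) :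
    ⟪v, c - p₂⟫_ℝ = ρ * Real.cos (a + (γ / 2 - k)) ∧
      ⟪u, c - p₂⟫_ℝ = ρ * Real.sin (a + (γ / 2 - k)) := by
  have hπ := Real.pi_pos
  obtain ⟨l₁, l₂, l₃, l₄⟩ := h.leg_coords
  have hD := h.leg_pos
  obtain ⟨θ, hθ⟩ : ∃ θ, θ = γ / 2 - k := ⟨_, rfl⟩
  rw [← hθ] at l₁ l₂ ⊢
  set D := 2 * R * Real.cos (γ / 2) with hDd
  have t := Real.sin_sq_add_cos_sq θ
  have ta := Real.sin_sq_add_cos_sq a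
  have hsγ : 0 < Real.sin γ :=
    Real.sin_pos_of_pos_of_lt_pi hγ (by linarith [h.angle_mem.2])
  have hsa : 0 ≤ Real.sin a := Real.sin_nonneg_of_nonneg_of_le_pi ha.1 ha.2
  -- the normal direction of the line through `p₁` and `p₂`
  set N : Plane := (-Real.sin θ) • v + Real.cos θ • u with hN
  have hNi : ∀ x : Plane, ⟪N, x⟫_ℝ = -Real.sin θ * ⟪v, x⟫_ℝ + Real.cos θ * ⟪u, x⟫_ℝ := by
    intro x
    rw [hN, inner_add_left, real_inner_smul_left, real_inner_smul_left]
  have hN12 : ⟪N, p₁⟫_ℝ = ⟪N, p₂⟫_ℝ := by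
    have : ⟪N, p₂ - o⟫_ℝ - ⟪N, p₁ - o⟫_ℝ = 0 := by rw [hNi, hNi, l₁, l₂]; ring
    rw [inner_sub_right, inner_sub_right] at this
    linarith
  have hNline : ∀ q ∈ line[ℝ, p₁, p₂], ⟪N, q⟫_ℝ = ⟪N, p₂⟫_ℝ := by
    intro q hq
    obtain ⟨t, rfl⟩ := mem_affineSpan_pair_iff_exists_lineMap_eq.1 hq
    rw [AffineMap.lineMap_apply_module, inner_add_right, inner_smul_right, inner_smul_right, hN12]
    ring
  have hN3 : ⟪N, p₃⟫_ℝ - ⟪N, p₂⟫_ℝ = D * Real.sin γ := by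
    have : ⟪N, p₃ - o⟫_ℝ - ⟪N, p₁ - o⟫_ℝ = D * Real.sin γ := by
      have hγθ : Real.sin γ = Real.sin (θ + (γ / 2 + k)) := by rw [hθ]; congr 1; ring
      rw [hNi, hNi, l₃, l₄, hγθ, Real.sin_add θ]
      ring
    rw [inner_sub_right, inner_sub_right] at this
    linarith
  have hNc : 0 ≤ ⟪N, c - p₂⟫_ℝ := by
    obtain ⟨q₁, hq₁, q₂, hq₂, hray⟩ := hside
    have e1 := hNline _ hq₁
    have e2 := hNline _ hq₂
    have e3 : 0 < ⟪N, p₃ - q₂⟫_ℝ := by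
      rw [inner_sub_right, e2, hN3]; positivity
    have e4 : ⟪N, c - p₂⟫_ℝ = ⟪N, c - q₁⟫_ℝ := by
      rw [inner_sub_right, inner_sub_right, e1]
    rw [e4]
    rcases hray with h0 | h0 | ⟨r₁, r₂, hr₁, hr₂, hr⟩
    · rw [vsub_eq_sub] at h0
      rw [h0, inner_zero_right]
    · rw [vsub_eq_sub] at h0
      rw [h0, inner_zero_right] at e3
      exact absurd e3 (lt_irrefl _)
    · rw [vsub_eq_sub, vsub_eq_sub] at hr
      have := congrArg (fun x => ⟪N, x⟫_ℝ) hr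
      simp only [inner_smul_right] at this
      have e5 : 0 ≤ r₁ * ⟪N, c - q₁⟫_ℝ := by rw [this]; positivity
      exact nonneg_of_mul_nonneg_right e5 hr₁
  have d₁ := h.frame.dist_sq c p₁ p₂
  have d₂ := h.frame.dist_sq c p₂ p₂
  rw [h₁] at d₁
  rw [h₂, sub_self, inner_zero_right, inner_zero_right, sub_zero, sub_zero] at d₂
  have hp12 : ⟪v, p₁ - p₂⟫_ℝ = D * Real.cos θ ∧ ⟪u, p₁ - p₂⟫_ℝ = D * Real.sin θ := by
    rw [← sub_sub_sub_cancel_right p₁ p₂ o, inner_sub_right v (p₁ - o) (p₂ - o),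
      inner_sub_right u (p₁ - o) (p₂ - o), l₁, l₂]
    constructor <;> ring
  rw [hp12.1, hp12.2] at d₁
  rw [hNi] at hNc
  set X := ⟪v, c - p₂⟫_ℝ
  set Y := ⟪u, c - p₂⟫_ℝ
  -- Along and normal to p₂p₁ the center has coordinates ρ cos a (equal distances to p₁ and p₂) and
  -- ρ sin a (Pythagoras, with the sign from `hNc`).
  have e1 : X * Real.cos θ + Y * Real.sin θ = ρ * Real.cos a := by
    apply mul_left_cancel₀ hD.ne'
    rw [hac]
    linear_combination d₁ / 2 - d₂ / 2 + D ^ 2 / 2 * t - D / 2 * hDd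
  have e2 : -Real.sin θ * X + Real.cos θ * Y = ρ * Real.sin a := by
    rw [← pow_left_inj₀ hNc (by positivity) two_ne_zero]
    linear_combination (X ^ 2 + Y ^ 2) * t - d₂ - ρ ^ 2 * ta -
      (X * Real.cos θ + Y * Real.sin θ + ρ * Real.cos a) * e1
  constructor
  · rw [Real.cos_add]; linear_combination Real.cos θ * e1 - Real.sin θ * e2 - X * t
  · rw [Real.sin_add]; linear_combination Real.sin θ * e1 + Real.cos θ * e2 - Y * t

end IsTiltedTriangle

/-- The tangent with the smaller angle to `[p₁, p₂]`. -/
lemma IsPentagonFrame.smaller_angle_le {R r γ k a : ℝ} {o p₁ p₂ p₃ c u v u' : Plane}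
    (h : IsPentagonFrame R r γ o p₁ p₂ p₃ c u) (hu' : u' = u ∨ u' = -u)
    (ht : IsTiltedTriangle R γ k o v u' p₁ p₂ p₃) {ρ : ℝ} (ha : a ∈ Set.Icc 0 (π / 3))
    (hX : ⟪v, c - p₂⟫_ℝ = ρ * Real.cos (a + (γ / 2 - k)))
    (hY : ⟪u', c - p₂⟫_ℝ = ρ * Real.sin (a + (γ / 2 - k))) : a + (γ / 2 - k) ≤ π / 2 := by
  have hπ := Real.pi_pos
  have habs : ∀ x : Plane, |⟪u', x⟫_ℝ| = |⟪u, x⟫_ℝ| := by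
    intro x
    rcases hu' with rfl | rfl
    · rfl
    · rw [inner_neg_left, abs_neg]
  obtain ⟨l₁, l₂, -, -⟩ := ht.leg_coords
  obtain ⟨θ, hθ⟩ : ∃ θ, θ = γ / 2 - k := ⟨_, rfl⟩
  rw [← hθ] at l₁ l₂ hX hY ⊢
  have hD := ht.leg_pos
  set D := 2 * R * Real.cos (γ / 2)
  have hp12 : ⟪v, p₁ - p₂⟫_ℝ = D * Real.cos θ ∧ ⟪u', p₁ - p₂⟫_ℝ = D * Real.sin θ := by
    rw [← sub_sub_sub_cancel_right p₁ p₂ o, inner_sub_right v (p₁ - o) (p₂ - o),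
      inner_sub_right u' (p₁ - o) (p₂ - o), l₁, l₂]
    constructor <;> ring
  obtain ⟨φ, hφ⟩ : ∃ φ, φ = a + θ := ⟨_, rfl⟩
  rw [← hφ] at hX hY ⊢
  by_contra hlt
  push Not at hlt
  -- w is u' reflected in the line p₂c, a normal of the other tangent from p₂. For φ > π/2 that
  -- tangent would make the strictly smaller angle with [p₁, p₂].
  set w : Plane := Real.sin (2 * φ) • v + (-Real.cos (2 * φ)) • u' with hw
  have hwi : ∀ x : Plane, ⟪w, x⟫_ℝ = Real.sin (2 * φ) * ⟪v, x⟫_ℝ - Real.cos (2 * φ) * ⟪u', x⟫_ℝ := by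
    intro x
    rw [hw, inner_add_left, real_inner_smul_left, real_inner_smul_left]
    ring
  have hwn : ‖w‖ = 1 := by
    rw [← pow_left_inj₀ (norm_nonneg _) zero_le_one two_ne_zero, ht.frame.norm_sq, hw,
      ht.frame.inner_left_comb, ht.frame.inner_right_comb]
    linear_combination Real.sin_sq_add_cos_sq (2 * φ)
  have hwc : |⟪w, c - p₂⟫_ℝ| = r := by
    rw [← h.support, ← habs, hwi, hX, hY]
    congr 1
    have : Real.sin (2 * φ) * Real.cos φ - Real.cos (2 * φ) * Real.sin φ = Real.sin φ := by
      rw [← Real.sin_sub]; congr 1; ring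
    linear_combination ρ * this
  have hwp := h.smaller_angle w hwn hwc
  rw [← habs, hwi, hp12.1, hp12.2] at hwp
  have h1 : Real.sin (2 * φ) * (D * Real.cos θ) - Real.cos (2 * φ) * (D * Real.sin θ) =
      D * Real.sin (2 * φ - θ) := by rw [Real.sin_sub]; ring
  rw [h1, abs_mul D, abs_mul D] at hwp
  have h2 : |Real.sin θ| ≤ |Real.sin (2 * φ - θ)| :=
    le_of_mul_le_mul_left hwp (abs_pos.2 hD.ne')
  have h3 : Real.sin θ ^ 2 ≤ Real.sin (2 * φ - θ) ^ 2 := sq_le_sq.2 h2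
  have h4 : Real.sin (2 * φ - θ) ^ 2 - Real.sin θ ^ 2 = Real.sin (2 * φ) * Real.sin (2 * a) := by
    rw [show 2 * φ - θ = φ + a by rw [hφ]; ring, show θ = φ - a by rw [hφ]; ring, Real.sin_add,
      Real.sin_sub, Real.sin_two_mul, Real.sin_two_mul]
    ring
  have hθγ : θ ≤ γ := by rw [hθ]; linarith [ht.tilt_mem.1]
  have h5 : Real.sin (2 * φ) < 0 := by
    rw [← neg_pos, ← Real.sin_sub_pi]
    exact Real.sin_pos_of_pos_of_lt_pi (by linarith) (by linarith [ha.2, ht.angle_mem.2])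
  have ha0 : 0 < a := by linarith [ht.angle_mem.2]
  have h6 : 0 < Real.sin (2 * a) :=
    Real.sin_pos_of_pos_of_lt_pi (by linarith) (by linarith [ha.2])
  have := mul_neg_of_neg_of_pos h5 h6
  linarith

/-- The width of a bent pentagon. -/
lemma IsBentPentagon.width_eq {P : Set Plane} (hP : IsBentPentagon P) :
    width P = lowerBound₃ (inradius P) (diameter P) (circumradius P) := by
  obtain ⟨R, r, γ, o, p₁, p₂, p₃, c, u, h, rfl, hT, hB, hr, hw⟩ := hP
  have hπ := Real.pi_pos
  obtain ⟨v, u', k, hu', ht⟩ := h.exists_isTiltedTriangle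
    (hT (subset_convexHull ℝ _ (by simp))).1
  have hreg : pentagonRegion p₁ p₂ p₃ u = pentagonRegion p₁ p₂ p₃ u' := by
    rcases hu' with rfl | rfl
    · rfl
    · rw [pentagonRegion_neg]
  have habs : ∀ x : Plane, |⟪u', x⟫_ℝ| = |⟪u, x⟫_ℝ| := by
    intro x
    rcases hu' with rfl | rfl
    · rfl
    · rw [inner_neg_left, abs_neg]
  rw [← habs, ht.inner_sub_base, abs_of_nonneg ht.height_base_nonneg] at hw
  rw [hreg] at hB hr hw ⊢
  obtain ⟨m₁, m₂, m₃⟩ := ht.vertices_mem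
  have hD := ht.diameter_eq m₁ m₂ fun x hx y hy => ht.dist_le_of_mem_region hx hy
  have hR := ht.circumradius_eq m₁ m₂ m₃ ht.region_subset_closedBall
  have hρR := circumradius_le_diameter_sub (isCompact_pentagonRegion p₁ p₂ p₃ u') ⟨_, m₁⟩
  rw [hw, hr, hR]
  rw [hr, hR] at hρR
  obtain ⟨ha, -, -, hac, -⟩ := vertex_angles h.radius_pos h.angle_mem hD h.r_mem.1 h.r_mem.2 hρR
  rw [lowerBound₃_eq h.radius_pos h.angle_mem hD]
  rcases h.angle_mem.1.eq_or_lt with h0 | h0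
  · rw [← h0]; simp
  have hρ := h.radius_pos.trans_le hρR
  set D := diameter (pentagonRegion p₁ p₂ p₃ u') with hDd
  set a := Real.arccos (D / (2 * (D - r))) with had
  obtain ⟨hX, hY⟩ := ht.center_coords h0 hρ ⟨ha.1, by linarith [ha.2]⟩ hac
    (by rw [h.tangent₁, ht.dist_legs.1, hD]) (by rw [h.tangent₂, ht.dist_legs.1, hD])
    h.same_side
  have hφ := h.smaller_angle_le hu' ht ha hX hY
  -- The frame fixes this product only up to sign; the ball lying in the region fixes the sign.
  have hsup : ⟪u', c - p₂⟫_ℝ = r := by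
    have h1 := (ht.mem_region_iff.1
      (add_mem_of_closedBall_subset h.r_mem.1 hB ht.frame.norm_right).2).1.1
    rw [← ht.y₂, show c - r • u' - o = (c - o) - r • u' by abel, inner_sub_right _ (c - o),
      inner_smul_right, ht.frame.inner_self_right] at h1
    have h2 : ⟪u', c - p₂⟫_ℝ = ⟪u', c - o⟫_ℝ - ⟪u', p₂ - o⟫_ℝ := by
      rw [← inner_sub_right, sub_sub_sub_cancel_right]
    rw [← h.support, ← habs, abs_of_nonneg (by linarith [h.r_mem.1])]
  -- `hφ`, which comes from the choice of the smaller angle, selects the branch of the arcsine.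
  have hs : Real.arcsin (r / (D - r)) = a + (γ / 2 - k) := by
    have h1 : r / (D - r) = Real.sin (a + (γ / 2 - k)) := by
      rw [div_eq_iff hρ.ne']; linarith
    rw [h1, Real.arcsin_sin _ hφ]
    linarith [ha.1, ht.tilt_mem.2]
  rw [hs]
  congr 2
  ring

/-! ### Existence of bent pentagons -/

lemma exists_isTiltedTriangle {R γ k : ℝ} (hR : 0 < R) (hγ : γ ∈ Set.Icc 0 (π / 3))
    (hk : k ∈ Set.Icc (-(γ / 2)) (γ / 2)) :
    ∃ v u p₁ p₂ p₃ : Plane, IsTiltedTriangle R γ k 0 v u p₁ p₂ p₃ := by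
  obtain ⟨u, hu⟩ := (NormedSpace.sphere_nonempty (E := Plane) (x := 0) (r := 1)).2 zero_le_one
  obtain ⟨v, hv⟩ := exists_isFrame (by simpa using hu : ‖u‖ = 1)
  refine ⟨v, u, (R * Real.cos k) • v + (-(R * Real.sin k)) • u,
    (-(R * Real.cos (γ - k))) • v + (-(R * Real.sin (γ - k))) • u,
    (-(R * Real.cos (γ + k))) • v + (R * Real.sin (γ + k)) • u, hv, hR, hγ, hk, ?_, ?_, ?_, ?_, ?_,
    ?_⟩ <;> simp only [sub_zero, hv.inner_left_comb, hv.inner_right_comb]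

/-! ### Balls in the region and the frame of a bent pentagon -/

namespace IsTiltedTriangle

variable {R γ k r ρ a : ℝ} {o v u p₁ p₂ p₃ c : Plane}

lemma closedBall_subset_region (h : IsTiltedTriangle R γ k o v u p₁ p₂ p₃)
    (d₁ : dist c p₁ + r ≤ 2 * R * Real.cos (γ / 2)) (d₂ : dist c p₂ + r ≤ 2 * R * Real.cos (γ / 2))
    (d₃ : dist c p₃ + r ≤ 2 * R * Real.cos (γ / 2)) (hb : ⟪u, p₂ - o⟫_ℝ + r ≤ ⟪u, c - o⟫_ℝ)
    (ht : ⟪u, c - o⟫_ℝ + r ≤ ⟪u, p₃ - o⟫_ℝ) : closedBall c r ⊆ pentagonRegion p₁ p₂ p₃ u := by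
  intro x hx
  rw [mem_closedBall] at hx
  have h1 : |⟪u, x - c⟫_ℝ| ≤ r := by
    refine (abs_real_inner_le_norm u (x - c)).trans ?_
    rwa [h.frame.norm_right, one_mul, ← dist_eq_norm]
  have h2 : ⟪u, x - o⟫_ℝ = ⟪u, x - c⟫_ℝ + ⟪u, c - o⟫_ℝ := by
    rw [← inner_add_right, sub_add_sub_cancel]
  rw [abs_le] at h1
  rw [h.mem_region_iff, ← h.y₂, ← h.y₃, Set.mem_Icc]
  exact ⟨⟨by linarith, by linarith⟩, (dist_triangle x c p₁).trans (by linarith),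
    (dist_triangle x c p₂).trans (by linarith), (dist_triangle x c p₃).trans (by linarith)⟩

lemma leg_coords' (h : IsTiltedTriangle R γ k o v u p₁ p₂ p₃) :
    ⟪v, p₁ - p₂⟫_ℝ = 2 * R * Real.cos (γ / 2) * Real.cos (γ / 2 - k) ∧
    ⟪u, p₁ - p₂⟫_ℝ = 2 * R * Real.cos (γ / 2) * Real.sin (γ / 2 - k) ∧
    ⟪v, p₃ - p₁⟫_ℝ = -(2 * R * Real.cos (γ / 2) * Real.cos (γ - (γ / 2 - k))) ∧
    ⟪u, p₃ - p₁⟫_ℝ = 2 * R * Real.cos (γ / 2) * Real.sin (γ - (γ / 2 - k)) := by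
  obtain ⟨l₁, l₂, l₃, l₄⟩ := h.leg_coords
  rw [show γ - (γ / 2 - k) = γ / 2 + k by ring, ← sub_sub_sub_cancel_right p₁ p₂ o,
    ← sub_sub_sub_cancel_right p₃ p₁ o, inner_sub_right v (p₁ - o) (p₂ - o),
    inner_sub_right u (p₁ - o) (p₂ - o), inner_sub_right v (p₃ - o) (p₁ - o),
    inner_sub_right u (p₃ - o) (p₁ - o), l₁, l₂, l₃, l₄]
  refine ⟨?_, ?_, ?_, ?_⟩ <;> ring

/-- The center of a ball touching the arcs around `p₁` and `p₂`, and its distances to the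
vertices. -/
lemma exists_center (h : IsTiltedTriangle R γ k o v u p₁ p₂ p₃) (hρ : 0 ≤ ρ)
    (ha : a ∈ Set.Icc (γ / 2) (π / 3)) (hac : ρ * Real.cos a = R * Real.cos (γ / 2)) :
    ∃ c, ⟪v, c - p₂⟫_ℝ = ρ * Real.cos (a + (γ / 2 - k)) ∧
      ⟪u, c - p₂⟫_ℝ = ρ * Real.sin (a + (γ / 2 - k)) ∧
      dist c p₁ = ρ ∧ dist c p₂ = ρ ∧ dist c p₃ ≤ ρ := by
  have hπ := Real.pi_pos
  obtain ⟨l₁, l₂, l₃, l₄⟩ := h.leg_coords'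
  have hR := h.radius_pos
  have hκ := h.cos_half_pos
  have hσ : 0 ≤ Real.sin (γ / 2) := Real.sin_nonneg_of_nonneg_of_le_pi
    (by linarith [h.angle_mem.1]) (by linarith [h.angle_mem.2])
  -- As a ≥ γ/2, on the perpendicular bisector of p₁p₂ the center lies at least as far towards the
  -- side of p₃ as o does, so it is no farther from p₃ than from p₁ and p₂.
  have hle : R * Real.sin (γ / 2) ≤ ρ * Real.sin a := by
    have h1 : 0 ≤ Real.sin (a - γ / 2) := Real.sin_nonneg_of_nonneg_of_le_pi
      (by linarith [ha.1]) (by linarith [ha.2, h.angle_mem.1])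
    rw [Real.sin_sub] at h1
    have h2 := mul_nonneg hρ h1
    refine le_of_mul_le_mul_left ?_ hκ
    linear_combination h2 - Real.sin (γ / 2) * hac
  have hc : Real.cos γ = 1 - 2 * Real.sin (γ / 2) ^ 2 := by
    have h1 := Real.cos_two_mul (γ / 2)
    rw [mul_div_cancel₀ _ two_ne_zero] at h1
    linear_combination h1 + 2 * Real.sin_sq_add_cos_sq (γ / 2)
  have hs := sin_eq_two_mul_half γ
  obtain ⟨θ, hθ⟩ : ∃ θ, θ = γ / 2 - k := ⟨_, rfl⟩
  rw [← hθ] at l₁ l₂ l₃ l₄ ⊢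
  have t := Real.sin_sq_add_cos_sq θ
  have tφ := Real.sin_sq_add_cos_sq (a + θ)
  have tγ := Real.sin_sq_add_cos_sq γ
  have hx₃ : ⟪v, p₃ - p₂⟫_ℝ = ⟪v, p₃ - p₁⟫_ℝ + ⟪v, p₁ - p₂⟫_ℝ := by
    rw [← inner_add_right, sub_add_sub_cancel]
  have hy₃ : ⟪u, p₃ - p₂⟫_ℝ = ⟪u, p₃ - p₁⟫_ℝ + ⟪u, p₁ - p₂⟫_ℝ := by
    rw [← inner_add_right, sub_add_sub_cancel]
  obtain ⟨c, hX, hY⟩ : ∃ c, ⟪v, c - p₂⟫_ℝ = ρ * Real.cos (a + θ) ∧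
      ⟪u, c - p₂⟫_ℝ = ρ * Real.sin (a + θ) := by
    refine ⟨(ρ * Real.cos (a + θ)) • v + (ρ * Real.sin (a + θ)) • u + p₂, ?_, ?_⟩
    · rw [add_sub_cancel_right, h.frame.inner_left_comb]
    · rw [add_sub_cancel_right, h.frame.inner_right_comb]
  have e : Real.cos (a + θ) * Real.cos θ + Real.sin (a + θ) * Real.sin θ = Real.cos a := by
    rw [← Real.cos_sub, add_sub_cancel_right]
  have e' : Real.sin (a + θ) * Real.cos θ - Real.cos (a + θ) * Real.sin θ = Real.sin a := by
    rw [← Real.sin_sub, add_sub_cancel_right]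
  refine ⟨c, hX, hY, ?_, ?_, abs_le_of_sq_le_sq' ?_ hρ |>.2⟩
  · rw [← pow_left_inj₀ dist_nonneg hρ two_ne_zero, h.frame.dist_sq _ _ p₂, hX, hY, l₁, l₂]
    obtain ⟨D, hD⟩ : ∃ D, D = 2 * R * Real.cos (γ / 2) := ⟨_, rfl⟩
    rw [← hD]
    linear_combination ρ ^ 2 * tφ + D ^ 2 * t - 2 * ρ * D * e - 2 * D * hac + D * hD
  · rw [← pow_left_inj₀ dist_nonneg hρ two_ne_zero, h.frame.dist_sq _ _ p₂, hX, hY, sub_self,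
      inner_zero_right, inner_zero_right]
    linear_combination ρ ^ 2 * tφ
  · rw [h.frame.dist_sq _ _ p₂, hX, hY, hx₃, hy₃, l₁, l₂, l₃, l₄, Real.cos_sub γ, Real.sin_sub γ]
    have hm : 4 * R * Real.cos (γ / 2) ^ 2 * Real.sin (γ / 2) * (R * Real.sin (γ / 2)) ≤
        4 * R * Real.cos (γ / 2) ^ 2 * Real.sin (γ / 2) * (ρ * Real.sin a) :=
      mul_le_mul_of_nonneg_left hle (by positivity)
    obtain ⟨D, hD⟩ : ∃ D, D = 2 * R * Real.cos (γ / 2) := ⟨_, rfl⟩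
    have hB : (ρ * Real.cos (a + θ) - (-(D * (Real.cos γ * Real.cos θ + Real.sin γ * Real.sin θ)) +
        D * Real.cos θ)) ^ 2 + (ρ * Real.sin (a + θ) - (D * (Real.sin γ * Real.cos θ -
        Real.cos γ * Real.sin θ) + D * Real.sin θ)) ^ 2 =
        ρ ^ 2 + 2 * D ^ 2 * (1 - Real.cos γ) - 2 * D * (1 - Real.cos γ) * (ρ * Real.cos a) -
          2 * D * Real.sin γ * (ρ * Real.sin a) := by
      linear_combination ρ ^ 2 * tφ - 2 * ρ * D * (1 - Real.cos γ) * e -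
        2 * ρ * D * Real.sin γ * e' + D ^ 2 * ((1 - Real.cos γ) ^ 2 + Real.sin γ ^ 2) * t +
        D ^ 2 * tγ
    rw [← hD, hB, hac, hs, hc, hD]
    linear_combination 2 * hm

/-- A ball in the region is no bigger than the ball touching both arcs and the lower line. -/
lemma inradius_region_le (h : IsTiltedTriangle R γ k o v u p₁ p₂ p₃)
    (ha : a ∈ Set.Icc 0 (π / 3)) (hφ : a + (γ / 2 - k) ≤ π / 2)
    (hρ : ρ = 2 * R * Real.cos (γ / 2) - r) (hρ0 : 0 ≤ ρ)
    (hac : ρ * Real.cos a = R * Real.cos (γ / 2)) (hs : ρ * Real.sin (a + (γ / 2 - k)) = r) :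
    inradius (pentagonRegion p₁ p₂ p₃ u) ≤ r := by
  have hπ := Real.pi_pos
  refine inradius_le ⟨_, h.vertices_mem.1⟩ fun t c ht hc => ?_
  by_contra hlt
  push Not at hlt
  obtain ⟨l₁, l₂, -, -⟩ := h.leg_coords'
  have hD := h.leg_pos
  have hsub : ∀ p, pentagonRegion p₁ p₂ p₃ u ⊆ closedBall p (2 * R * Real.cos (γ / 2)) →
      dist c p ^ 2 ≤ ρ ^ 2 := fun p hp =>
    pow_le_pow_left₀ dist_nonneg (by
      have := dist_add_le_of_closedBall_subset ht (hc.trans hp)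
      linarith) 2
  have d₁ := hsub p₁ fun x hx => (h.mem_region_iff.1 hx).2.1
  have d₂ := hsub p₂ fun x hx => (h.mem_region_iff.1 hx).2.2.1
  have hb := (h.mem_region_iff.1 (add_mem_of_closedBall_subset ht hc h.frame.norm_right).2).1.1
  rw [← h.y₂, show c - t • u - o = (c - p₂) + (p₂ - o) - t • u by abel, inner_sub_right _ _ (t • u),
    inner_add_right, inner_smul_right, h.frame.inner_self_right] at hb
  rw [h.frame.dist_sq _ _ p₂] at d₁ d₂
  rw [sub_self, inner_zero_right, inner_zero_right] at d₂
  rw [l₁, l₂] at d₁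
  have hθ1 : 0 ≤ γ / 2 - k := by linarith [h.tilt_mem.2]
  obtain ⟨θ, hθ⟩ : ∃ θ, θ = γ / 2 - k := ⟨_, rfl⟩
  rw [← hθ] at d₁ hs hφ hθ1
  have hsθ : 0 ≤ Real.sin θ := Real.sin_nonneg_of_nonneg_of_le_pi hθ1 (by linarith [ha.1])
  have hcθ : 0 ≤ Real.cos θ := Real.cos_nonneg_of_mem_Icc ⟨by linarith, by linarith [ha.1]⟩
  have hsa : 0 ≤ Real.sin a := Real.sin_nonneg_of_nonneg_of_le_pi ha.1 (by linarith [ha.2])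
  have hcφ : 0 ≤ Real.cos (a + θ) :=
    Real.cos_nonneg_of_mem_Icc ⟨by linarith [ha.1], hφ⟩
  have tθ := Real.sin_sq_add_cos_sq θ
  have ta := Real.sin_sq_add_cos_sq a
  obtain ⟨ℓ, hℓ⟩ : ∃ ℓ, ℓ = R * Real.cos (γ / 2) := ⟨_, rfl⟩
  rw [← hℓ] at hac
  rw [show 2 * R * Real.cos (γ / 2) = 2 * ℓ by rw [hℓ]; ring] at d₁ hD
  set X := ⟪v, c - p₂⟫_ℝ
  set Y := ⟪u, c - p₂⟫_ℝ
  -- The center of a ball of radius t > r lies in the lens of radius ρ over p₁p₂. As a + θ ≤ π/2,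
  -- the apex of the lens is its highest point, at height r above L₁, which is below t.
  have hlens := lens_height (S := Real.sin θ) (C := Real.cos θ) (E := ρ * Real.sin a) (ℓ := ℓ)
    (α := Real.cos θ * X + Real.sin θ * Y - ℓ) (β := Real.cos θ * Y - Real.sin θ * X) hsθ hcθ
    (by positivity) (by linarith)
    (by
      rw [Real.cos_add] at hcφ
      have := mul_nonneg hρ0 hcφ
      linear_combination this + Real.cos θ * hac)
    (by linear_combination d₁ + ((X ^ 2 + Y ^ 2) - 4 * ℓ ^ 2) * tθ - ρ ^ 2 * ta +
          (ρ * Real.cos a + ℓ) * hac)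
    (by linear_combination d₂ + (X ^ 2 + Y ^ 2) * tθ - ρ ^ 2 * ta + (ρ * Real.cos a + ℓ) * hac)
  rw [Real.sin_add] at hs
  have : Y ≤ r := by
    linear_combination hlens - Y * tθ + hs - Real.sin θ * hac
  linarith

/-- The data of a bent pentagon from a tilted triangle. -/
lemma isPentagonFrame (h : IsTiltedTriangle R γ k o v u p₁ p₂ p₃)
    (ha : a ∈ Set.Icc 0 (π / 2)) (hr : r ∈ Set.Icc 0 R)
    (hφ : a + (γ / 2 - k) ∈ Set.Icc 0 (π / 2)) (hρ : ρ = 2 * R * Real.cos (γ / 2) - r)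
    (hρ0 : 0 < ρ) (hac : ρ * Real.cos a = R * Real.cos (γ / 2))
    (hs : ρ * Real.sin (a + (γ / 2 - k)) = r) (hX : ⟪v, c - p₂⟫_ℝ = ρ * Real.cos (a + (γ / 2 - k)))
    (hY : ⟪u, c - p₂⟫_ℝ = ρ * Real.sin (a + (γ / 2 - k))) (h₁ : dist c p₁ = ρ) (h₂ : dist c p₂ = ρ) :
    IsPentagonFrame R r γ o p₁ p₂ p₃ c u := by
  obtain ⟨l₁, l₂, l₃, l₄⟩ := h.leg_coords'
  obtain ⟨d₂, d₃⟩ := h.dist_legs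
  obtain ⟨n₁, n₂, n₃⟩ := h.norm_sub
  have hD := h.leg_pos
  have hπ := Real.pi_pos
  have hsγ := h.sin_nonneg
  have hsa : 0 ≤ Real.sin a := Real.sin_nonneg_of_nonneg_of_le_pi ha.1 (by linarith [ha.2])
  have hca : 0 ≤ Real.cos a := Real.cos_nonneg_of_mem_Icc ⟨by linarith [ha.1], ha.2⟩
  obtain ⟨θ, hθ⟩ : ∃ θ, θ = γ / 2 - k := ⟨_, rfl⟩
  rw [← hθ] at l₁ l₂ l₃ l₄ hφ hs hX hY
  obtain ⟨φ, hφθ⟩ : ∃ φ, φ = a + θ := ⟨_, rfl⟩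
  rw [← hφθ] at hφ hs hX hY
  have hsφ : 0 ≤ Real.sin φ := Real.sin_nonneg_of_nonneg_of_le_pi hφ.1 (by linarith [hφ.2])
  have hcφ : 0 ≤ Real.cos φ := Real.cos_nonneg_of_mem_Icc ⟨by linarith [hφ.1], hφ.2⟩
  obtain ⟨D, hDd⟩ : ∃ D, D = 2 * R * Real.cos (γ / 2) := ⟨_, rfl⟩
  rw [← hDd] at l₁ l₂ l₃ l₄ d₂ d₃ hD hρ
  have t := Real.sin_sq_add_cos_sq θ
  have tφ := Real.sin_sq_add_cos_sq φ
  refine ⟨h.radius_pos, hr, h.angle_mem, by rw [dist_eq_norm, n₁], by rw [dist_eq_norm, n₂],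
    by rw [dist_eq_norm, n₃], by rw [d₂, hDd], by rw [d₃, hDd], ?_, by rw [h₁, d₂, hρ],
    by rw [h₂, d₂, hρ], ?_, h.frame.norm_right, ?_, ?_⟩
  · have e1 : InnerProductGeometry.angle (p₂ - p₁) (p₃ - p₁) = γ := by
      rw [InnerProductGeometry.angle, ← dist_eq_norm, ← dist_eq_norm, dist_comm p₂, dist_comm p₃, d₂,
        d₃, ← neg_sub p₁ p₂, inner_neg_left, h.frame.inner_eq, l₁, l₂, l₃, l₄,
        ← Real.arccos_cos h.angle_mem.1 (by linarith [h.angle_mem.2])]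
      congr 1
      rw [div_eq_iff (by positivity), Real.cos_sub, Real.sin_sub]
      rw [Real.arccos_cos h.angle_mem.1 (by linarith [h.angle_mem.2])]
      linear_combination D ^ 2 * Real.cos γ * t
    exact e1
  · refine ⟨AffineMap.lineMap p₁ p₂ (1 / 2 : ℝ), AffineMap.lineMap_mem_affineSpan_pair _ _ _,
      AffineMap.lineMap p₁ p₂ (Real.cos γ), AffineMap.lineMap_mem_affineSpan_pair _ _ _, ?_⟩
    have hc : c - AffineMap.lineMap p₁ p₂ (1 / 2 : ℝ) =
        (ρ * Real.sin a) • ((-Real.sin θ) • v + Real.cos θ • u) := by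
      rw [show c - AffineMap.lineMap p₁ p₂ (1 / 2 : ℝ) = (c - p₂) - (1 / 2 : ℝ) • (p₁ - p₂) by
        rw [AffineMap.lineMap_apply_module]; module]
      apply h.frame.ext
      · rw [inner_smul_right, h.frame.inner_left_comb, inner_sub_right, inner_smul_right, hX, l₁,
          hφθ, Real.cos_add]
        linear_combination Real.cos θ * hac - Real.cos θ / 2 * hDd
      · rw [inner_smul_right, h.frame.inner_right_comb, inner_sub_right, inner_smul_right, hY, l₂,
          hφθ, Real.sin_add]
        linear_combination Real.sin θ * hac - Real.sin θ / 2 * hDd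
    have hp : p₃ - AffineMap.lineMap p₁ p₂ (Real.cos γ) =
        (D * Real.sin γ) • ((-Real.sin θ) • v + Real.cos θ • u) := by
      rw [show p₃ - AffineMap.lineMap p₁ p₂ (Real.cos γ) = (p₃ - p₁) + Real.cos γ • (p₁ - p₂) by
        rw [AffineMap.lineMap_apply_module]; module]
      apply h.frame.ext
      · rw [inner_smul_right, h.frame.inner_left_comb, inner_add_right, inner_smul_right, l₁, l₃,
          Real.cos_sub]
        ring
      · rw [inner_smul_right, h.frame.inner_right_comb, inner_add_right, inner_smul_right, l₂, l₄,
          Real.sin_sub]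
        ring
    rw [vsub_eq_sub, vsub_eq_sub, hc, hp]
    exact ((SameRay.refl _).nonneg_smul_left (by positivity)).nonneg_smul_right (by positivity)
  · rw [hY, hs, abs_of_nonneg hr.1]
  · intro w hw hwc
    rw [h.frame.inner_eq, hX, hY] at hwc
    rw [h.frame.inner_eq w, l₁, l₂]
    have hn := h.frame.norm_sq w
    rw [hw] at hn
    set x := ⟪v, w⟫_ℝ
    set y := ⟪u, w⟫_ℝ
    -- A and B are the components of w along and across p₂c. Tangency fixes A² and B², and (A cos a
    -- − B sin a)² is least when AB is greatest, which is the case for u.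
    obtain ⟨A, hA⟩ : ∃ A, A = x * Real.cos φ + y * Real.sin φ := ⟨_, rfl⟩
    obtain ⟨B, hB⟩ : ∃ B, B = y * Real.cos φ - x * Real.sin φ := ⟨_, rfl⟩
    have hA2 : A ^ 2 = Real.sin φ ^ 2 := by
      have h1 := congrArg (· ^ 2) hwc
      simp only [sq_abs] at h1
      apply mul_left_cancel₀ (pow_pos hρ0 2).ne'
      rw [← mul_pow, ← mul_pow, hs, ← h1, hA]
      ring
    have hB2 : B ^ 2 = Real.cos φ ^ 2 := by
      have h1 : A ^ 2 + B ^ 2 = x ^ 2 + y ^ 2 := by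
        rw [hA, hB]; linear_combination (x ^ 2 + y ^ 2) * tφ
      linarith
    have hAB : A * B ≤ Real.sin φ * Real.cos φ := by
      refine (abs_le_of_sq_le_sq' (le_of_eq ?_) (by positivity)).2
      rw [mul_pow, mul_pow, hA2, hB2]
    have e1 : x * (D * Real.cos θ) + y * (D * Real.sin θ) =
        D * (A * Real.cos a - B * Real.sin a) := by
      rw [hA, hB, show θ = φ - a by rw [hφθ]; ring, Real.cos_sub, Real.sin_sub]; ring
    have e2 : Real.sin θ = Real.sin φ * Real.cos a - Real.cos φ * Real.sin a := by
      rw [← Real.sin_sub]; congr 1; rw [hφθ]; ring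
    rw [e1, e2, abs_mul, abs_mul]
    refine mul_le_mul_of_nonneg_left (sq_le_sq.1 ?_) (abs_nonneg _)
    have h2 := mul_le_mul_of_nonneg_left hAB (mul_nonneg hsa hca)
    linear_combination 2 * h2 - Real.cos a ^ 2 * hA2 - Real.sin a ^ 2 * hB2

end IsTiltedTriangle

section Existence

variable {K : Set Plane}

/-- A bent pentagon with the same inradius, diameter and circumradius as a given body. -/
lemma exists_isBentPentagon (hK : IsCompact K) (hne : K.Nonempty) (hr0 : 0 < inradius K)
    (h₁ : lowerBound₁ (inradius K) ≤ lowerBound₃ (inradius K) (diameter K) (circumradius K))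
    (h₂ : lowerBound₂ (diameter K) (circumradius K) ≤
      lowerBound₃ (inradius K) (diameter K) (circumradius K)) :
    ∃ P, IsBentPentagon P ∧ inradius P = inradius K ∧ diameter P = diameter K ∧
      circumradius P = circumradius K := by
  have hπ := Real.pi_pos
  have hnt : K.Nontrivial := by
    by_contra hs
    obtain ⟨c, hc⟩ := exists_inball hK hne
    have := two_mul_le_diam hK.isBounded hr0.le hc
    rw [diam_subsingleton (Set.not_nontrivial_iff.1 hs)] at this
    linarith
  obtain ⟨γ, hγ, hD⟩ := exists_apex_angle hK hnt
  have hR := circumradius_pos hK hnt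
  have hrR := inradius_le_circumradius hK hne
  have hRD := circumradius_le_diameter_sub hK hne
  obtain ⟨ha, hγa, hs, hac, hsr⟩ := vertex_angles hR hγ hD hr0.le hrR hRD
  rw [lowerBound₂_eq hR hγ hD] at h₂
  rw [lowerBound₃_eq hR hγ hD] at h₁ h₂
  set r := inradius K
  set R := circumradius K
  set D := diameter K
  set a := Real.arccos (D / (2 * (D - r)))
  set s := Real.arcsin (r / (D - r))
  rw [lowerBound₁] at h₁
  -- The tilt for which the strip has height ℓ₃.
  obtain ⟨k, hk⟩ : ∃ k, k = γ / 2 - (s - a) := ⟨_, rfl⟩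
  rw [← hk] at h₁ h₂
  have hsγ : 0 ≤ Real.sin γ := Real.sin_nonneg_of_nonneg_of_le_pi hγ.1 (by linarith [hγ.2])
  have hsγ' : 0 < Real.sin γ := by
    refine hsγ.lt_of_ne fun h0 => ?_
    rw [← h0] at h₁
    linarith
  -- ℓ₃ ≥ ℓ₂ says cos k ≥ cos(γ/2).
  have hkγ : k ∈ Set.Icc (-(γ / 2)) (γ / 2) := by
    refine abs_le.1 ?_
    by_contra hlt
    push Not at hlt
    have hc := Real.cos_lt_cos_of_nonneg_of_le_pi (by linarith [hγ.1])
      (abs_le.2 ⟨by linarith [ha.1, hs.2, hγ.1], by linarith [ha.2, hs.1, hγ.2]⟩) hlt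
    rw [Real.cos_abs] at hc
    have := mul_lt_mul_of_pos_left hc (by positivity : 0 < 2 * R * Real.sin γ)
    linarith
  obtain ⟨v, u, p₁, p₂, p₃, h⟩ := exists_isTiltedTriangle hR hγ hkγ
  have has : a + (γ / 2 - k) = s := by rw [hk]; ring
  have hρ0 : 0 < D - r := hR.trans_le hRD
  obtain ⟨c, hX, hY, d₁, d₂, d₃⟩ := h.exists_center hρ0.le ⟨hγa, ha.2⟩ hac
  have hframe := h.isPentagonFrame (r := r) ⟨ha.1, by linarith [ha.2]⟩ ⟨hr0.le, hrR⟩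
    (by rw [has]; exact hs) (by rw [← hD]) hρ0 hac (by rw [has]; exact hsr) hX hY d₁ d₂
  rw [has, hsr] at hY
  have hc₂ : ⟪u, c - 0⟫_ℝ = ⟪u, p₂ - 0⟫_ℝ + r := by
    rw [← hY, ← inner_add_right]; congr 1; abel
  have hball : closedBall c r ⊆ pentagonRegion p₁ p₂ p₃ u := by
    refine h.closedBall_subset_region ?_ ?_ ?_ (by rw [hc₂]) ?_
    · rw [d₁, ← hD]; linarith
    · rw [d₂, ← hD]; linarith
    · rw [← hD]; linarith
    · have := h.height_base
      linarith
  obtain ⟨m₁, m₂, m₃⟩ := h.vertices_mem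
  have hPc := isCompact_pentagonRegion p₁ p₂ p₃ u
  have hPr : inradius (pentagonRegion p₁ p₂ p₃ u) = r :=
    le_antisymm (h.inradius_region_le ha (by rw [has]; exact hs.2) (by rw [← hD]) hρ0.le hac
      (by rw [has]; exact hsr)) (le_inradius hPc.isBounded hr0.le hball)
  have hPD : diameter (pentagonRegion p₁ p₂ p₃ u) = D := by
    rw [h.diameter_eq m₁ m₂ fun x hx y hy => h.dist_le_of_mem_region hx hy, hD]
  have hPR := h.circumradius_eq m₁ m₂ m₃ h.region_subset_closedBall
  have hPnt : (pentagonRegion p₁ p₂ p₃ u).Nontrivial :=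
    ⟨p₁, m₁, p₂, m₂, dist_pos.1 (h.dist_legs.1 ▸ h.leg_pos)⟩
  refine ⟨_, ⟨R, r, γ, 0, p₁, p₂, p₃, c, u, hframe, rfl, h.convexHull_subset, hball, hPr, ?_⟩,
    hPr, hPD, hPR⟩
  rw [h.inner_sub_base, abs_of_nonneg h.height_base_nonneg]
  -- The region lies in the strip; conversely, the general inequality applies to the region itself,
  -- whose radii are now known.
  refine le_antisymm ((width_le_breadth hPc ⟨_, m₁⟩ h.frame.norm_right).trans
    (h.breadth_le ⟨_, m₁⟩ subset_rfl)) ?_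
  have := (lowerBounds_le_width hPc hPnt).2.2
  rwa [hPr, hPD, hPR, lowerBound₃_eq hR hγ hD, ← hk] at this

end Existence

/-! ### Bodies between two given bodies -/

section Interpolation

open scoped Pointwise

variable {K L P : Set Plane}

lemma breadth_mono {u : Plane} (hP : IsCompact P) (hne : K.Nonempty) (h : K ⊆ P) :
    breadth K u ≤ breadth P u :=
  breadth_le hne fun _ hx => ⟨csInf_le (bddBelow_inner_image hP u) ⟨_, h hx, rfl⟩,
    le_csSup (bddAbove_inner_image hP u) ⟨_, h hx, rfl⟩⟩

/-- Cancellation of a ball from an inclusion of Minkowski sums. -/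
lemma closedBall_subset_of_subset_add (hK : IsCompact K) (hKc : Convex ℝ K) {c : Plane} {ρ ε : ℝ}
    (hε : 0 ≤ ε) (h : closedBall c (ρ + ε) ⊆ K + closedBall 0 ε) : closedBall c ρ ⊆ K := by
  intro x hx
  by_contra hxK
  -- Pushing x by ε in the direction of a separating functional stays in the large ball but leaves K
  -- + closedBall 0 ε.
  obtain ⟨f, w, hf, hw⟩ := geometric_hahn_banach_closed_point hKc hK.isClosed hxK
  obtain ⟨g, rfl⟩ := (InnerProductSpace.toDual ℝ Plane).surjective f
  simp only [InnerProductSpace.toDual_apply_apply] at hf hw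
  obtain ⟨e, he, hge⟩ : ∃ e : Plane, ‖e‖ = 1 ∧ ⟪g, e⟫_ℝ = ‖g‖ := by
    rcases eq_or_ne g 0 with rfl | hg
    · obtain ⟨e, he⟩ := (NormedSpace.sphere_nonempty (E := Plane) (x := 0) (r := 1)).2 zero_le_one
      exact ⟨e, by simpa using he, by simp⟩
    · refine ⟨‖g‖⁻¹ • g, norm_smul_inv_norm hg, ?_⟩
      rw [inner_smul_right, real_inner_self_eq_norm_sq]
      field_simp [norm_ne_zero_iff.2 hg]
  have hmem : x + ε • e ∈ K + closedBall 0 ε := by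
    apply h
    rw [mem_closedBall] at hx ⊢
    refine (dist_triangle _ x _).trans ?_
    rw [dist_eq_norm (x + ε • e), add_sub_cancel_left, norm_smul, he, mul_one, Real.norm_of_nonneg hε]
    linarith
  obtain ⟨y, hy, z, hz, hyz⟩ := Set.mem_add.1 hmem
  have h1 := congrArg (fun q => ⟪g, q⟫_ℝ) hyz
  simp only [inner_add_right, inner_smul_right, hge] at h1
  have h2 : ⟪g, z⟫_ℝ ≤ ‖g‖ * ε := (real_inner_le_norm g z).trans
    (mul_le_mul_of_nonneg_left (by simpa using hz) (norm_nonneg _))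
  linarith [hf y hy]

/-- Cancelling the ε-ball leaves a ball of radius inradius L − ε in K. This makes the inradius
Lipschitz along Minkowski interpolation. -/
lemma inradius_le_add_of_subset_add (hK : IsCompact K) (hKc : Convex ℝ K) (hL : IsCompact L)
    (hne : L.Nonempty) {ε : ℝ} (hε : 0 ≤ ε) (h : L ⊆ K + closedBall 0 ε) :
    inradius L ≤ inradius K + ε := by
  rcases le_total (inradius L) ε with hle | hle
  · linarith [inradius_nonneg (K := K)]
  · obtain ⟨c, hc⟩ := exists_inball hL hne
    have h1 : closedBall c (inradius L - ε) ⊆ K :=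
      closedBall_subset_of_subset_add hK hKc hε (by rw [sub_add_cancel]; exact hc.trans h)
    linarith [le_inradius hK.isBounded (sub_nonneg.2 hle) h1]

/-- Between two bodies there are bodies with any inradius in between. -/
lemma exists_inradius_eq (hL : IsCompact L) (hLc : Convex ℝ L) (hLne : L.Nonempty)
    (hP : IsCompact P) (hPc : Convex ℝ P) (hLP : L ⊆ P) {r : ℝ} (h₁ : inradius L ≤ r)
    (h₂ : r ≤ inradius P) :
    ∃ K, IsCompact K ∧ Convex ℝ K ∧ L ⊆ K ∧ K ⊆ P ∧ inradius K = r := by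
  set F : ℝ → Set Plane := fun t => (1 - t) • L + t • P with hF
  have hFk : ∀ t, IsCompact (F t) := fun t => (hL.smul _).add (hP.smul _)
  have hFc : ∀ t, Convex ℝ (F t) := fun t => (hLc.smul _).add (hPc.smul _)
  have hPne := hLne.mono hLP
  have hFne : ∀ t, (F t).Nonempty := fun t => hLne.smul_set.add hPne.smul_set
  have hF0 : F 0 = L := by
    simp only [hF, sub_zero, one_smul]
    rw [Set.zero_smul_set hPne, add_zero]
  have hF1 : F 1 = P := by
    simp only [hF, sub_self, one_smul]
    rw [Set.zero_smul_set hLne, zero_add]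
  -- Replacing t by s in (1 − t)l + tp moves the point by (t − s)(p − l).
  have hsub : ∀ s t, F t ⊆ F s + closedBall 0 (diam P * |t - s|) := by
    rintro s t x hx
    obtain ⟨_, ⟨l, hl, rfl⟩, _, ⟨p, hp, rfl⟩, rfl⟩ := Set.mem_add.1 hx
    refine Set.mem_add.2 ⟨(1 - s) • l + s • p, Set.add_mem_add ⟨l, hl, rfl⟩ ⟨p, hp, rfl⟩,
      (t - s) • (p - l), ?_, ?_⟩
    · rw [mem_closedBall_zero_iff, norm_smul, Real.norm_eq_abs, mul_comm, ← dist_eq_norm]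
      exact mul_le_mul_of_nonneg_right (dist_le_diam_of_mem hP.isBounded hp (hLP hl))
        (abs_nonneg _)
    · simp only
      module
  have hlip : ∀ s t, inradius (F t) ≤ inradius (F s) + diam P * dist t s := fun s t =>
    inradius_le_add_of_subset_add (hFk s) (hFc s) (hFk t) (hFne t)
      (mul_nonneg diam_nonneg (abs_nonneg _)) (hsub s t)
  have hcont : Continuous fun t => inradius (F t) :=
    (LipschitzWith.of_le_add_mul ⟨diam P, diam_nonneg⟩ fun s t => hlip t s).continuous
  obtain ⟨t, ht, hr⟩ := intermediate_value_Icc zero_le_one hcont.continuousOn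
    (⟨by rwa [hF0], by rwa [hF1]⟩ : r ∈ Set.Icc (inradius (F 0)) (inradius (F 1)))
  refine ⟨F t, hFk t, hFc t, fun x hx => ?_, ?_, hr⟩
  · exact Set.mem_add.2 ⟨_, ⟨x, hx, rfl⟩, _, ⟨x, hLP hx, rfl⟩, by simp only; module⟩
  · rintro x hx
    obtain ⟨_, ⟨l, hl, rfl⟩, _, ⟨p, hp, rfl⟩, rfl⟩ := Set.mem_add.1 hx
    exact hPc (hLP hl) hp (by linarith [ht.2]) ht.1 (by ring)

end Interpolation

/-! ### The lower boundary -/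

/-- The inradius of an isosceles triangle. -/
lemma IsTiltedTriangle.inradius_convexHull_le {R γ k : ℝ} {o v u p₁ p₂ p₃ : Plane}
    (h : IsTiltedTriangle R γ k o v u p₁ p₂ p₃) :
    inradius (convexHull ℝ {p₁, p₂, p₃}) ≤ 2 * R * Real.sin (γ / 2) * (1 - Real.sin (γ / 2)) := by
  have hπ := Real.pi_pos
  have hR := h.radius_pos
  obtain ⟨hγ0, hγ3⟩ := h.angle_mem
  have hσ : 0 ≤ Real.sin (γ / 2) :=
    Real.sin_nonneg_of_nonneg_of_le_pi (by linarith) (by linarith)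
  have hσ3 : 0 ≤ Real.sin (3 * γ / 2) :=
    Real.sin_nonneg_of_nonneg_of_le_pi (by linarith) (by linarith)
  refine inradius_le ((Set.insert_nonempty _ _).convexHull) fun ρ c hρ hc => ?_
  have key : ∀ n m t : ℝ, n ^ 2 + m ^ 2 = 1 →
      n * (R * Real.cos k) + m * -(R * Real.sin k) ≤ t →
      n * -(R * Real.cos (γ - k)) + m * -(R * Real.sin (γ - k)) ≤ t →
      n * -(R * Real.cos (γ + k)) + m * (R * Real.sin (γ + k)) ≤ t →
      n * ⟪v, c - o⟫_ℝ + m * ⟪u, c - o⟫_ℝ + ρ ≤ t := by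
    intro n m t hnm t₁ t₂ t₃
    set w : Plane := n • v + m • u with hw
    have hwi : ∀ x : Plane, ⟪w, x⟫_ℝ = n * ⟪v, x⟫_ℝ + m * ⟪u, x⟫_ℝ := fun x => by
      rw [hw, inner_add_left, real_inner_smul_left, real_inner_smul_left]
    have hwn : ‖w‖ = 1 := by
      rw [← pow_left_inj₀ (norm_nonneg _) zero_le_one two_ne_zero, h.frame.norm_sq, hw,
        h.frame.inner_left_comb, h.frame.inner_right_comb, hnm, one_pow]
    have hsub : convexHull ℝ {p₁, p₂, p₃} ⊆ {x | ⟪w, x⟫_ℝ ≤ t + ⟪w, o⟫_ℝ} := by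
      refine convexHull_min ?_ (convex_halfSpace_le (innerSL ℝ w).isLinear _)
      have hp : ∀ p : Plane, n * ⟪v, p - o⟫_ℝ + m * ⟪u, p - o⟫_ℝ ≤ t → ⟪w, p⟫_ℝ ≤ t + ⟪w, o⟫_ℝ := by
        intro p hp
        rw [← hwi, inner_sub_right] at hp
        linarith
      rintro x (rfl | rfl | rfl) <;> apply hp
      · rwa [h.x₁, h.y₁]
      · rwa [h.x₂, h.y₂]
      · rwa [h.x₃, h.y₃]
    have h1 := hsub (add_mem_of_closedBall_subset hρ hc hwn).1
    rw [Set.mem_ofPred_eq, inner_add_right, inner_smul_right, real_inner_self_eq_norm_sq, hwn] at h1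
    rw [← hwi, inner_sub_right]
    linarith
  -- The ball is tested against the outer normals of the two legs and of the base. With weights 1, 1
  -- and 2 sin(γ/2), proportional to the side lengths, the normals add up to 0 and the center drops
  -- out.
  have a₁ : Real.sin (γ / 2 - k) * Real.cos k + Real.cos (γ / 2 - k) * Real.sin k =
      Real.sin (γ / 2) := by rw [← Real.sin_add]; congr 1; ring
  have k₁ := key (Real.sin (γ / 2 - k)) (-Real.cos (γ / 2 - k)) (R * Real.sin (γ / 2))
    (by rw [neg_sq]; exact Real.sin_sq_add_cos_sq _)
    (by linear_combination R * a₁)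
    (by
      have : Real.sin (γ - k) * Real.cos (γ / 2 - k) - Real.cos (γ - k) * Real.sin (γ / 2 - k) =
        Real.sin (γ / 2) := by rw [← Real.sin_sub]; congr 1; ring
      linear_combination R * this)
    (by
      have : Real.sin (γ + k) * Real.cos (γ / 2 - k) + Real.cos (γ + k) * Real.sin (γ / 2 - k) =
        Real.sin (3 * γ / 2) := by rw [← Real.sin_add]; congr 1; ring
      linear_combination -R * this + R * hσ + R * hσ3)
  have k₂ := key (Real.sin (γ / 2 + k)) (Real.cos (γ / 2 + k)) (R * Real.sin (γ / 2))
    (Real.sin_sq_add_cos_sq _)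
    (by
      have : Real.sin (γ / 2 + k) * Real.cos k - Real.cos (γ / 2 + k) * Real.sin k =
        Real.sin (γ / 2) := by rw [← Real.sin_sub]; congr 1; ring
      linear_combination R * this)
    (by
      have : Real.sin (γ - k) * Real.cos (γ / 2 + k) + Real.cos (γ - k) * Real.sin (γ / 2 + k) =
        Real.sin (3 * γ / 2) := by rw [← Real.sin_add]; congr 1; ring
      linear_combination -R * this + R * hσ + R * hσ3)
    (by
      have : Real.sin (γ + k) * Real.cos (γ / 2 + k) - Real.cos (γ + k) * Real.sin (γ / 2 + k) =
        Real.sin (γ / 2) := by rw [← Real.sin_sub]; congr 1; ring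
      linear_combination R * this)
  have k₃ := key (-Real.cos k) (Real.sin k) (R * Real.cos γ)
    (by rw [neg_sq]; exact Real.cos_sq_add_sin_sq _)
    (by linear_combination -R * Real.sin_sq_add_cos_sq k + R * h.cos_angle_pos.le + hR.le)
    (by
      have : Real.cos (γ - k) * Real.cos k - Real.sin (γ - k) * Real.sin k =
        Real.cos γ := by rw [← Real.cos_add]; congr 1; ring
      linear_combination R * this)
    (by
      have : Real.cos (γ + k) * Real.cos k + Real.sin (γ + k) * Real.sin k =
        Real.cos γ := by rw [← Real.cos_sub]; congr 1; ring
      linear_combination R * this)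
  have hc := Real.cos_two_mul (γ / 2)
  rw [mul_div_cancel₀ _ two_ne_zero] at hc
  have k₃' := mul_le_mul_of_nonneg_left k₃ hσ
  have t := Real.sin_sq_add_cos_sq (γ / 2)
  rw [Real.sin_sub, Real.cos_sub] at k₁
  rw [Real.sin_add, Real.cos_add] at k₂
  have h1 : (2 + 2 * Real.sin (γ / 2)) * ρ ≤
      2 * R * Real.sin (γ / 2) + 2 * Real.sin (γ / 2) * (R * Real.cos γ) := by
    linear_combination k₁ + k₂ + 2 * k₃'
  refine le_of_mul_le_mul_left (h1.trans (le_of_eq ?_))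
    (by linarith : 0 < 2 + 2 * Real.sin (γ / 2))
  rw [hc]
  linear_combination 4 * R * Real.sin (γ / 2) * t

/-- Bodies with prescribed inradius between an isosceles triangle and a body with the same
diameter and circumradius. -/
lemma IsTiltedTriangle.exists_between {R γ k r : ℝ} {o v u p₁ p₂ p₃ : Plane} {P : Set Plane}
    (h : IsTiltedTriangle R γ k o v u p₁ p₂ p₃) (hP : IsCompact P) (hPc : Convex ℝ P)
    (hT : convexHull ℝ {p₁, p₂, p₃} ⊆ P) (hPR : P ⊆ closedBall o R)
    (hPD : ∀ x ∈ P, ∀ y ∈ P, dist x y ≤ 2 * R * Real.cos (γ / 2))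
    (hr : 2 * R * Real.sin (γ / 2) * (1 - Real.sin (γ / 2)) ≤ r) (hrP : r ≤ inradius P) :
    ∃ K, IsCompact K ∧ Convex ℝ K ∧ K.Nontrivial ∧ inradius K = r ∧
      diameter K = 2 * R * Real.cos (γ / 2) ∧ circumradius K = R ∧ width K ≤ breadth P u := by
  obtain ⟨K, hK, hKc, hTK, hKP, hKr⟩ := exists_inradius_eq
    (isCompact_convexHull (Set.toFinite {p₁, p₂, p₃}).isCompact) (convex_convexHull ℝ _)
    (Set.insert_nonempty _ _).convexHull hP hPc hT (h.inradius_convexHull_le.trans hr) hrP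
  have m : ∀ p ∈ ({p₁, p₂, p₃} : Set Plane), p ∈ K := fun p hp => hTK (subset_convexHull ℝ _ hp)
  have m₁ := m p₁ (by simp)
  have m₂ := m p₂ (by simp)
  exact ⟨K, hK, hKc, ⟨p₁, m₁, p₂, m₂, dist_pos.1 (h.dist_legs.1 ▸ h.leg_pos)⟩, hKr,
    h.diameter_eq m₁ m₂ fun x hx y hy => hPD x (hKP hx) y (hKP hy),
    h.circumradius_eq m₁ m₂ (m p₃ (by simp)) (hKP.trans hPR),
    (width_le_breadth hK ⟨_, m₁⟩ h.frame.norm_right).trans (breadth_mono hP ⟨_, m₁⟩ hKP)⟩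

/-- The hull of the untilted triangle and a big ball around its circumcenter. -/
lemma exists_body_of_big_inradius {R γ r : ℝ} (hR : 0 < R) (hγ : γ ∈ Set.Icc 0 (π / 3))
    (hr0 : 0 ≤ r) (hrR : r ≤ R) (hRD : R + r ≤ 2 * R * Real.cos (γ / 2))
    (hr : 2 * R * Real.sin (γ / 2) * (1 - Real.sin (γ / 2)) ≤ r) (hrγ : R * Real.sin γ ≤ r) :
    ∃ K, IsCompact K ∧ Convex ℝ K ∧ K.Nontrivial ∧ inradius K = r ∧
      diameter K = 2 * R * Real.cos (γ / 2) ∧ circumradius K = R ∧ width K ≤ 2 * r := by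
  -- Without tilt the vertices have heights 0 and ±R sin γ, so R sin γ ≤ r puts the triangle into
  -- the strip of the ball.
  obtain ⟨v, u, p₁, p₂, p₃, h⟩ := exists_isTiltedTriangle (k := 0) hR hγ
    ⟨by linarith [hγ.1], by linarith [hγ.1]⟩
  obtain ⟨n₁, n₂, n₃⟩ := h.norm_sub
  simp only [sub_zero] at n₁ n₂ n₃
  set S : Set Plane := {p₁, p₂, p₃} ∪ closedBall 0 r with hS
  have hSk : IsCompact S := (Set.toFinite _).isCompact.union (isCompact_closedBall _ _)
  have hPk := isCompact_convexHull hSk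
  have hball : closedBall 0 r ⊆ convexHull ℝ S := Set.subset_union_right.trans (subset_convexHull ℝ S)
  have hSR : ∀ x ∈ S, ‖x‖ ≤ R := by
    rintro x ((rfl | rfl | rfl) | hx)
    · exact n₁.le
    · exact n₂.le
    · exact n₃.le
    · exact (mem_closedBall_zero_iff.1 hx).trans hrR
  have hD := h.leg_pos
  have hTD : ∀ x ∈ ({p₁, p₂, p₃} : Set Plane), ∀ y ∈ ({p₁, p₂, p₃} : Set Plane),
      dist x y ≤ 2 * R * Real.cos (γ / 2) := fun x hx y hy =>
    h.dist_le_of_mem_region (h.convexHull_subset (subset_convexHull ℝ _ hx))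
      (h.convexHull_subset (subset_convexHull ℝ _ hy))
  have hSD : ∀ x ∈ S, ∀ y ∈ S, dist x y ≤ 2 * R * Real.cos (γ / 2) := by
    intro x hx y hy
    rcases hx with hx' | hx'
    · rcases hy with hy' | hy'
      · exact hTD x hx' y hy'
      · rw [dist_eq_norm]
        linarith [norm_sub_le x y, hSR x (Or.inl hx'), mem_closedBall_zero_iff.1 hy']
    · rw [dist_eq_norm]
      linarith [norm_sub_le x y, hSR y hy, mem_closedBall_zero_iff.1 hx']
  have hSu : ∀ x ∈ S, ⟪u, x⟫_ℝ ∈ Set.Icc (-r) r := by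
    have y₁ := h.y₁
    have y₂ := h.y₂
    have y₃ := h.y₃
    simp only [sub_zero, add_zero, Real.sin_zero, mul_zero, neg_zero] at y₁ y₂ y₃
    have := mul_nonneg hR.le h.sin_nonneg
    rintro x ((rfl | rfl | rfl) | hx)
    · rw [y₁]; constructor <;> linarith
    · rw [y₂]; constructor <;> linarith
    · rw [y₃]; constructor <;> linarith
    · refine abs_le.1 ((abs_real_inner_le_norm u x).trans ?_)
      rw [h.frame.norm_right, one_mul]
      exact mem_closedBall_zero_iff.1 hx
  have hPu : convexHull ℝ S ⊆ (innerSL ℝ u) ⁻¹' Set.Icc (-r) r :=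
    convexHull_min hSu ((convex_Icc _ _).linear_preimage (innerSL ℝ u).toLinearMap)
  obtain ⟨K, hK, hKc, hKnt, hKr, hKD, hKR, hKw⟩ := h.exists_between hPk (convex_convexHull ℝ S)
    (convexHull_mono Set.subset_union_left)
    (convexHull_min (fun x hx => mem_closedBall_zero_iff.2 (hSR x hx)) (convex_closedBall _ _))
    (fun x hx y hy => (dist_le_diam_of_mem hPk.isBounded hx hy).trans (by
      rw [convexHull_diam]; exact diam_le_of_forall_dist_le hD.le hSD))
    hr (le_inradius hPk.isBounded hr0 hball)
  refine ⟨K, hK, hKc, hKnt, hKr, hKD, hKR, hKw.trans ?_⟩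
  have := breadth_le (u := u) (K := convexHull ℝ S) ⟨_, hball (mem_closedBall_self hr0)⟩
    fun x hx => hPu hx
  linarith

/-- The pentagon region of sufficiently small tilt contains a ball of radius `r`. -/
lemma IsTiltedTriangle.le_inradius_region {R γ k r a s : ℝ} {o v u p₁ p₂ p₃ : Plane}
    (h : IsTiltedTriangle R γ k o v u p₁ p₂ p₃) (hr : 0 ≤ r) (hk : 0 ≤ k)
    (hRD : R ≤ 2 * R * Real.cos (γ / 2) - r) (ha : a ∈ Set.Icc (γ / 2) (π / 3))
    (hac : (2 * R * Real.cos (γ / 2) - r) * Real.cos a = R * Real.cos (γ / 2))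
    (hs : s ∈ Set.Icc 0 (π / 2)) (hsr : (2 * R * Real.cos (γ / 2) - r) * Real.sin s = r)
    (hsk : s ≤ a + (γ / 2 - k)) (hrk : 2 * r ≤ 2 * R * Real.sin γ * Real.cos k) :
    r ≤ inradius (pentagonRegion p₁ p₂ p₃ u) := by
  have hπ := Real.pi_pos
  have hR := h.radius_pos
  have hρ : 0 < 2 * R * Real.cos (γ / 2) - r := hR.trans_le hRD
  obtain ⟨n₁, n₂, n₃⟩ := h.norm_sub
  obtain ⟨c, hX, hY, d₁, d₂, d₃⟩ := h.exists_center hρ.le ha hac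
  have hh : r ≤ ⟪u, c - p₂⟫_ℝ := by
    rw [hY]
    calc r = (2 * R * Real.cos (γ / 2) - r) * Real.sin s := hsr.symm
      _ ≤ _ := mul_le_mul_of_nonneg_left (Real.sin_le_sin_of_le_of_le_pi_div_two
        (by linarith [hs.1]) (by linarith [ha.2, h.angle_mem.2]) hsk) hρ.le
  have hc : ⟪u, c - o⟫_ℝ = ⟪u, c - p₂⟫_ℝ + ⟪u, p₂ - o⟫_ℝ := by
    rw [← inner_add_right, sub_add_sub_cancel]
  have hbase := h.height_base
  have hsum : 0 ≤ ⟪u, p₃ - o⟫_ℝ + ⟪u, p₂ - o⟫_ℝ := by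
    have h1 : 0 ≤ Real.sin k := Real.sin_nonneg_of_nonneg_of_le_pi hk
      (by linarith [h.tilt_mem.2, h.angle_mem.2])
    have h2 := mul_nonneg (mul_nonneg hR.le h.cos_angle_pos.le) h1
    rw [h.y₂, h.y₃, Real.sin_add, Real.sin_sub]
    linarith
  -- The touching ball may reach above the upper line. Its center is moved towards o until the ball
  -- rests on the lower line, or to o itself if the ball around o is already high enough.
  obtain ⟨t, ht, ht₁, ht₂⟩ : ∃ t ∈ Set.Icc (0 : ℝ) 1, ⟪u, p₂ - o⟫_ℝ + r ≤ t * ⟪u, c - o⟫_ℝ ∧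
      t * ⟪u, c - o⟫_ℝ + r ≤ ⟪u, p₃ - o⟫_ℝ := by
    rcases le_or_gt (⟪u, p₂ - o⟫_ℝ + r) 0 with hle | hlt
    · exact ⟨0, ⟨le_rfl, zero_le_one⟩, by linarith, by linarith⟩
    · have hpos : 0 < ⟪u, c - o⟫_ℝ := by linarith
      refine ⟨(⟪u, p₂ - o⟫_ℝ + r) / ⟪u, c - o⟫_ℝ, ⟨by positivity, ?_⟩, ?_, ?_⟩
      · rw [div_le_one hpos]; linarith
      · rw [div_mul_cancel₀ _ hpos.ne']
      · rw [div_mul_cancel₀ _ hpos.ne']; linarith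
  -- Both ends of the segment have distance at most D − r from the vertex, o because R ≤ D − r.
  have hd : ∀ p : Plane, ‖p - o‖ = R → dist c p ≤ 2 * R * Real.cos (γ / 2) - r →
      dist (o + t • (c - o)) p + r ≤ 2 * R * Real.cos (γ / 2) := by
    intro p hp hcp
    have h1 := convex_closedBall p (2 * R * Real.cos (γ / 2) - r)
      (mem_closedBall.2 (by rw [dist_comm, dist_eq_norm, hp]; exact hRD) :
        o ∈ closedBall p (2 * R * Real.cos (γ / 2) - r)) (mem_closedBall.2 hcp)
      (sub_nonneg.2 ht.2) ht.1 (sub_add_cancel _ _)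
    rw [show (1 - t) • o + t • c = o + t • (c - o) by module, mem_closedBall] at h1
    linarith
  refine le_inradius (isCompact_pentagonRegion _ _ _ _).isBounded hr
    (h.closedBall_subset_region (hd _ n₁ d₁.le) (hd _ n₂ d₂.le) (hd _ n₃ d₃) ?_ ?_) <;>
  rwa [add_sub_cancel_left, inner_smul_right]

/-- The best of the three bounds is attained for any inradius, diameter and circumradius of a
body. -/
lemma exists_width_eq {K : Set Plane} (hK : IsCompact K) (hKc : Convex ℝ K) (hnt : K.Nontrivial) :
    ∃ L, IsCompact L ∧ Convex ℝ L ∧ L.Nontrivial ∧ inradius L = inradius K ∧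
      diameter L = diameter K ∧ circumradius L = circumradius K ∧
      width L = max (lowerBound₁ (inradius K)) (max (lowerBound₂ (diameter K) (circumradius K))
        (lowerBound₃ (inradius K) (diameter K) (circumradius K))) := by
  suffices ∃ L, IsCompact L ∧ Convex ℝ L ∧ L.Nontrivial ∧ inradius L = inradius K ∧
      diameter L = diameter K ∧ circumradius L = circumradius K ∧
      width L ≤ max (lowerBound₁ (inradius K)) (max (lowerBound₂ (diameter K) (circumradius K))
        (lowerBound₃ (inradius K) (diameter K) (circumradius K))) by
    obtain ⟨L, hL, hLc, hLnt, hr, hD, hR, hw⟩ := this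
    refine ⟨L, hL, hLc, hLnt, hr, hD, hR, le_antisymm hw ?_⟩
    have := lowerBounds_le_width hL hLnt
    rw [hr, hD, hR] at this
    exact max_le this.1 (max_le this.2.1 this.2.2)
  have hπ := Real.pi_pos
  obtain ⟨γ, hγ, hD⟩ := exists_apex_angle hK hnt
  have hR := circumradius_pos hK hnt
  have hr0 := inradius_nonneg (K := K)
  have hrR := inradius_le_circumradius hK hnt.nonempty
  have hRD := circumradius_le_diameter_sub hK hnt.nonempty
  have hrT := le_inradius_of_apex_angle hK hKc hnt hγ hD
  obtain ⟨ha, hγa, hs, hac, hsr⟩ := vertex_angles hR hγ hD hr0 hrR hRD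
  rw [lowerBound₂_eq hR hγ hD, lowerBound₃_eq hR hγ hD, lowerBound₁]
  set r := inradius K
  set R := circumradius K
  set D := diameter K
  set a := Real.arccos (D / (2 * (D - r)))
  set s := Real.arcsin (r / (D - r))
  rcases le_or_gt (R * Real.sin γ) r with hrγ | hrγ
  · obtain ⟨L, hL, hLc, hLnt, h1, h2, h3, hw⟩ := exists_body_of_big_inradius hR hγ hr0 hrR
      (by rw [← hD]; linarith) hrT hrγ
    exact ⟨L, hL, hLc, hLnt, h1, h2.trans hD.symm, h3, hw.trans (le_max_left _ _)⟩
  · have hsγ : 0 < R * Real.sin γ := hr0.trans_lt hrγ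
    have hρ0 : 0 < D - r := hR.trans_le hRD
    -- Otherwise r = ρ sin s ≥ ρ sin(a + γ/2) ≥ 2ρ cos a sin(γ/2) = R sin γ.
    have hb : s - a ≤ γ / 2 := by
      by_contra hlt
      push Not at hlt
      have hκ : 0 < Real.cos (γ / 2) :=
        Real.cos_pos_of_mem_Ioo ⟨by linarith [hγ.1], by linarith [hγ.2]⟩
      have h1 : Real.sin (a + γ / 2) ≤ Real.sin s := Real.sin_le_sin_of_le_of_le_pi_div_two
        (by linarith [ha.1, hγ.1]) hs.2 (by linarith)
      have h2 : 0 ≤ Real.sin (a - γ / 2) := Real.sin_nonneg_of_nonneg_of_le_pi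
        (by linarith) (by linarith [ha.2, hγ.1])
      rw [Real.sin_add] at h1
      rw [Real.sin_sub] at h2
      have h3 := mul_le_mul_of_nonneg_left h1 hρ0.le
      have h4 := mul_nonneg hρ0.le h2
      have h5 := sin_eq_two_mul_half γ
      have h6 : R * Real.sin γ ≤ r := by
        linear_combination h3 + h4 + hsr + R * h5 - 2 * Real.sin (γ / 2) * hac
      linarith
    -- θ is the positive part of s − a: either ℓ₃ is reached, or the tilt can be the extreme one,
    -- which gives ℓ₂.
    obtain ⟨θ, hθ0, hθγ, hθb, hθM⟩ : ∃ θ, 0 ≤ θ ∧ θ ≤ γ / 2 ∧ s - a ≤ θ ∧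
        2 * R * Real.sin γ * Real.cos (γ / 2 - θ) ≤ max (2 * R * Real.sin γ * Real.cos (γ / 2))
          (2 * R * Real.sin γ * Real.cos (γ / 2 - (s - a))) := by
      rcases le_total 0 (s - a) with h0 | h0
      · exact ⟨s - a, h0, hb, le_rfl, le_max_right _ _⟩
      · exact ⟨0, le_rfl, by linarith [hγ.1], h0, by rw [sub_zero]; exact le_max_left _ _⟩
    -- If this strip is narrower than 2r, the tilt is reduced until its height is exactly 2r, which
    -- gives ℓ₁.
    obtain ⟨k, hk0, hkθ, hk₁, hk₂⟩ : ∃ k, 0 ≤ k ∧ k ≤ γ / 2 - θ ∧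
        2 * r ≤ 2 * R * Real.sin γ * Real.cos k ∧
        2 * R * Real.sin γ * Real.cos k ≤
          max (2 * r) (2 * R * Real.sin γ * Real.cos (γ / 2 - θ)) := by
      rcases le_total (2 * r) (2 * R * Real.sin γ * Real.cos (γ / 2 - θ)) with h0 | h0
      · exact ⟨γ / 2 - θ, by linarith, le_rfl, h0, le_max_right _ _⟩
      · have h1 : Real.cos (γ / 2 - θ) ≤ r / (R * Real.sin γ) := by
          rw [le_div_iff₀ hsγ]; linarith
        have h2 : 0 ≤ r / (R * Real.sin γ) := by positivity
        have h3 : 2 * R * Real.sin γ * Real.cos (Real.arccos (r / (R * Real.sin γ))) = 2 * r := by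
          rw [Real.cos_arccos (by linarith) (by rw [div_le_one hsγ]; exact hrγ.le)]
          rw [show 2 * R * Real.sin γ * (r / (R * Real.sin γ)) =
            2 * (R * Real.sin γ * (r / (R * Real.sin γ))) by ring, mul_div_cancel₀ _ hsγ.ne']
        refine ⟨_, Real.arccos_nonneg (r / (R * Real.sin γ)), ?_, h3.ge,
          h3.le.trans (le_max_left _ _)⟩
        have h4 := Real.arccos_le_arccos h1
        rwa [Real.arccos_cos (by linarith) (by linarith [hγ.2])] at h4
    obtain ⟨v, u, p₁, p₂, p₃, h⟩ := exists_isTiltedTriangle (k := k) hR hγ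
      ⟨by linarith [hγ.1], by linarith⟩
    obtain ⟨L, hL, hLc, hLnt, h1, h2, h3, hw⟩ := h.exists_between
      (isCompact_pentagonRegion p₁ p₂ p₃ u) (convex_pentagonRegion p₁ p₂ p₃ u) h.convexHull_subset
      h.region_subset_closedBall (fun x hx y hy => h.dist_le_of_mem_region hx hy) hrT
      (h.le_inradius_region (a := a) (s := s) hr0 hk0 (by rwa [← hD]) ⟨hγa, ha.2⟩ (by rwa [← hD]) hs
        (by rwa [← hD]) (by linarith) hk₁)
    refine ⟨L, hL, hLc, hLnt, h1, h2.trans hD.symm, h3, hw.trans ?_⟩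
    refine (h.breadth_le ⟨_, h.vertices_mem.1⟩ subset_rfl).trans (hk₂.trans ?_)
    exact max_le_max le_rfl hθM

/-! ### Scaling -/

lemma lowerBound₁_div (r R : ℝ) : lowerBound₁ (r / R) = lowerBound₁ r / R := by
  rw [lowerBound₁, lowerBound₁, mul_div_assoc]

lemma lowerBound₂_div {R : ℝ} (hR : 0 < R) (D : ℝ) :
    lowerBound₂ (2 * (D / (2 * R))) 1 = lowerBound₂ D R / R := by
  have h : √(4 * R ^ 2 - D ^ 2) = R * √(4 * 1 ^ 2 - (2 * (D / (2 * R))) ^ 2) := by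
    nth_rewrite 2 [← Real.sqrt_sq hR.le]
    rw [← Real.sqrt_mul (sq_nonneg R)]
    congr 1
    field_simp
  rw [lowerBound₂, lowerBound₂, h]
  field_simp

lemma lowerBound₃_div {R : ℝ} (hR : 0 < R) (r D : ℝ) :
    lowerBound₃ (r / R) (2 * (D / (2 * R))) 1 = lowerBound₃ r D R / R := by
  have h₁ : 2 * (D / (2 * R)) = D / R := by field_simp
  have h₂ : D / R / (2 * 1) = D / (2 * R) := by field_simp
  rw [lowerBound₃, lowerBound₃, h₁, h₂, ← sub_div, ← mul_div_assoc 2 (D - r) R,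
    div_div_div_cancel_right₀ hR.ne', div_div_div_cancel_right₀ hR.ne']
  ring

/-- All three bounds are homogeneous of degree one, so they pass to the diagram, where R = 1. -/
lemma max_lowerBound_div {R : ℝ} (hR : 0 < R) (r D : ℝ) :
    max (lowerBound₁ (r / R)) (max (lowerBound₂ (2 * (D / (2 * R))) 1)
      (lowerBound₃ (r / R) (2 * (D / (2 * R))) 1)) =
    max (lowerBound₁ r) (max (lowerBound₂ D R) (lowerBound₃ r D R)) / R := by
  rw [lowerBound₁_div, lowerBound₂_div hR, lowerBound₃_div hR, max_div_div_right hR.le,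
    max_div_div_right hR.le]

lemma two_mul_div_two_mul (w R : ℝ) : 2 * (w / (2 * R)) = w / R := by
  rw [← mul_div_assoc, mul_div_mul_left _ _ two_ne_zero]

lemma le_two_mul_of_mem_diagram {x y z : ℝ} (h : (x, y, z) ∈ diagram) :
    max (lowerBound₁ x) (max (lowerBound₂ (2 * z) 1) (lowerBound₃ x (2 * z) 1)) ≤ 2 * y := by
  obtain ⟨K, hnt, he⟩ := h
  simp only [Prod.mk.injEq] at he
  obtain ⟨rfl, rfl, rfl⟩ := he
  have hR := circumradius_pos K.isCompact hnt
  obtain ⟨h₁, h₂, h₃⟩ := lowerBounds_le_width K.isCompact hnt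
  rw [max_lowerBound_div hR, two_mul_div_two_mul]
  exact div_le_div_of_nonneg_right (max_le h₁ (max_le h₂ h₃)) hR.le

lemma exists_mem_diagram {x z : ℝ} (h : (x, z) ∈ diagramRDR) :
    ∃ y, (x, y, z) ∈ diagram ∧
      2 * y = max (lowerBound₁ x) (max (lowerBound₂ (2 * z) 1) (lowerBound₃ x (2 * z) 1)) := by
  obtain ⟨K, hnt, he⟩ := h
  obtain ⟨rfl, rfl⟩ := Prod.mk.inj he
  have hR := circumradius_pos K.isCompact hnt
  obtain ⟨L, hL, hLc, hLnt, hLr, hLD, hLR, hw⟩ := exists_width_eq K.isCompact K.convex hnt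
  refine ⟨width L / (2 * circumradius K), ⟨⟨L, hLc, hL, hLnt.nonempty⟩, hLnt, ?_⟩, ?_⟩
  · change _ = (inradius L / circumradius L, width L / (2 * circumradius L),
      diameter L / (2 * circumradius L))
    rw [hLr, hLD, hLR]
  · rw [max_lowerBound_div hR, two_mul_div_two_mul, hw]

lemma mem_diagramRDR {x y z : ℝ} (h : (x, y, z) ∈ diagram) : (x, z) ∈ diagramRDR := by
  obtain ⟨K, hnt, he⟩ := h
  simp only [Prod.mk.injEq] at he
  obtain ⟨rfl, rfl, rfl⟩ := he
  exact ⟨K, hnt, rfl⟩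

/-- The third lower bound, singletons included. -/
lemma lowerBound₃_le_width {K : Set Plane} (hK : IsCompact K) (hne : K.Nonempty) :
    lowerBound₃ (inradius K) (diameter K) (circumradius K) ≤ width K := by
  by_cases hnt : K.Nontrivial
  · exact (lowerBounds_le_width hK hnt).2.2
  -- For a singleton the factor D = 0 annihilates the bound, whatever value the divisions by zero
  -- have.
  · have hD : diameter K = 0 := diam_subsingleton (Set.not_nontrivial_iff.1 hnt)
    rw [hD, lowerBound₃, mul_zero, zero_mul, zero_mul]
    exact le_width fun u _ => breadth_nonneg hK hne

lemma lowerBoundary_diagram : lowerBoundary diagram =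
    {q : ℝ × ℝ × ℝ | (q.1, q.2.2) ∈ diagramRDR ∧
      2 * q.2.1 = max (lowerBound₁ q.1)
        (max (lowerBound₂ (2 * q.2.2) 1) (lowerBound₃ q.1 (2 * q.2.2) 1))} := by
  ext ⟨x, y, z⟩
  constructor
  · rintro ⟨hmem, hle⟩
    obtain ⟨y', hy', he⟩ := exists_mem_diagram (mem_diagramRDR hmem)
    refine ⟨mem_diagramRDR hmem, le_antisymm ?_ (le_two_mul_of_mem_diagram hmem)⟩
    rw [← he]
    exact mul_le_mul_of_nonneg_left (hle hy') zero_le_two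
  · rintro ⟨hmem, he⟩
    obtain ⟨y', hy', he'⟩ := exists_mem_diagram hmem
    obtain rfl : y = y' := mul_left_cancel₀ two_ne_zero (he.trans he'.symm)
    refine ⟨hy', fun y'' hy'' => ?_⟩
    have := le_two_mul_of_mem_diagram hy''
    rw [← he'] at this
    exact le_of_mul_le_mul_left this two_pos

end BlaschkeSantalo

/-! ### The theorem -/

open BlaschkeSantalo in
theorem mainTheorem1 :
    -- the inequality, for every planar convex body
    (∀ K : ConvexBody Plane,
      lowerBound₃ (inradius K) (diameter K) (circumradius K) ≤ width K) ∧
    -- equality for the bent pentagons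
    (∀ P : Set Plane, IsBentPentagon P →
      width P = lowerBound₃ (inradius P) (diameter P) (circumradius P)) ∧
    -- the bent pentagons realize the bound wherever it is the largest of the three bounds
    (∀ K : ConvexBody Plane, 0 < inradius K →
      lowerBound₁ (inradius K) ≤
        lowerBound₃ (inradius K) (diameter K) (circumradius K) →
      lowerBound₂ (diameter K) (circumradius K) ≤
        lowerBound₃ (inradius K) (diameter K) (circumradius K) →
      ∃ P : Set Plane, IsBentPentagon P ∧ inradius P = inradius K ∧
        diameter P = diameter K ∧ circumradius P = circumradius K) ∧
    -- the three lower bounds give the full lower boundary of the diagram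
    (lowerBoundary diagram =
      {q : ℝ × ℝ × ℝ | (q.1, q.2.2) ∈ diagramRDR ∧
        2 * q.2.1 = max (lowerBound₁ q.1)
          (max (lowerBound₂ (2 * q.2.2) 1) (lowerBound₃ q.1 (2 * q.2.2) 1))}) := by
  exact ⟨fun K => lowerBound₃_le_width K.isCompact K.nonempty,
    fun P hP => hP.width_eq,
    fun K hr h₁ h₂ => exists_isBentPentagon K.isCompact K.nonempty hr h₁ h₂,
    lowerBoundary_diagram⟩
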